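/- Let $G$ be a finite simple undirected graph on $n$ vertices, and write $N[v]$ for the closed neighbourhood of a vertex $v$. A twin cover of $G$ is a vertex set $S$ such that every edge $\{u,v\}$ has an endpoint in $S$ or satisfies $N[u]=N[v]$; the twin cover number $\tau=\tau(G)$ is the minimum size of a twin cover. For a positive integer $r$, an $r$-grouped dominating set of $G$ is a family of mutually disjoint sets of exactly $r$ vertices (the units), each inducing a connected subgraph of $G$, such that every vertex of $G$ lies in some unit or is adjacent to a vertex of some unit. The problem $r$-Grouped Dominating Set is: given a graph $G$ and positive integers $r$ and $k$, decide whether $G$ has an $r$-grouped dominating set with at most $k$ units. Algorithms are programs of a deterministic random access machine with logarithmic cost (the cost of each step is polynomial in, and at least, the binary length of the numbers and addresses that it handles). The input consists of the adjacency matrix of $G$ and of $n$, $r$ and $k$; its size is $N=n^2+|r|_2+|k|_2$, where $|\cdot|_2$ is the binary length. A running time is $O^*(f)$ if it is at most $f\cdot p(N)$ for a fixed polynomial $p$ that does not depend on the input (in particular not on $r$). Theorem. 1. There is an algorithm that solves $r$-Grouped Dominating Set, for all inputs $(G,r,k)$ with $r,k\ge 1$, in time $O^*\bigl((2\tau(r+1))^{\tau}\bigr)$,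 where $0^0=1$. 2. There is an algorithm that solves $r$-Grouped Dominating Set, for all inputs $(G,r,k)$ with $r\in\{2,3\}$ and $k\ge 1$, in time $O^*\bigl((r+1)^{\tau}\bigr)$. The algorithms are not given a twin cover, nor the number $\tau$. -/

import Mathlib

/-! ### Grouped dominating sets and twin covers -/

namespace GroupedDom

section Graphs

variable {V : Type*}

/-- `S` is a dominating set of `G`: every vertex is in `S` or adjacent to a vertex of `S`. -/
def IsDominatingSet (G : SimpleGraph V) (S : Set V) : Prop :=
  ∀ v, v ∈ S ∨ ∃ u ∈ S, G.Adj v u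

/-- `𝒟` is an `r`-grouped dominating set of `G` (the members of `𝒟` are its units): the units are
mutually disjoint, each has exactly `r` vertices and induces a connected subgraph, and their union
is a dominating set. The number of units is `𝒟.card`. -/
def IsGroupedDominatingSet (G : SimpleGraph V) (r : ℕ) (𝒟 : Finset (Finset V)) : Prop :=
  (∀ D ∈ 𝒟, D.card = r ∧ (G.induce (D : Set V)).Connected) ∧
  (∀ D ∈ 𝒟, ∀ D' ∈ 𝒟, D ≠ D' → Disjoint D D') ∧
  IsDominatingSet G {v | ∃ D ∈ 𝒟, v ∈ D}

/-- The question of `r`-Grouped Dominating Set: does `G` have an `r`-grouped dominating set with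
at most `k` units? -/
def HasGroupedDominatingSet (G : SimpleGraph V) (r k : ℕ) : Prop :=
  ∃ 𝒟 : Finset (Finset V), 𝒟.card ≤ k ∧ IsGroupedDominatingSet G r 𝒟

/-- The closed neighbourhood `N[v]`. -/
def closedNeighborSet (G : SimpleGraph V) (v : V) : Set V :=
  insert v (G.neighborSet v)

/-- `u` and `v` are (true) twins: `N[u] = N[v]`. -/
def AreTwins (G : SimpleGraph V) (u v : V) : Prop :=
  closedNeighborSet G u = closedNeighborSet G v

/-- `S` is a twin cover: every edge joins two true twins or has an endpoint in `S`. -/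
def IsTwinCover (G : SimpleGraph V) (S : Finset V) : Prop :=
  ∀ u v, G.Adj u v → AreTwins G u v ∨ u ∈ S ∨ v ∈ S

/-- The twin cover number: the size of a minimum twin cover. -/
noncomputable def twinCoverNumber [Fintype V] (G : SimpleGraph V) : ℕ :=
  sInf {m : ℕ | ∃ S : Finset V, IsTwinCover G S ∧ S.card = m}

/-- The minimum in the definition of the twin cover number is attained. -/
theorem exists_twinCover_card_eq [Fintype V] (G : SimpleGraph V) :
    ∃ S : Finset V, IsTwinCover G S ∧ S.card = twinCoverNumber G :=
  Nat.sInf_mem (s := {m : ℕ | ∃ S : Finset V, IsTwinCover G S ∧ S.card = m})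
    ⟨_, Finset.univ, fun u _ _ => Or.inr (Or.inl (Finset.mem_univ u)), rfl⟩

end Graphs

/-! ### A random access machine with logarithmic costs

Programs are finite structured programs over natural-number registers and arrays (a program names
only finitely many registers and arrays, and the arrays can be indexed by computed values). Costs
depend on the binary length `Nat.size` of every number that is handled, be it an operand, a result
or an address. -/

/-- A memory state: `reg x` is the content of register `x`, and `arr a i` is the entry with index
`i` of array `a`. -/
structure State where
  reg : ℕ → ℕ
  arr : ℕ → ℕ → ℕ

/-- The elementary binary operations. -/
inductive Op
  | add | sub | mul | div | mod | lt | eq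

/-- Subtraction is truncated, `div` and `mod` are the quotient and the remainder (with the
conventions `m / 0 = 0` and `m % 0 = m`), and comparisons return `1` or `0`. -/
def Op.eval : Op → ℕ → ℕ → ℕ
  | .add, m, n => m + n
  | .sub, m, n => m - n
  | .mul, m, n => m * n
  | .div, m, n => m / n
  | .mod, m, n => m % n
  | .lt, m, n => if m < n then 1 else 0
  | .eq, m, n => if m = n then 1 else 0

/-- Expressions: constants, registers, array entries `a[e]`, and elementary operations. -/
inductive Expr
  | const (c : ℕ)
  | reg (x : ℕ)
  | load (a : ℕ) (e : Expr)
  | op (o : Op) (e₁ e₂ : Expr)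

/-- The value of an expression. -/
def Expr.eval (σ : State) : Expr → ℕ
  | .const c => c
  | .reg x => σ.reg x
  | .load a e => σ.arr a (e.eval σ)
  | .op o e₁ e₂ => o.eval (e₁.eval σ) (e₂.eval σ)

/-- The cost of evaluating an expression. Reading a number costs one plus its length; an array
access also pays for the length of the index; an elementary operation pays for the product of the
operands' lengths, as in schoolbook multiplication and division. -/
def Expr.cost (σ : State) : Expr → ℕ
  | .const c => 1 + c.size
  | .reg x => 1 + (σ.reg x).size
  | .load a e => e.cost σ + (1 + (e.eval σ).size + (σ.arr a (e.eval σ)).size)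
  | .op _ e₁ e₂ => e₁.cost σ + e₂.cost σ + (1 + (e₁.eval σ).size) * (1 + (e₂.eval σ).size)

/-- Programs: `assign x e` is `x := e`, `store a e₁ e₂` is `a[e₁] := e₂`, `ite e P Q` runs `P` if
the value of `e` is non-zero and `Q` otherwise, and `loop e P` runs `P` as long as the value of `e`
is non-zero. -/
inductive Prog
  | skip
  | assign (x : ℕ) (e : Expr)
  | store (a : ℕ) (e₁ e₂ : Expr)
  | seq (P Q : Prog)
  | ite (e : Expr) (P Q : Prog)
  | loop (e : Expr) (P : Prog)

/-- `x := v`. -/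
def State.setReg (σ : State) (x v : ℕ) : State :=
  { σ with reg := Function.update σ.reg x v }

/-- `a[i] := v`. -/
def State.setArr (σ : State) (a i v : ℕ) : State :=
  { σ with arr := Function.update σ.arr a (Function.update (σ.arr a) i v) }

/-- `Runs P σ t σ'`: started in the state `σ`, the program `P` halts in the state `σ'` after time
exactly `t`. -/
inductive Runs : Prog → State → ℕ → State → Prop
  | skip (σ : State) : Runs .skip σ 1 σ
  | assign (σ : State) (x : ℕ) (e : Expr) :
      Runs (.assign x e) σ (e.cost σ + (1 + (e.eval σ).size)) (σ.setReg x (e.eval σ))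
  | store (σ : State) (a : ℕ) (e₁ e₂ : Expr) :
      Runs (.store a e₁ e₂) σ
        (e₁.cost σ + e₂.cost σ + (1 + (e₁.eval σ).size + (e₂.eval σ).size))
        (σ.setArr a (e₁.eval σ) (e₂.eval σ))
  | seq {P Q : Prog} {σ σ₁ σ₂ : State} {t₁ t₂ : ℕ} :
      Runs P σ t₁ σ₁ → Runs Q σ₁ t₂ σ₂ → Runs (.seq P Q) σ (t₁ + t₂) σ₂
  | ite_true {e : Expr} {P Q : Prog} {σ σ' : State} {t : ℕ} :
      e.eval σ ≠ 0 → Runs P σ t σ' → Runs (.ite e P Q) σ (e.cost σ + 1 + t) σ'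
  | ite_false {e : Expr} {P Q : Prog} {σ σ' : State} {t : ℕ} :
      e.eval σ = 0 → Runs Q σ t σ' → Runs (.ite e P Q) σ (e.cost σ + 1 + t) σ'
  | loop_done {e : Expr} {P : Prog} {σ : State} :
      e.eval σ = 0 → Runs (.loop e P) σ (e.cost σ + 1) σ
  | loop_step {e : Expr} {P : Prog} {σ σ₁ σ₂ : State} {t₁ t₂ : ℕ} :
      e.eval σ ≠ 0 → Runs P σ t₁ σ₁ → Runs (.loop e P) σ₁ t₂ σ₂ →
      Runs (.loop e P) σ (e.cost σ + 1 + t₁ + t₂) σ₂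

/-- The machine is deterministic: the time and the final state are determined by the program and
the initial state. -/
theorem Runs.deterministic {P : Prog} {σ σ₁ : State} {t₁ : ℕ} (h₁ : Runs P σ t₁ σ₁) :
    ∀ {t₂ : ℕ} {σ₂ : State}, Runs P σ t₂ σ₂ → t₁ = t₂ ∧ σ₁ = σ₂ := by
  induction h₁ with
  | skip σ => intro _ _ h; cases h; exact ⟨rfl, rfl⟩
  | assign σ x e => intro _ _ h; cases h; exact ⟨rfl, rfl⟩
  | store σ a e₁ e₂ => intro _ _ h; cases h; exact ⟨rfl, rfl⟩
  | seq _ _ ih₁ ih₂ =>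
    intro _ _ h
    cases h with
    | seq g₁ g₂ =>
      obtain ⟨rfl, rfl⟩ := ih₁ g₁
      obtain ⟨rfl, rfl⟩ := ih₂ g₂
      exact ⟨rfl, rfl⟩
  | ite_true he _ ih =>
    intro _ _ h
    cases h with
    | ite_true _ g => obtain ⟨rfl, rfl⟩ := ih g; exact ⟨rfl, rfl⟩
    | ite_false he' _ => exact absurd he' he
  | ite_false he _ ih =>
    intro _ _ h
    cases h with
    | ite_true he' _ => exact absurd he he'
    | ite_false _ g => obtain ⟨rfl, rfl⟩ := ih g; exact ⟨rfl, rfl⟩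
  | loop_done he =>
    intro _ _ h
    cases h with
    | loop_done _ => exact ⟨rfl, rfl⟩
    | loop_step he' _ _ => exact absurd he he'
  | loop_step he _ _ ih₁ ih₂ =>
    intro _ _ h
    cases h with
    | loop_done he' => exact absurd he' he
    | loop_step _ g₁ g₂ =>
      obtain ⟨rfl, rfl⟩ := ih₁ g₁
      obtain ⟨rfl, rfl⟩ := ih₂ g₂
      exact ⟨rfl, rfl⟩

/-! ### The computational problem -/

open Classical in
/-- The initial state for the input `(G, r, k)`, where `G` is a graph on the vertex set
`{0, …, n - 1}`: registers `0`, `1`, `2` hold `n`, `r`, `k`, array `0` holds the adjacency matrix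
of `G` row by row (the entry with index `u * n + v` is `1` if `u` and `v` are adjacent), and
everything else is `0`. -/
noncomputable def initState {n : ℕ} (G : SimpleGraph (Fin n)) (r k : ℕ) : State where
  reg x := if x = 0 then n else if x = 1 then r else if x = 2 then k else 0
  arr a i :=
    if a = 0 ∧ ∃ u v : Fin n, G.Adj u v ∧ i = (u : ℕ) * n + (v : ℕ) then 1 else 0

/-- The input size in bits: the adjacency matrix, and `r` and `k` in binary. -/
def inputSize (n r k : ℕ) : ℕ := n * n + r.size + k.size

open Classical in
/-- `r`-Grouped Dominating Set, restricted to the inputs with `r ∈ R`, can be solved in time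
`O*(f τ r)`, where `τ` is the twin cover number of the input graph: a single program decides all
these inputs (leaving the answer `1` for yes and `0` for no in register `0`), in time at most
`f τ r` times a polynomial in the input size. The polynomial does not depend on the input; in
particular it does not depend on `r`. -/
def SolvableInOStar (R : Set ℕ) (f : ℕ → ℕ → ℕ) : Prop :=
  ∃ (P : Prog) (p : Polynomial ℕ),
    ∀ (n : ℕ) (G : SimpleGraph (Fin n)) (r k : ℕ), r ∈ R → 1 ≤ r → 1 ≤ k →
      ∃ (t : ℕ) (σ : State), Runs P (initState G r k) t σ ∧
        t ≤ f (twinCoverNumber G) r * p.eval (inputSize n r k) ∧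
        σ.reg 0 = if HasGroupedDominatingSet G r k then 1 else 0

end GroupedDom

/-!
Grouped dominating sets are decided by a dynamic program over a minimum twin cover `S`.

In `G - S` every connected component is a clique of true twins (`IsTwinCover.adj_of_mem_clq`), and
all its vertices have the same neighbours in `S`. A partial solution can therefore be described by
little data (`Config`, `Matches`): for each `v ∈ S` whether it is undominated, dominated, in a
finished unit, or in an unfinished fragment together with the name `ℓ ∈ S` of the fragment; for each
name the size of the fragment; and a few numbers that are at most `n`. The cliques of `G - S` are
processed one after the other, and only the number of used vertices of the current clique is
remembered. At the end (`Config.Accept`), a clique without neighbours in units needs a unit of its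
own, and one unit suffices for it. The program is sound because each move acts on partial solutions
(`Reach.exists_matches`, `Matches.hasGroupedDominatingSet`), and complete because a given solution
can be built up within the cliques, vertex by vertex
(`HasGroupedDominatingSet.exists_accept`).

There are at most `((τ + 3)(r + 1)) ^ τ` configurations up to a polynomial factor
(`exists_configs`), and `(τ + 3) ^ τ ≤ 2 (2 τ) ^ τ`. For `r ∈ {2, 3}` the solution can be built up
such that in between at most one unit is in an arbitrary state. Each other unfinished unit then
consists of one vertex of `S` and one vertex outside `S`, where `r = 3`. Hence all but three
vertices of `S` have only `r + 1` possible labels, with determined fragment sizes, and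
`(r + 1) ^ τ` configurations remain up to a polynomial factor (`Matches.tidy`,
`exists_configs_tidy`). Both running times are thus achieved by the same program.

On the machine, configurations are numbers in base `n + 4` (`Config.code`), and the reached ones are
enumerated by a search that uses an array, indexed by codes, to recognize known configurations
(`exec_searchProg`); with logarithmic costs, an access costs only the length of the code. A minimum
twin cover is found by a bounded search tree (`exec_coverProg`): each edge that violates the
definition requires one of its two ends, and the binary digits of a number `m < 2 ^ (τ + 1)` tell
which. This takes time `O*(2 ^ τ)`. Programs are written with the help of expressions that contain
conditionals and bounded sums (`XExpr`), compiled to the machine with polynomial overhead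
(`XExpr.runs_compile`).
-/

namespace GroupedDom

open Finset

/-! ### Expressions with bounded sums -/

/-- Functions bounded by a polynomial with natural coefficients. -/
def PolyBdd (f : ℕ → ℕ) : Prop := ∃ p : Polynomial ℕ, ∀ x, f x ≤ p.eval x

namespace PolyBdd

theorem const (c : ℕ) : PolyBdd fun _ => c := ⟨Polynomial.C c, by simp⟩

theorem id : PolyBdd fun x => x := ⟨Polynomial.X, by simp⟩

theorem add {f g : ℕ → ℕ} (hf : PolyBdd f) (hg : PolyBdd g) : PolyBdd fun x => f x + g x := by
  obtain ⟨p, hp⟩ := hf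
  obtain ⟨q, hq⟩ := hg
  exact ⟨p + q, fun x => by simpa using add_le_add (hp x) (hq x)⟩

theorem mul {f g : ℕ → ℕ} (hf : PolyBdd f) (hg : PolyBdd g) : PolyBdd fun x => f x * g x := by
  obtain ⟨p, hp⟩ := hf
  obtain ⟨q, hq⟩ := hg
  exact ⟨p * q, fun x => by simpa using Nat.mul_le_mul (hp x) (hq x)⟩

theorem monotone_eval (p : Polynomial ℕ) : Monotone fun x => p.eval x := by
  intro a b hab
  simp only [Polynomial.eval_eq_sum, Polynomial.sum]
  gcongr

theorem comp {f g : ℕ → ℕ} (hf : PolyBdd f) (hg : PolyBdd g) : PolyBdd fun x => f (g x) := by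
  obtain ⟨p, hp⟩ := hf
  obtain ⟨q, hq⟩ := hg
  exact ⟨p.comp q, fun x => by simpa using (hp _).trans (monotone_eval p (hq x))⟩

end PolyBdd

/-- Expressions of the machine enriched by conditionals and by sums `∑ x < n, e` in which the
summation variable is a register `x` and the bound `n` is the content of register `0`. -/
inductive XExpr
  | const (c : ℕ)
  | reg (x : ℕ)
  | load (a : ℕ) (e : XExpr)
  | op (o : Op) (e₁ e₂ : XExpr)
  | ite (e a b : XExpr)
  | sum (x : ℕ) (e : XExpr)

namespace XExpr

/-- The value of an extended expression. -/
def eval : XExpr → State → ℕ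
  | const c, _ => c
  | reg x, σ => σ.reg x
  | load a e, σ => σ.arr a (e.eval σ)
  | op o e₁ e₂, σ => o.eval (e₁.eval σ) (e₂.eval σ)
  | ite e a b, σ => if e.eval σ ≠ 0 then a.eval σ else b.eval σ
  | sum x e, σ => ∑ i ∈ range (σ.reg 0), e.eval (σ.setReg x i)

/-- All registers of the expression are below `64`, and register `0` is no summation variable. -/
def ok64 : XExpr → Bool
  | const _ => true
  | reg x => decide (x < 64)
  | load _ e => e.ok64
  | op _ e₁ e₂ => e₁.ok64 && e₂.ok64
  | ite e a b => e.ok64 && a.ok64 && b.ok64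
  | sum x e => decide (x < 64) && decide (x ≠ 0) && e.ok64

/-- A program that leaves the value of the expression in register `d`, where `64 ≤ d`, and that
changes no register below `d`. -/
def compile : XExpr → ℕ → Prog
  | const c, d => .assign d (.const c)
  | reg x, d => .assign d (.reg x)
  | load a e, d => .seq (e.compile d) (.assign d (.load a (.reg d)))
  | op o e₁ e₂, d =>
    .seq (e₁.compile d) (.seq (e₂.compile (d + 1)) (.assign d (.op o (.reg d) (.reg (d + 1)))))
  | ite e a b, d => .seq (e.compile d) (.ite (.reg d) (a.compile d) (b.compile d))
  | sum x e, d =>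
    .seq (.assign d (.const 0)) <| .seq (.assign (d + 1) (.reg x)) <| .seq (.assign x (.const 0)) <|
      .seq
        (.loop (.op .lt (.reg x) (.reg 0)) <|
          .seq (e.compile (d + 2)) <|
            .seq (.assign d (.op .add (.reg d) (.reg (d + 2))))
              (.assign x (.op .add (.reg x) (.const 1))))
        (.assign x (.reg (d + 1)))

/-- A bound for the binary length of the value, if the numbers in memory have length at most `w`
and register `0` holds a number that is at most `w`. -/
def sizeBound : XExpr → ℕ → ℕ
  | const c, _ => c.size
  | reg _, w => w
  | load _ _, w => w
  | op _ e₁ e₂, w => e₁.sizeBound w + e₂.sizeBound w + 1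
  | ite _ a b, w => a.sizeBound w + b.sizeBound w
  | sum _ e, w => w + e.sizeBound w

/-- A bound for the running time of the compiled expression, under the same assumptions. -/
def costBound : XExpr → ℕ → ℕ
  | const c, _ => 2 + 2 * c.size
  | reg _, w => 2 + 2 * w
  | load _ e, w => e.costBound w + (3 + 2 * e.sizeBound w + 2 * w)
  | op _ e₁ e₂, w => e₁.costBound w + e₂.costBound w +
      (5 + 2 * (e₁.sizeBound w + e₂.sizeBound w) +
        (1 + e₁.sizeBound w) * (1 + e₂.sizeBound w))
  | ite e a b, w => e.costBound w + (2 + e.sizeBound w) + (a.costBound w + b.costBound w)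
  | sum _ e, w => 10 + 4 * w + (2 + 2 * w + (1 + w) * (1 + w) + 1) +
      w * ((2 + 2 * w + (1 + w) * (1 + w) + 1) + e.costBound w +
        (10 + 4 * (w + e.sizeBound w) + 4 * w + (2 + w + e.sizeBound w) * (2 + w + e.sizeBound w)))

theorem polyBdd_sizeBound (e : XExpr) : PolyBdd e.sizeBound := by
  induction e with
  | const c => exact .const _
  | reg x => exact .id
  | load a e _ => exact .id
  | op o e₁ e₂ h₁ h₂ => exact (h₁.add h₂).add (.const 1)
  | ite e a b _ ha hb => exact ha.add hb
  | sum x e h => exact PolyBdd.id.add h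

theorem polyBdd_costBound (e : XExpr) : PolyBdd e.costBound := by
  have c := PolyBdd.const
  have w := PolyBdd.id
  induction e with
  | const _ => exact .const _
  | reg x => exact (c 2).add ((c 2).mul w)
  | load a e h =>
    exact h.add (((c 3).add ((c 2).mul e.polyBdd_sizeBound)).add ((c 2).mul w))
  | op o e₁ e₂ h₁ h₂ =>
    have s₁ := e₁.polyBdd_sizeBound
    have s₂ := e₂.polyBdd_sizeBound
    exact (h₁.add h₂).add
      (((c 5).add ((c 2).mul (s₁.add s₂))).add (((c 1).add s₁).mul ((c 1).add s₂)))
  | ite e a b he ha hb => exact (he.add ((c 2).add e.polyBdd_sizeBound)).add (ha.add hb)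
  | sum x e h =>
    have s := e.polyBdd_sizeBound
    have t := (((c 2).add ((c 2).mul w)).add (((c 1).add w).mul ((c 1).add w))).add (c 1)
    have u := ((c 2).add w).add s
    exact (((c 10).add ((c 4).mul w)).add t).add (w.mul ((t.add h).add
      ((((c 10).add ((c 4).mul (w.add s))).add ((c 4).mul w)).add (u.mul u))))

end XExpr

/-- Two states that agree on the arrays and on the registers below `64`; the others are scratch
registers. -/
def State.Eqv (σ τ : State) : Prop := (∀ x < 64, σ.reg x = τ.reg x) ∧ σ.arr = τ.arr

/-- `w` bounds the content of register `0` and the binary length of all array entries and of the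
registers below `64`. -/
structure State.Bdd (w : ℕ) (σ : State) : Prop where
  zero : σ.reg 0 ≤ w
  reg : ∀ x < 64, (σ.reg x).size ≤ w
  arr : ∀ a i, (σ.arr a i).size ≤ w

@[simp] theorem State.setReg_reg (σ : State) (x v y : ℕ) :
    (σ.setReg x v).reg y = if y = x then v else σ.reg y := by
  simp [State.setReg, Function.update_apply]

@[simp] theorem State.setReg_arr (σ : State) (x v : ℕ) : (σ.setReg x v).arr = σ.arr := rfl

@[simp] theorem State.setArr_reg (σ : State) (a i v : ℕ) : (σ.setArr a i v).reg = σ.reg := rfl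

@[simp] theorem State.setArr_arr (σ : State) (a i v b j : ℕ) :
    (σ.setArr a i v).arr b j = if b = a ∧ j = i then v else σ.arr b j := by
  by_cases hb : b = a
  · subst hb; simp [State.setArr, Function.update_apply]
  · simp [State.setArr, hb]

namespace State.Eqv

theorem refl (σ : State) : σ.Eqv σ := ⟨fun _ _ => rfl, rfl⟩

theorem trans {σ τ υ : State} (h : σ.Eqv τ) (h' : τ.Eqv υ) : σ.Eqv υ :=
  ⟨fun x hx => (h.1 x hx).trans (h'.1 x hx), h.2.trans h'.2⟩

theorem setReg {σ τ : State} (h : σ.Eqv τ) (x v : ℕ) : (σ.setReg x v).Eqv (τ.setReg x v) :=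
  ⟨fun y hy => by simp [h.1 y hy], h.2⟩

theorem setArr {σ τ : State} (h : σ.Eqv τ) (a i v : ℕ) :
    (σ.setArr a i v).Eqv (τ.setArr a i v) :=
  ⟨fun y hy => by simp [h.1 y hy], by ext b j; simp [h.2]⟩

theorem bdd {σ τ : State} (h : σ.Eqv τ) {w : ℕ} (hw : τ.Bdd w) : σ.Bdd w :=
  ⟨by rw [h.1 0 (by norm_num)]; exact hw.zero, fun x hx => by rw [h.1 x hx]; exact hw.reg x hx,
    by rw [h.2]; exact hw.arr⟩

end State.Eqv

theorem State.Bdd.setReg {w : ℕ} {σ : State} (h : σ.Bdd w) {x v : ℕ} (hx : x ≠ 0)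
    (hv : v.size ≤ w) : (σ.setReg x v).Bdd w :=
  ⟨by simpa [hx.symm] using h.zero,
    fun y hy => by simp only [State.setReg_reg]; split_ifs; exacts [hv, h.reg y hy], h.arr⟩

theorem State.Bdd.setArr {w : ℕ} {σ : State} (h : σ.Bdd w) {a i v : ℕ} (hv : v.size ≤ w) :
    (σ.setArr a i v).Bdd w :=
  ⟨h.zero, h.reg, fun b j => by
    simp only [State.setArr_arr]; split_ifs; exacts [hv, h.arr b j]⟩

theorem size_add_le (a b : ℕ) : (a + b).size ≤ a.size + b.size + 1 := by
  rw [Nat.size_le]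
  have ha := Nat.size_le.1 (le_refl a.size)
  have hb := Nat.size_le.1 (le_refl b.size)
  have h1 : 2 ^ a.size ≤ 2 ^ (a.size + b.size) := Nat.pow_le_pow_right (by norm_num) (by omega)
  have h2 : 2 ^ b.size ≤ 2 ^ (a.size + b.size) := Nat.pow_le_pow_right (by norm_num) (by omega)
  rw [pow_succ]
  omega

theorem size_mul_le (a b : ℕ) : (a * b).size ≤ a.size + b.size := by
  rw [Nat.size_le, pow_add]
  exact Nat.mul_lt_mul'' (Nat.size_le.1 le_rfl) (Nat.size_le.1 le_rfl)

theorem size_le_self (a : ℕ) : a.size ≤ a := Nat.size_le.2 Nat.lt_two_pow_self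

theorem Op.size_eval_le (o : Op) (a b : ℕ) : (o.eval a b).size ≤ a.size + b.size + 1 := by
  cases o with
  | add => exact size_add_le a b
  | sub => exact (Nat.size_le_size (Nat.sub_le a b)).trans (by omega)
  | mul => exact (size_mul_le a b).trans (by omega)
  | div => exact (Nat.size_le_size (Nat.div_le_self a b)).trans (by omega)
  | mod => exact (Nat.size_le_size (Nat.mod_le a b)).trans (by omega)
  | lt => simp only [Op.eval]; split_ifs <;> simp
  | eq => simp only [Op.eval]; split_ifs <;> simp

namespace XExpr

theorem eval_congr (e : XExpr) (he : e.ok64) {σ τ : State} (h : σ.Eqv τ) :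
    e.eval σ = e.eval τ := by
  induction e generalizing σ τ with
  | const c => rfl
  | reg x => exact h.1 x (by simpa [ok64] using he)
  | load a e ih => simp only [eval, ih he h, h.2]
  | op o e₁ e₂ h₁ h₂ =>
    simp only [ok64, Bool.and_eq_true] at he
    simp only [eval, h₁ he.1 h, h₂ he.2 h]
  | ite e a b ih ha hb =>
    simp only [ok64, Bool.and_eq_true] at he
    simp only [eval, ih he.1.1 h, ha he.1.2 h, hb he.2 h]
  | sum x e ih =>
    simp only [ok64, Bool.and_eq_true] at he
    simp only [eval, h.1 0 (by norm_num)]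
    exact Finset.sum_congr rfl fun i _ => ih he.2 (h.setReg x i)

theorem size_eval_le (e : XExpr) (he : e.ok64) {σ : State} {w : ℕ} (h : σ.Bdd w) :
    (e.eval σ).size ≤ e.sizeBound w := by
  induction e generalizing σ with
  | const c => exact le_rfl
  | reg x => exact h.reg x (by simpa [ok64] using he)
  | load a e ih => exact h.arr _ _
  | op o e₁ e₂ h₁ h₂ =>
    simp only [ok64, Bool.and_eq_true] at he
    have := o.size_eval_le (e₁.eval σ) (e₂.eval σ)
    have := h₁ he.1 h
    have := h₂ he.2 h
    simp only [eval, sizeBound]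
    omega
  | ite e a b ih ha hb =>
    simp only [ok64, Bool.and_eq_true] at he
    have := ha he.1.2 h
    have := hb he.2 h
    simp only [eval, sizeBound]
    split_ifs <;> omega
  | sum x e ih =>
    simp only [ok64, Bool.and_eq_true, decide_eq_true_eq] at he
    simp only [eval, sizeBound]
    have key : ∑ i ∈ range (σ.reg 0), e.eval (σ.setReg x i) ≤ σ.reg 0 * 2 ^ e.sizeBound w := by
      refine (Finset.sum_le_card_nsmul _ _ (2 ^ e.sizeBound w) fun i hi => ?_).trans (by simp)
      have hi' : i ≤ w := (Finset.mem_range.1 hi).le.trans h.zero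
      exact (Nat.size_le.1 (ih he.2 (h.setReg he.1.2 ((size_le_self i).trans hi')))).le
    refine (Nat.size_le_size key).trans ?_
    rw [Nat.size_le, pow_add]
    exact Nat.mul_lt_mul_of_pos_right
      (lt_of_lt_of_le Nat.lt_two_pow_self (Nat.pow_le_pow_right (by norm_num) h.zero))
      (by positivity)

end XExpr

/-- Two states that agree on the arrays and on the registers below `d`. -/
def State.EqvBelow (d : ℕ) (σ τ : State) : Prop := (∀ x < d, σ.reg x = τ.reg x) ∧ σ.arr = τ.arr

theorem State.EqvBelow.eqv {d : ℕ} {σ τ : State} (h : σ.EqvBelow d τ) (hd : 64 ≤ d) : σ.Eqv τ :=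
  ⟨fun x hx => h.1 x (by omega), h.2⟩

theorem State.EqvBelow.mono {d d' : ℕ} {σ τ : State} (h : σ.EqvBelow d τ) (hd : d' ≤ d) :
    σ.EqvBelow d' τ :=
  ⟨fun x hx => h.1 x (by omega), h.2⟩

theorem State.EqvBelow.trans {d : ℕ} {σ τ υ : State} (h : σ.EqvBelow d τ) (h' : τ.EqvBelow d υ) :
    σ.EqvBelow d υ :=
  ⟨fun x hx => (h.1 x hx).trans (h'.1 x hx), h.2.trans h'.2⟩

theorem State.eqvBelow_setReg (d : ℕ) (σ : State) (v : ℕ) : (σ.setReg d v).EqvBelow d σ :=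
  ⟨fun x hx => by simp [hx.ne], rfl⟩

namespace XExpr

/-- The loop in the compiled code of a sum: it adds the remaining summands `i, …, n - 1`. -/
theorem runs_sum_loop {x d w : ℕ} {e : XExpr} (hx : x < 64) (hx0 : x ≠ 0) (he : e.ok64)
    (hd : 64 ≤ d) {σ : State} (hσ : σ.Bdd w)
    (ih : ∀ {τ : State}, τ.Bdd w → ∃ t τ', Runs (e.compile (d + 2)) τ t τ' ∧
      t ≤ e.costBound w ∧ τ'.EqvBelow (d + 2) τ ∧ τ'.reg (d + 2) = e.eval τ)
    (m : ℕ) : ∀ (i : ℕ) (τ : State), i + m = σ.reg 0 → τ.EqvBelow d (σ.setReg x i) →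
      τ.reg d = ∑ j ∈ range i, e.eval (σ.setReg x j) → ∃ t τ',
      Runs (.loop (.op .lt (.reg x) (.reg 0)) (.seq (e.compile (d + 2))
        (.seq (.assign d (.op .add (.reg d) (.reg (d + 2))))
          (.assign x (.op .add (.reg x) (.const 1)))))) τ t τ' ∧
      t ≤ (2 + 2 * w + (1 + w) * (1 + w) + 1) +
        m * ((2 + 2 * w + (1 + w) * (1 + w) + 1) + e.costBound w +
        (10 + 4 * (w + e.sizeBound w) + 4 * w +
          (2 + w + e.sizeBound w) * (2 + w + e.sizeBound w))) ∧
      τ'.EqvBelow d (σ.setReg x (σ.reg 0)) ∧ τ'.reg (d + 1) = τ.reg (d + 1) ∧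
      τ'.reg d = ∑ j ∈ range (σ.reg 0), e.eval (σ.setReg x j) := by
  induction m with
  | zero =>
    intro i τ hi hτ hsum
    obtain rfl : i = σ.reg 0 := by omega
    have h0 : τ.reg 0 = σ.reg 0 := by rw [hτ.1 0 (by omega)]; simp [hx0.symm]
    have h1 : τ.reg x = σ.reg 0 := by rw [hτ.1 x (by omega)]; simp
    refine ⟨_, _, Runs.loop_done ?_, ?_, hτ, rfl, hsum⟩
    · simp [Expr.eval, Op.eval, h0, h1]
    · simp only [Expr.cost, Expr.eval, h0, h1, zero_mul, add_zero]
      have := hσ.reg 0 (by norm_num)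
      have := Nat.mul_le_mul (Nat.add_le_add_left this 1) (Nat.add_le_add_left this 1)
      omega
  | succ m ihm =>
    intro i τ hi hτ hsum
    have h0 : τ.reg 0 = σ.reg 0 := by rw [hτ.1 0 (by omega)]; simp [hx0.symm]
    have h1 : τ.reg x = i := by rw [hτ.1 x (by omega)]; simp
    have hiw : i ≤ w := by have := hσ.zero; omega
    have his : i.size ≤ w := (size_le_self i).trans hiw
    have hb : (σ.setReg x i).Bdd w := hσ.setReg hx0 his
    obtain ⟨t₁, τ₁, r₁, ht₁, he₁, hv₁⟩ := ih ((hτ.eqv hd).bdd hb)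
    have hval : τ₁.reg (d + 2) = e.eval (σ.setReg x i) := by
      rw [hv₁]; exact e.eval_congr he (hτ.eqv hd)
    have hd₁ : τ₁.reg d = ∑ j ∈ range i, e.eval (σ.setReg x j) := by
      rw [he₁.1 d (by omega), hsum]
    have hsize : (∑ j ∈ range i, e.eval (σ.setReg x j)).size ≤ w + e.sizeBound w := by
      refine (Nat.size_le_size (m := ∑ j ∈ range i, e.eval (σ.setReg x j)) ?_).trans
        (size_eval_le (.sum x e) (by simp [ok64, hx, hx0, he]) hσ)
      exact Finset.sum_le_sum_of_subset (by simpa using by omega)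
    have hsize' : (e.eval (σ.setReg x i)).size ≤ e.sizeBound w := size_eval_le e he hb
    set τ₂ := τ₁.setReg d (τ₁.reg d + τ₁.reg (d + 2)) with hτ₂
    have r₂ : Runs (.assign d (.op .add (.reg d) (.reg (d + 2)))) τ₁ _ τ₂ :=
      Runs.assign τ₁ d (.op .add (.reg d) (.reg (d + 2)))
    have hx₂ : τ₂.reg x = i := by
      simp only [hτ₂, State.setReg_reg, if_neg (show x ≠ d by omega)]
      rw [he₁.1 x (by omega), h1]
    set τ₃ := τ₂.setReg x (τ₂.reg x + 1) with hτ₃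
    have r₃ : Runs (.assign x (.op .add (.reg x) (.const 1))) τ₂ _ τ₃ :=
      Runs.assign τ₂ x (.op .add (.reg x) (.const 1))
    have hτ₃' : τ₃.EqvBelow d (σ.setReg x (i + 1)) := by
      refine ⟨fun y hy => ?_, ?_⟩
      · simp only [hτ₃, hτ₂, State.setReg_reg]
        by_cases hyx : y = x
        · simp [hyx, show x ≠ d by omega, he₁.1 x (show x < d + 2 by omega), h1]
        · simp only [if_neg hyx, if_neg hy.ne]
          rw [he₁.1 y (by omega), hτ.1 y hy]
          simp [hyx]
      · simp only [hτ₃, hτ₂, State.setReg_arr]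
        rw [he₁.2, hτ.2]; rfl
    obtain ⟨t₄, τ₄, r₄, ht₄, he₄, hv₄, hs₄⟩ := ihm (i + 1) τ₃ (by omega) hτ₃' (by
      simp only [hτ₃, hτ₂, State.setReg_reg, if_neg (show d ≠ x by omega), if_true]
      rw [Finset.sum_range_succ, hd₁, hval])
    refine ⟨_, _, Runs.loop_step ?_ (Runs.seq r₁ (Runs.seq r₂ r₃)) r₄, ?_, he₄, ?_, hs₄⟩
    · simp only [Expr.eval, Op.eval, h0, h1]
      rw [if_pos (by omega)]; norm_num
    · simp only [Expr.cost, Expr.eval, Op.eval, h0, h1, hx₂, hd₁, hval]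
      generalize (∑ j ∈ range i, e.eval (σ.setReg x j)) = A at *
      generalize e.eval (σ.setReg x i) = A' at *
      have b1 := size_add_le A A'
      have b2 := size_add_le i 1
      have b3 := hσ.reg 0 (by norm_num)
      have b4 : Nat.size 1 = 1 := Nat.size_one
      have b5 := Nat.mul_le_mul (Nat.add_le_add_left his 1) (Nat.add_le_add_left b3 1)
      have b6 : (1 + A.size) * (1 + A'.size) ≤
          (1 + w + e.sizeBound w) * (1 + w + e.sizeBound w) :=
        Nat.mul_le_mul (by omega) (by omega)
      rw [Nat.add_mul m 1, one_mul]
      rw [b4] at b2 ⊢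
      generalize m * _ = Z at *
      generalize (1 + i.size) * (1 + (σ.reg 0).size) = Z1 at *
      generalize (1 + A.size) * (1 + A'.size) = Z2 at *
      nlinarith
    · rw [hv₄]
      simp only [hτ₃, hτ₂, State.setReg_reg, if_neg (show d + 1 ≠ x by omega),
        if_neg (show d + 1 ≠ d by omega)]
      exact he₁.1 (d + 1) (by omega)

/-- Correctness and running time of the compiled code of an expression. -/
theorem runs_compile (e : XExpr) (he : e.ok64) {d : ℕ} (hd : 64 ≤ d) {σ : State} {w : ℕ}
    (hσ : σ.Bdd w) : ∃ t τ, Runs (e.compile d) σ t τ ∧ t ≤ e.costBound w ∧ τ.EqvBelow d σ ∧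
      τ.reg d = e.eval σ := by
  induction e generalizing σ d with
  | const c =>
    refine ⟨_, _, Runs.assign σ d (.const c), ?_, σ.eqvBelow_setReg d _, by simp [eval, Expr.eval]⟩
    simp only [Expr.cost, Expr.eval, costBound]; omega
  | reg x =>
    refine ⟨_, _, Runs.assign σ d (.reg x), ?_, σ.eqvBelow_setReg d _, by simp [eval, Expr.eval]⟩
    have := hσ.reg x (by simpa [ok64] using he)
    simp only [Expr.cost, Expr.eval, costBound]; omega
  | load a e ih =>
    obtain ⟨t, τ, r, ht, hτ, hv⟩ := ih he hd hσ
    refine ⟨_, _, Runs.seq r (Runs.assign τ d (.load a (.reg d))), ?_,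
      (τ.eqvBelow_setReg d _).trans hτ, by simp [eval, Expr.eval, hv, hτ.2]⟩
    have h1 := size_eval_le e he hσ
    have h2 := hσ.arr a (e.eval σ)
    simp only [Expr.cost, Expr.eval, costBound, hv, hτ.2]
    omega
  | op o e₁ e₂ h₁ h₂ =>
    simp only [ok64, Bool.and_eq_true] at he
    obtain ⟨t₁, τ₁, r₁, ht₁, hτ₁, hv₁⟩ := h₁ he.1 hd hσ
    obtain ⟨t₂, τ₂, r₂, ht₂, hτ₂, hv₂⟩ := h₂ he.2 (d := d + 1) (by omega) ((hτ₁.eqv hd).bdd hσ)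
    have hv₂' : τ₂.reg (d + 1) = e₂.eval σ := by rw [hv₂, e₂.eval_congr he.2 (hτ₁.eqv hd)]
    have hv₁' : τ₂.reg d = e₁.eval σ := by rw [hτ₂.1 d (by omega), hv₁]
    refine ⟨_, _, Runs.seq r₁ (Runs.seq r₂ (Runs.assign τ₂ d (.op o (.reg d) (.reg (d + 1))))), ?_,
      ((τ₂.eqvBelow_setReg d _).trans (hτ₂.mono (by omega))).trans hτ₁,
      by simp [eval, Expr.eval, hv₁', hv₂']⟩
    have s₁ := size_eval_le e₁ he.1 hσ
    have s₂ := size_eval_le e₂ he.2 hσ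
    have s₃ := o.size_eval_le (e₁.eval σ) (e₂.eval σ)
    have s₄ := Nat.mul_le_mul (Nat.add_le_add_left s₁ 1) (Nat.add_le_add_left s₂ 1)
    simp only [Expr.cost, Expr.eval, costBound, hv₁', hv₂']
    omega
  | ite e a b ih ha hb =>
    simp only [ok64, Bool.and_eq_true] at he
    obtain ⟨t₁, τ₁, r₁, ht₁, hτ₁, hv₁⟩ := ih he.1.1 hd hσ
    have s₁ := size_eval_le e he.1.1 hσ
    by_cases h0 : e.eval σ = 0
    · obtain ⟨t₂, τ₂, r₂, ht₂, hτ₂, hv₂⟩ := hb he.2 hd ((hτ₁.eqv hd).bdd hσ)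
      refine ⟨_, _, Runs.seq r₁ (Runs.ite_false (by simp [Expr.eval, hv₁, h0]) r₂), ?_,
        hτ₂.trans hτ₁, ?_⟩
      · simp only [Expr.cost, costBound, hv₁]; omega
      · rw [hv₂, b.eval_congr he.2 (hτ₁.eqv hd)]; simp [eval, h0]
    · obtain ⟨t₂, τ₂, r₂, ht₂, hτ₂, hv₂⟩ := ha he.1.2 hd ((hτ₁.eqv hd).bdd hσ)
      refine ⟨_, _, Runs.seq r₁ (Runs.ite_true (by simp [Expr.eval, hv₁, h0]) r₂), ?_,
        hτ₂.trans hτ₁, ?_⟩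
      · simp only [Expr.cost, costBound, hv₁]; omega
      · rw [hv₂, a.eval_congr he.1.2 (hτ₁.eqv hd)]; simp [eval, h0]
  | sum x e ih =>
    simp only [ok64, Bool.and_eq_true, decide_eq_true_eq] at he
    obtain ⟨⟨hx, hx0⟩, he⟩ := he
    set σ₁ := σ.setReg d 0 with hσ₁
    set σ₂ := σ₁.setReg (d + 1) (σ₁.reg x) with hσ₂
    set σ₃ := σ₂.setReg x 0 with hσ₃
    have r₁ : Runs (.assign d (.const 0)) σ _ σ₁ := Runs.assign σ d (.const 0)
    have r₂ : Runs (.assign (d + 1) (.reg x)) σ₁ _ σ₂ := Runs.assign σ₁ (d + 1) (.reg x)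
    have r₃ : Runs (.assign x (.const 0)) σ₂ _ σ₃ := Runs.assign σ₂ x (.const 0)
    have hx₁ : σ₁.reg x = σ.reg x := by simp [hσ₁, show x ≠ d by omega]
    have h₃ : σ₃.EqvBelow d (σ.setReg x 0) := by
      refine ⟨fun y hy => ?_, rfl⟩
      simp only [hσ₃, hσ₂, hσ₁, State.setReg_reg]
      split_ifs <;> first | rfl | omega
    obtain ⟨t₄, τ₄, r₄, ht₄, he₄, hv₄, hs₄⟩ := runs_sum_loop hx hx0 he hd hσ
      (fun hτ => ih he (by omega) hτ) (σ.reg 0) 0 σ₃ (by simp) h₃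
      (by simp [hσ₃, hσ₂, hσ₁, show d ≠ x by omega])
    have hsave : τ₄.reg (d + 1) = σ.reg x := by
      rw [hv₄]
      simp only [hσ₃, hσ₂, State.setReg_reg, if_neg (show d + 1 ≠ x by omega), if_true, hx₁]
    refine ⟨_, _, Runs.seq r₁ (Runs.seq r₂ (Runs.seq r₃ (Runs.seq r₄
      (Runs.assign τ₄ x (.reg (d + 1)))))), ?_, ?_, ?_⟩
    · simp only [Expr.cost, Expr.eval, hsave, hx₁, Nat.size_zero, costBound]
      have := hσ.reg x hx
      have := Nat.mul_le_mul_right ((2 + 2 * w + (1 + w) * (1 + w) + 1) + e.costBound w +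
        (10 + 4 * (w + e.sizeBound w) + 4 * w +
          (2 + w + e.sizeBound w) * (2 + w + e.sizeBound w))) hσ.zero
      omega
    · refine ⟨fun y hy => ?_, ?_⟩
      · simp only [Expr.eval, State.setReg_reg, hsave]
        by_cases hyx : y = x
        · simp [hyx]
        · rw [if_neg hyx, he₄.1 y hy]; simp [hyx]
      · simp only [State.setReg_arr]; rw [he₄.2]; rfl
    · simp only [State.setReg_reg, if_neg (show d ≠ x by omega), eval, hs₄]

end XExpr

/-! ### Running times of programs modulo scratch registers -/

/-- Started in `σ`, the program halts within time `T` in the state `σ'`, where both states matter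
up to scratch registers only. -/
def Exec (P : Prog) (T : ℕ) (σ σ' : State) : Prop :=
  ∀ σ₀ : State, σ₀.Eqv σ → ∃ t τ, Runs P σ₀ t τ ∧ t ≤ T ∧ τ.Eqv σ'

namespace Exec

theorem mono {P : Prog} {T T' : ℕ} {σ σ' : State} (h : Exec P T σ σ') (hT : T ≤ T') :
    Exec P T' σ σ' := fun σ₀ h₀ => by
  obtain ⟨t, τ, r, ht, hτ⟩ := h σ₀ h₀
  exact ⟨t, τ, r, ht.trans hT, hτ⟩

theorem seq {P Q : Prog} {T₁ T₂ : ℕ} {σ σ₁ σ₂ : State} (h₁ : Exec P T₁ σ σ₁)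
    (h₂ : Exec Q T₂ σ₁ σ₂) : Exec (.seq P Q) (T₁ + T₂) σ σ₂ := fun σ₀ h₀ => by
  obtain ⟨t₁, τ₁, r₁, ht₁, hτ₁⟩ := h₁ σ₀ h₀
  obtain ⟨t₂, τ₂, r₂, ht₂, hτ₂⟩ := h₂ τ₁ hτ₁
  exact ⟨_, τ₂, r₁.seq r₂, add_le_add ht₁ ht₂, hτ₂⟩

end Exec

/-- `x := e` for an extended expression. -/
def Prog.set (x : ℕ) (e : XExpr) : Prog := .seq (e.compile 64) (.assign x (.reg 64))

/-- `a[i] := e` for extended expressions. -/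
def Prog.put (a : ℕ) (i e : XExpr) : Prog :=
  .seq (i.compile 64) (.seq (e.compile 65) (.store a (.reg 64) (.reg 65)))

/-- A conditional on the value of an extended expression. -/
def Prog.cond (e : XExpr) (P Q : Prog) : Prog := .seq (e.compile 64) (.ite (.reg 64) P Q)

/-- A loop that runs as long as register `x` is below register `y`. -/
def Prog.whileLt (x y : ℕ) (P : Prog) : Prog := .loop (.op .lt (.reg x) (.reg y)) P

/-- The time for `x := e`. -/
def setCost (e : XExpr) (w : ℕ) : ℕ := e.costBound w + (2 + 2 * e.sizeBound w)

/-- The time for `a[i] := e`. -/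
def putCost (i e : XExpr) (w : ℕ) : ℕ :=
  i.costBound w + e.costBound w + (3 + 2 * (i.sizeBound w + e.sizeBound w))

/-- The time for one test of a loop. -/
def testCost (w : ℕ) : ℕ := 2 + 2 * w + (1 + w) * (1 + w) + 1

theorem polyBdd_setCost (e : XExpr) : PolyBdd (setCost e) :=
  e.polyBdd_costBound.add ((PolyBdd.const 2).add ((PolyBdd.const 2).mul e.polyBdd_sizeBound))

theorem polyBdd_putCost (i e : XExpr) : PolyBdd (putCost i e) :=
  (i.polyBdd_costBound.add e.polyBdd_costBound).add
    ((PolyBdd.const 3).add ((PolyBdd.const 2).mul (i.polyBdd_sizeBound.add e.polyBdd_sizeBound)))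

theorem polyBdd_testCost : PolyBdd testCost :=
  (((PolyBdd.const 2).add ((PolyBdd.const 2).mul .id)).add
    (((PolyBdd.const 1).add .id).mul ((PolyBdd.const 1).add .id))).add (.const 1)

namespace Exec

theorem set {x v : ℕ} {e : XExpr} (he : e.ok64) {σ : State} {w : ℕ} (hσ : σ.Bdd w)
    (hev : e.eval σ = v) : Exec (.set x e) (setCost e w) σ (σ.setReg x v) := by
  subst hev
  intro σ₀ h₀
  simp only [setCost]
  obtain ⟨t, τ, r, ht, hτ, hv⟩ := e.runs_compile he le_rfl (h₀.bdd hσ)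
  have hs := e.size_eval_le he (h₀.bdd hσ)
  refine ⟨_, _, r.seq (Runs.assign τ x (.reg 64)), ?_, ?_⟩
  · simp only [Expr.cost, Expr.eval, hv]; omega
  · simp only [Expr.eval, hv, e.eval_congr he h₀]
    exact ((hτ.eqv le_rfl).trans h₀).setReg _ _

theorem put {a j v : ℕ} {i e : XExpr} (hi : i.ok64) (he : e.ok64) {σ : State} {w : ℕ}
    (hσ : σ.Bdd w) (hj : i.eval σ = j) (hev : e.eval σ = v) :
    Exec (.put a i e) (putCost i e w) σ (σ.setArr a j v) := by
  subst hj hev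
  intro σ₀ h₀
  simp only [putCost]
  obtain ⟨t, τ, r, ht, hτ, hv⟩ := i.runs_compile hi le_rfl (h₀.bdd hσ)
  have h₁ : τ.Eqv σ := (hτ.eqv le_rfl).trans h₀
  obtain ⟨t', τ', r', ht', hτ', hv'⟩ := e.runs_compile he (d := 65) (by norm_num) (h₁.bdd hσ)
  have hs := i.size_eval_le hi (h₀.bdd hσ)
  have hs' := e.size_eval_le he (h₁.bdd hσ)
  have hv₂ : τ'.reg 64 = i.eval σ₀ := by rw [hτ'.1 64 (by norm_num), hv]
  refine ⟨_, _, r.seq (r'.seq (Runs.store τ' a (.reg 64) (.reg 65))), ?_, ?_⟩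
  · simp only [Expr.cost, Expr.eval, hv₂, hv']; omega
  · simp only [Expr.eval, hv₂, hv', i.eval_congr hi h₀, e.eval_congr he h₁]
    exact ((hτ'.eqv (by norm_num)).trans h₁).setArr _ _ _

theorem cond_true {e : XExpr} {P Q : Prog} (he : e.ok64) {σ σ' : State} {w T : ℕ}
    (hσ : σ.Bdd w) (h : e.eval σ ≠ 0) (hP : Exec P T σ σ') :
    Exec (.cond e P Q) (e.costBound w + (2 + e.sizeBound w) + T) σ σ' := by
  intro σ₀ h₀
  obtain ⟨t, τ, r, ht, hτ, hv⟩ := e.runs_compile he le_rfl (h₀.bdd hσ)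
  have hs := e.size_eval_le he (h₀.bdd hσ)
  obtain ⟨t', τ', r', ht', hτ'⟩ := hP τ ((hτ.eqv le_rfl).trans h₀)
  refine ⟨_, _, r.seq (Runs.ite_true (by simpa [Expr.eval, hv, e.eval_congr he h₀]) r'), ?_, hτ'⟩
  simp only [Expr.cost, hv]; omega

theorem cond_false {e : XExpr} {P Q : Prog} (he : e.ok64) {σ σ' : State} {w T : ℕ}
    (hσ : σ.Bdd w) (h : e.eval σ = 0) (hQ : Exec Q T σ σ') :
    Exec (.cond e P Q) (e.costBound w + (2 + e.sizeBound w) + T) σ σ' := by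
  intro σ₀ h₀
  obtain ⟨t, τ, r, ht, hτ, hv⟩ := e.runs_compile he le_rfl (h₀.bdd hσ)
  have hs := e.size_eval_le he (h₀.bdd hσ)
  obtain ⟨t', τ', r', ht', hτ'⟩ := hQ τ ((hτ.eqv le_rfl).trans h₀)
  refine ⟨_, _, r.seq (Runs.ite_false (by simpa [Expr.eval, hv, e.eval_congr he h₀]) r'), ?_, hτ'⟩
  simp only [Expr.cost, hv]; omega

/-- The rule for loops: an invariant `I` and a measure `μ` that decreases with each iteration. -/
theorem whileLt {x y : ℕ} {P : Prog} (hx : x < 64) (hy : y < 64) {w T : ℕ} (I : State → Prop)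
    (μ : State → ℕ) (hb : ∀ σ, I σ → σ.Bdd w)
    (hP : ∀ σ, I σ → σ.reg x < σ.reg y → ∃ σ', Exec P T σ σ' ∧ I σ' ∧ μ σ' < μ σ)
    {σ : State} (hσ : I σ) :
    ∃ σ', Exec (.whileLt x y P) ((μ σ + 1) * (testCost w + T)) σ σ' ∧
      I σ' ∧ σ'.reg y ≤ σ'.reg x := by
  simp only [testCost]
  have hcost : ∀ {σ σ₀ : State}, I σ → σ₀.Eqv σ →
      Expr.cost σ₀ (.op .lt (.reg x) (.reg y)) + 1 ≤ 2 + 2 * w + (1 + w) * (1 + w) + 1 := by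
    intro σ σ₀ h h₀
    have h1 := (h₀.bdd (hb σ h)).reg x hx
    have h2 := (h₀.bdd (hb σ h)).reg y hy
    have := Nat.mul_le_mul (Nat.add_le_add_left h1 1) (Nat.add_le_add_left h2 1)
    simp only [Expr.cost, Expr.eval]
    omega
  induction hm : μ σ using Nat.strong_induction_on generalizing σ with
  | _ m ih =>
    subst hm
    by_cases hlt : σ.reg x < σ.reg y
    · obtain ⟨σ₁, h₁, hI₁, hμ⟩ := hP σ hσ hlt
      obtain ⟨σ₂, h₂, hI₂, hle⟩ := ih _ hμ hI₁ rfl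
      refine ⟨σ₂, fun σ₀ h₀ => ?_, hI₂, hle⟩
      obtain ⟨t₁, τ₁, r₁, ht₁, hτ₁⟩ := h₁ σ₀ h₀
      obtain ⟨t₂, τ₂, r₂, ht₂, hτ₂⟩ := h₂ τ₁ hτ₁
      refine ⟨_, τ₂, Runs.loop_step ?_ r₁ r₂, ?_, hτ₂⟩
      · simp [Expr.eval, Op.eval, h₀.1 x hx, h₀.1 y hy, hlt]
      · have := hcost hσ h₀
        generalize 2 + 2 * w + (1 + w) * (1 + w) + 1 = K at *
        calc _ ≤ (μ σ₁ + 1) * (K + T) + (K + T) := by omega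
          _ = (μ σ₁ + 1 + 1) * (K + T) := by ring
          _ ≤ _ := Nat.mul_le_mul_right _ (by omega)
    · refine ⟨σ, fun σ₀ h₀ => ?_, hσ, not_lt.1 hlt⟩
      refine ⟨_, σ₀, Runs.loop_done ?_, ?_, h₀⟩
      · simp [Expr.eval, Op.eval, h₀.1 x hx, h₀.1 y hy, hlt]
      · refine (hcost hσ h₀).trans ?_
        generalize 2 + 2 * w + (1 + w) * (1 + w) + 1 = K at *
        nlinarith [Nat.zero_le (μ σ), Nat.zero_le T, Nat.zero_le (μ σ * (K + T))]

end Exec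

/-! ### Exhaustive search on the machine -/

/-- The states that a search starting from `s₀` visits: every choice `c < L` leads from `s` to
`N s c`, provided that `ok` admits the new state. -/
inductive Visited (N : ℕ → ℕ → ℕ) (ok : ℕ → Prop) (L s₀ : ℕ) : ℕ → Prop
  | init : Visited N ok L s₀ s₀
  | step {s c : ℕ} : Visited N ok L s₀ s → c < L → ok (N s c) → Visited N ok L s₀ (N s c)

/-- The treatment of one choice: register `9` holds the current state, register `8` the choice;
array `4` is the queue, with end in register `7`, and array `3` marks the states met so far. -/
def searchBody (nextE okE : XExpr) : Prog :=
  .seq (.set 10 nextE) <|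
  .seq (.set 11 (.ite okE (.op .eq (.load 3 (.reg 10)) (.const 0)) (.const 0))) <|
  .seq (.put 4 (.reg 7) (.ite (.reg 11) (.reg 10) (.load 4 (.reg 7)))) <|
  .seq (.put 3 (.reg 10) (.ite (.reg 11) (.const 1) (.load 3 (.reg 10)))) <|
  .seq (.set 7 (.op .add (.reg 7) (.reg 11))) <|
  .set 8 (.op .add (.reg 8) (.const 1))

/-- The treatment of the state at the front of the queue. Register `12` is set if the state is
accepting; register `5` holds the number of choices. -/
def searchStep (nextE okE accE : XExpr) : Prog :=
  .seq (.set 9 (.load 4 (.reg 6))) <|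
  .seq (.set 12 (.ite accE (.const 1) (.reg 12))) <|
  .seq (.set 8 (.const 0)) <|
  .seq (.whileLt 8 5 (searchBody nextE okE)) <|
  .set 6 (.op .add (.reg 6) (.const 1))

/-- Search from the state in register `9`. -/
def searchProg (nextE okE accE : XExpr) : Prog :=
  .seq (.put 3 (.reg 9) (.const 1)) <|
  .seq (.put 4 (.const 0) (.reg 9)) <|
  .seq (.set 6 (.const 0)) <|
  .seq (.set 7 (.const 1)) <|
  .seq (.set 12 (.const 0)) <|
  .whileLt 6 7 (searchStep nextE okE accE)

/-- The states agree on everything that a search does not write to. -/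
def State.SameInput (σ₀ σ : State) : Prop :=
  (∀ x, (x < 6 ∨ 12 < x) → σ.reg x = σ₀.reg x) ∧ ∀ a, a ≠ 3 → a ≠ 4 → σ.arr a = σ₀.arr a

/-- The time for one choice. -/
def searchBodyCost (nextE okE : XExpr) (w : ℕ) : ℕ :=
  setCost nextE w +
  (setCost (.ite okE (.op .eq (.load 3 (.reg 10)) (.const 0)) (.const 0)) w +
  (putCost (.reg 7) (.ite (.reg 11) (.reg 10) (.load 4 (.reg 7))) w +
  (putCost (.reg 10) (.ite (.reg 11) (.const 1) (.load 3 (.reg 10))) w +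
  (setCost (.op .add (.reg 7) (.reg 11)) w +
  setCost (.op .add (.reg 8) (.const 1)) w))))

/-- The time for one state. -/
def searchStepCost (nextE okE accE : XExpr) (w : ℕ) : ℕ :=
  setCost (.load 4 (.reg 6)) w +
  (setCost (.ite accE (.const 1) (.reg 12)) w +
  (setCost (.const 0) w +
  ((w + 1) * (testCost w + searchBodyCost nextE okE w) +
  setCost (.op .add (.reg 6) (.const 1)) w)))

/-- The time for a search, per visited state. -/
def searchCost (nextE okE accE : XExpr) (w : ℕ) : ℕ :=
  putCost (.reg 9) (.const 1) w +
  (putCost (.const 0) (.reg 9) w +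
  (setCost (.const 0) w +
  (setCost (.const 1) w +
  (setCost (.const 0) w + (testCost w + searchStepCost nextE okE accE w)))))

theorem polyBdd_searchCost (nextE okE accE : XExpr) :
    PolyBdd (searchCost nextE okE accE) := by
  have s := polyBdd_setCost
  have p := polyBdd_putCost
  have t := polyBdd_testCost
  have b : PolyBdd (searchBodyCost nextE okE) :=
    (s _).add ((s _).add ((p _ _).add ((p _ _).add ((s _).add (s _)))))
  have c : PolyBdd (searchStepCost nextE okE accE) :=
    (s _).add ((s _).add ((s _).add (((PolyBdd.id.add (.const 1)).mul (t.add b)).add (s _))))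
  exact (p _ _).add ((p _ _).add ((s _).add ((s _).add ((s _).add (t.add c)))))

section Search

variable {N : ℕ → ℕ → ℕ} {ok acc : ℕ → Prop} {L s₀ w : ℕ} {σ₀ : State} {R : Finset ℕ}

/-- The part of the invariant of a search that concerns the queue: it lists visited states without
repetition, and the marks in array `3` describe its content. -/
structure SearchInv (N : ℕ → ℕ → ℕ) (ok : ℕ → Prop) (L s₀ w : ℕ) (σ₀ σ : State) : Prop where
  same : σ₀.SameInput σ
  bdd : σ.Bdd w
  head_le : σ.reg 6 ≤ σ.reg 7
  pos : 0 < σ.reg 7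
  first : σ.arr 4 0 = s₀
  visited : ∀ i < σ.reg 7, Visited N ok L s₀ (σ.arr 4 i)
  inj : ∀ i < σ.reg 7, ∀ j < σ.reg 7, σ.arr 4 i = σ.arr 4 j → i = j
  mark : ∀ t, σ.arr 3 t ≠ 0 ↔ ∃ i < σ.reg 7, σ.arr 4 i = t
  closed : ∀ i < σ.reg 6, ∀ c < L, ok (N (σ.arr 4 i) c) →
    ∃ j < σ.reg 7, σ.arr 4 j = N (σ.arr 4 i) c

theorem SearchInv.tail_le (hR : ∀ s, Visited N ok L s₀ s → s ∈ R) {σ : State}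
    (h : SearchInv N ok L s₀ w σ₀ σ) : σ.reg 7 ≤ R.card := by
  have := Finset.card_le_card_of_injOn (s := range (σ.reg 7)) (t := R) (σ.arr 4)
    (fun i hi => hR _ (h.visited i (by simpa using hi)))
    (fun i hi j hj => h.inj i (by simpa using hi) j (by simpa using hj))
  simpa using this

variable {nextE okE accE : XExpr}

/-- One choice in a search: a new admissible state is appended to the queue. -/
theorem exec_searchBody (hnext : nextE.ok64) (hok : okE.ok64) (hw : 1 ≤ w)
    (hR : ∀ s, Visited N ok L s₀ s → s ∈ R) (hRw : (R.card).size ≤ w) (hLw : L ≤ w)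
    (hs : ∀ s c, Visited N ok L s₀ s → c < L → (N s c).size ≤ w)
    (hnextE : ∀ σ, σ₀.SameInput σ → Visited N ok L s₀ (σ.reg 9) → σ.reg 8 < L →
      nextE.eval σ = N (σ.reg 9) (σ.reg 8))
    (hokE : ∀ σ s c, σ₀.SameInput σ → Visited N ok L s₀ s → c < L → σ.reg 10 = N s c →
      (okE.eval σ ≠ 0 ↔ ok (σ.reg 10)))
    {σ : State} (h : SearchInv N ok L s₀ w σ₀ σ) (hlt : σ.reg 6 < σ.reg 7)
    (h9 : σ.reg 9 = σ.arr 4 (σ.reg 6)) (h8 : σ.reg 8 < L)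
    (hc : ∀ c < σ.reg 8, ok (N (σ.reg 9) c) → ∃ j < σ.reg 7, σ.arr 4 j = N (σ.reg 9) c) :
    ∃ σ', Exec (searchBody nextE okE) (searchBodyCost nextE okE w) σ σ' ∧
      SearchInv N ok L s₀ w σ₀ σ' ∧ σ'.reg 6 = σ.reg 6 ∧ σ'.reg 9 = σ.reg 9 ∧
      σ'.reg 12 = σ.reg 12 ∧ σ'.reg 8 = σ.reg 8 + 1 ∧ σ.reg 7 ≤ σ'.reg 7 ∧
      (∀ i < σ.reg 7, σ'.arr 4 i = σ.arr 4 i) ∧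
      (∀ c < σ'.reg 8, ok (N (σ.reg 9) c) → ∃ j < σ'.reg 7, σ'.arr 4 j = N (σ.reg 9) c) := by
  classical
  have hv : Visited N ok L s₀ (σ.reg 9) := h9 ▸ h.visited _ hlt
  have hsz := hs _ _ hv h8
  set t := N (σ.reg 9) (σ.reg 8) with ht
  have e1 : nextE.eval σ = t := hnextE σ h.same hv h8
  set σ₁ := σ.setReg 10 t with hσ₁
  have x1 : Exec (.set 10 nextE) (setCost nextE w) σ σ₁ := Exec.set hnext h.bdd e1
  have b1 : σ₁.Bdd w := h.bdd.setReg (by norm_num) hsz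
  have same1 : σ₀.SameInput σ₁ :=
    ⟨fun x hx => by simp [hσ₁, show x ≠ 10 by omega, h.same.1 x hx], h.same.2⟩
  have e2 : okE.eval σ₁ ≠ 0 ↔ ok t := by
    simpa [hσ₁] using hokE σ₁ _ _ same1 hv h8 (by simp [hσ₁, ht])
  set new : Prop := ok t ∧ σ.arr 3 t = 0 with hnew
  set g := if new then 1 else 0 with hg
  have e2' : (XExpr.ite okE (.op .eq (.load 3 (.reg 10)) (.const 0)) (.const 0)).eval σ₁ = g := by
    by_cases hk : ok t
    · simp only [XExpr.eval, if_pos (e2.2 hk), Op.eval]; simp [hg, hnew, hk, hσ₁]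
    · simp only [XExpr.eval, if_neg (mt e2.1 hk)]; simp [hg, hnew, hk]
  set σ₂ := σ₁.setReg 11 g with hσ₂
  have hg1 : g.size ≤ w := by rw [hg]; split_ifs <;> simp; omega
  have x2 : Exec (.set 11 (.ite okE (.op .eq (.load 3 (.reg 10)) (.const 0)) (.const 0)))
      (setCost (.ite okE (.op .eq (.load 3 (.reg 10)) (.const 0)) (.const 0)) w) σ₁ σ₂ :=
    Exec.set (by simp [XExpr.ok64, hok]) b1 e2'
  have b2 : σ₂.Bdd w := b1.setReg (by norm_num) hg1
  set σ₃ := σ₂.setArr 4 (σ.reg 7) (if new then t else σ.arr 4 (σ.reg 7)) with hσ₃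
  have x3 : Exec (.put 4 (.reg 7) (.ite (.reg 11) (.reg 10) (.load 4 (.reg 7))))
      (putCost (.reg 7) (.ite (.reg 11) (.reg 10) (.load 4 (.reg 7))) w) σ₂ σ₃ :=
    Exec.put (by decide) (by decide) b2 (by simp [XExpr.eval, hσ₂, hσ₁])
      (by by_cases hn : new <;> simp [XExpr.eval, hσ₂, hσ₁, hg, hn])
  have b3 : σ₃.Bdd w := b2.setArr (by split_ifs; exacts [hsz, h.bdd.arr _ _])
  set σ₄ := σ₃.setArr 3 t (if new then 1 else σ.arr 3 t) with hσ₄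
  have x4 : Exec (.put 3 (.reg 10) (.ite (.reg 11) (.const 1) (.load 3 (.reg 10))))
      (putCost (.reg 10) (.ite (.reg 11) (.const 1) (.load 3 (.reg 10))) w) σ₃ σ₄ :=
    Exec.put (by decide) (by decide) b3 (by simp [XExpr.eval, hσ₃, hσ₂, hσ₁])
      (by by_cases hn : new <;> simp [XExpr.eval, hσ₃, hσ₂, hσ₁, hg, hn])
  have b4 : σ₄.Bdd w := b3.setArr (by split_ifs; exacts [by simpa using hw, h.bdd.arr _ _])
  have ng : new → ∀ i < σ.reg 7, σ.arr 4 i ≠ t := fun hn i hi he =>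
    (h.mark t).2 ⟨i, hi, he⟩ hn.2
  have vnew : new → Visited N ok L s₀ t := fun hn => hv.step h8 hn.1
  have htail : σ.reg 7 + g ≤ R.card := by
    by_cases hn : new
    · have hnm : t ∉ (range (σ.reg 7)).image (σ.arr 4) := by
        simp only [Finset.mem_image, Finset.mem_range, not_exists, not_and]
        exact ng hn
      have hsub : insert t ((range (σ.reg 7)).image (σ.arr 4)) ⊆ R := by
        intro s hs
        rcases Finset.mem_insert.1 hs with rfl | hs
        · exact hR _ (vnew hn)
        · obtain ⟨i, hi, rfl⟩ := Finset.mem_image.1 hs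
          exact hR _ (h.visited i (by simpa using hi))
      have := Finset.card_le_card hsub
      rw [Finset.card_insert_of_notMem hnm, Finset.card_image_of_injOn
        (fun i hi j hj => h.inj i (by simpa using hi) j (by simpa using hj))] at this
      simpa [hg, hn] using this
    · simpa [hg, hn] using h.tail_le hR
  set σ₅ := σ₄.setReg 7 (σ.reg 7 + g) with hσ₅
  have x5 : Exec (.set 7 (.op .add (.reg 7) (.reg 11))) (setCost (.op .add (.reg 7) (.reg 11)) w)
      σ₄ σ₅ :=
    Exec.set (by decide) b4 (by simp [XExpr.eval, Op.eval, hσ₄, hσ₃, hσ₂, hσ₁])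
  have b5 : σ₅.Bdd w := b4.setReg (by norm_num) ((Nat.size_le_size htail).trans hRw)
  set σ₆ := σ₅.setReg 8 (σ.reg 8 + 1) with hσ₆
  have x6 : Exec (.set 8 (.op .add (.reg 8) (.const 1))) (setCost (.op .add (.reg 8) (.const 1)) w)
      σ₅ σ₆ :=
    Exec.set (by decide) b5 (by simp [XExpr.eval, Op.eval, hσ₅, hσ₄, hσ₃, hσ₂, hσ₁])
  have b6 : σ₆.Bdd w := b5.setReg (by norm_num) ((size_le_self _).trans (by omega))
  have r7 : σ₆.reg 7 = σ.reg 7 + g := by simp [hσ₆, hσ₅]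
  have r6 : σ₆.reg 6 = σ.reg 6 := by simp [hσ₆, hσ₅, hσ₄, hσ₃, hσ₂, hσ₁]
  have r9 : σ₆.reg 9 = σ.reg 9 := by simp [hσ₆, hσ₅, hσ₄, hσ₃, hσ₂, hσ₁]
  have r12 : σ₆.reg 12 = σ.reg 12 := by simp [hσ₆, hσ₅, hσ₄, hσ₃, hσ₂, hσ₁]
  have r8 : σ₆.reg 8 = σ.reg 8 + 1 := by simp [hσ₆]
  have a4 : ∀ i, σ₆.arr 4 i = if new ∧ i = σ.reg 7 then t else σ.arr 4 i := by
    intro i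
    by_cases hi : i = σ.reg 7 <;> by_cases hn : new <;>
      simp [hσ₆, hσ₅, hσ₄, hσ₃, hσ₂, hσ₁, hi, hn]
  have a3 : ∀ i, σ₆.arr 3 i = if new ∧ i = t then 1 else σ.arr 3 i := by
    intro i
    by_cases hi : i = t <;> by_cases hn : new <;>
      simp [hσ₆, hσ₅, hσ₄, hσ₃, hσ₂, hσ₁, hi, hn]
  have old : ∀ i < σ.reg 7, σ₆.arr 4 i = σ.arr 4 i := fun i hi => by
    rw [a4, if_neg (by omega)]
  have keep : ∀ s, (∃ j < σ.reg 7, σ.arr 4 j = s) → ∃ j < σ₆.reg 7, σ₆.arr 4 j = s := by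
    rintro s ⟨j, hj, rfl⟩
    exact ⟨j, by omega, old j hj⟩
  have split : ∀ i < σ₆.reg 7, i < σ.reg 7 ∨ (new ∧ i = σ.reg 7 ∧ σ₆.arr 4 i = t) := by
    intro i hi
    by_cases hn : new
    · simp only [r7, hg, if_pos hn] at hi
      rcases Nat.lt_succ_iff_lt_or_eq.1 hi with hi | hi
      · exact Or.inl hi
      · exact Or.inr ⟨hn, hi, by rw [a4, if_pos ⟨hn, hi⟩]⟩
    · simp only [r7, hg, if_neg hn] at hi
      exact Or.inl hi
  refine ⟨σ₆, x1.seq (x2.seq (x3.seq (x4.seq (x5.seq x6)))), ?_, r6, r9, r12, r8, by omega, old, ?_⟩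
  · constructor
    · refine ⟨fun x hx => ?_, fun a h3 h4 => ?_⟩
      · simp only [hσ₆, hσ₅, hσ₄, hσ₃, hσ₂, hσ₁, State.setReg_reg, State.setArr_reg]
        rw [if_neg (by omega), if_neg (by omega), if_neg (by omega), if_neg (by omega), h.same.1 x hx]
      · funext i
        simp [hσ₆, hσ₅, hσ₄, hσ₃, hσ₂, hσ₁, h3, h4, h.same.2 a h3 h4]
    · exact b6
    · have := h.head_le; omega
    · have := h.pos; omega
    · rw [old 0 h.pos, h.first]
    · intro i hi
      rcases split i hi with hi | ⟨hn, -, he⟩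
      · rw [old i hi]; exact h.visited i hi
      · rw [he]; exact vnew hn
    · intro i hi j hj hij
      rcases split i hi with hi' | ⟨hn, hi', he⟩ <;> rcases split j hj with hj' | ⟨hn', hj', he'⟩
      · rw [old i hi', old j hj'] at hij; exact h.inj i hi' j hj' hij
      · rw [old i hi', he'] at hij; exact absurd hij (ng hn' i hi')
      · rw [old j hj', he] at hij; exact absurd hij.symm (ng hn j hj')
      · omega
    · intro u
      rw [a3]
      by_cases hu : new ∧ u = t
      · simp only [if_pos hu, ne_eq, one_ne_zero, not_false_eq_true, true_iff]
        exact ⟨σ.reg 7, by simp [r7, hg, hu.1], by rw [a4, if_pos ⟨hu.1, rfl⟩, hu.2]⟩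
      · rw [if_neg hu, h.mark]
        refine ⟨keep u, ?_⟩
        rintro ⟨j, hj, rfl⟩
        rcases split j hj with hj' | ⟨hn, -, he⟩
        · exact ⟨j, hj', (old j hj').symm⟩
        · exact absurd ⟨hn, he⟩ hu
    · intro i hi c hcL hokc
      rw [r6] at hi
      rw [old i (by omega)] at hokc ⊢
      exact keep _ (h.closed i hi c hcL hokc)
  · intro c hc' hokc
    rw [r8] at hc'
    rcases Nat.lt_succ_iff_lt_or_eq.1 hc' with hc' | rfl
    · exact keep _ (hc c hc' hokc)
    · by_cases hn : new
      · exact ⟨σ.reg 7, by simp [r7, hg, hn], by rw [a4, if_pos ⟨hn, rfl⟩]⟩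
      · have : σ.arr 3 t ≠ 0 := fun h0 => hn ⟨hokc, h0⟩
        exact keep _ ((h.mark t).1 this)

open Classical in
/-- A search decides whether an accepting state can be visited, within a time that is, up to a
polynomial factor, the number of visited states. -/
theorem exec_searchProg (hnext : nextE.ok64) (hok : okE.ok64) (hacc : accE.ok64) (hw : 1 ≤ w)
    (hR : ∀ s, Visited N ok L s₀ s → s ∈ R) (hRw : (R.card).size ≤ w) (hLw : L ≤ w)
    (hs : ∀ s c, Visited N ok L s₀ s → c < L → (N s c).size ≤ w)
    (hnextE : ∀ σ, σ₀.SameInput σ → Visited N ok L s₀ (σ.reg 9) → σ.reg 8 < L →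
      nextE.eval σ = N (σ.reg 9) (σ.reg 8))
    (hokE : ∀ σ s c, σ₀.SameInput σ → Visited N ok L s₀ s → c < L → σ.reg 10 = N s c →
      (okE.eval σ ≠ 0 ↔ ok (σ.reg 10)))
    (haccE : ∀ σ, σ₀.SameInput σ → Visited N ok L s₀ (σ.reg 9) →
      (accE.eval σ ≠ 0 ↔ acc (σ.reg 9)))
    (hb : σ₀.Bdd w) (h9 : σ₀.reg 9 = s₀) (h5 : σ₀.reg 5 = L) (h3 : ∀ i, σ₀.arr 3 i = 0) :
    ∃ σ', Exec (searchProg nextE okE accE) ((R.card + 1) * searchCost nextE okE accE w) σ₀ σ' ∧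
      σ'.Bdd w ∧ σ'.reg 12 = if ∃ s, Visited N ok L s₀ s ∧ acc s then 1 else 0 := by
  have hone : Nat.size 1 ≤ w := by simpa using hw
  set σ₁ := σ₀.setArr 3 s₀ 1 with hσ₁
  have x1 : Exec (.put 3 (.reg 9) (.const 1)) (putCost (.reg 9) (.const 1) w) σ₀ σ₁ :=
    Exec.put (by decide) (by decide) hb h9 rfl
  have b1 : σ₁.Bdd w := hb.setArr hone
  set σ₂ := σ₁.setArr 4 0 s₀ with hσ₂
  have x2 : Exec (.put 4 (.const 0) (.reg 9)) (putCost (.const 0) (.reg 9) w) σ₁ σ₂ :=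
    Exec.put (by decide) (by decide) b1 rfl h9
  have b2 : σ₂.Bdd w := b1.setArr (h9 ▸ hb.reg 9 (by norm_num))
  set σ₃ := σ₂.setReg 6 0 with hσ₃
  have x3 : Exec (.set 6 (.const 0)) (setCost (.const 0) w) σ₂ σ₃ :=
    Exec.set (by decide) b2 rfl
  have b3 : σ₃.Bdd w := b2.setReg (by norm_num) (by simp)
  set σ₄ := σ₃.setReg 7 1 with hσ₄
  have x4 : Exec (.set 7 (.const 1)) (setCost (.const 1) w) σ₃ σ₄ :=
    Exec.set (by decide) b3 rfl
  have b4 : σ₄.Bdd w := b3.setReg (by norm_num) hone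
  set σ₅ := σ₄.setReg 12 0 with hσ₅
  have x5 : Exec (.set 12 (.const 0)) (setCost (.const 0) w) σ₄ σ₅ :=
    Exec.set (by decide) b4 rfl
  have b5 : σ₅.Bdd w := b4.setReg (by norm_num) (by simp)
  let I : State → Prop := fun σ => SearchInv N ok L s₀ w σ₀ σ ∧
    σ.reg 12 = if ∃ i < σ.reg 6, acc (σ.arr 4 i) then 1 else 0
  have hI : I σ₅ := by
    have r7 : σ₅.reg 7 = 1 := by simp [hσ₅, hσ₄]
    have r6 : σ₅.reg 6 = 0 := by simp [hσ₅, hσ₄, hσ₃]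
    have a0 : σ₅.arr 4 0 = s₀ := by simp [hσ₅, hσ₄, hσ₃, hσ₂]
    refine ⟨⟨⟨fun x hx => ?_, fun a h3 h4 => ?_⟩, b5, by omega, by omega, a0, ?_, ?_, ?_, ?_⟩, ?_⟩
    · simp only [hσ₅, hσ₄, hσ₃, hσ₂, hσ₁, State.setReg_reg, State.setArr_reg]
      rw [if_neg (by omega), if_neg (by omega), if_neg (by omega)]
    · funext i
      simp [hσ₅, hσ₄, hσ₃, hσ₂, hσ₁, h3, h4]
    · intro i hi
      obtain rfl : i = 0 := by omega
      rw [a0]; exact .init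
    · intro i hi j hj _; omega
    · intro t
      have : σ₅.arr 3 t = if t = s₀ then 1 else 0 := by
        by_cases ht : t = s₀ <;> simp [hσ₅, hσ₄, hσ₃, hσ₂, hσ₁, h3, ht]
      rw [this, r7]
      constructor
      · intro h
        refine ⟨0, by norm_num, ?_⟩
        rw [a0]; by_contra hne; simp [Ne.symm hne] at h
      · rintro ⟨i, hi, hit⟩
        obtain rfl : i = 0 := by omega
        rw [a0] at hit; simp [hit]
    · intro i hi; omega
    · simp [r6]; simp [hσ₅]
  have loop := Exec.whileLt (x := 6) (y := 7) (P := searchStep nextE okE accE) (by norm_num)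
    (by norm_num) (w := w) (T := searchStepCost nextE okE accE w) I
    (fun σ => R.card - σ.reg 6) (fun σ h => h.1.bdd) ?_ hI
  · obtain ⟨σ', x6, ⟨hI', hf⟩, hend⟩ := loop
    refine ⟨σ', (x1.seq (x2.seq (x3.seq (x4.seq (x5.seq x6))))).mono ?_, hI'.bdd, ?_⟩
    · have h6 : σ₅.reg 6 = 0 := by simp [hσ₅, hσ₄, hσ₃]
      rw [h6, Nat.sub_zero]
      change _ + (_ + (_ + (_ + (_ + (R.card + 1) *
        (testCost w + searchStepCost nextE okE accE w))))) ≤ _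
      simp only [searchCost]
      generalize testCost w + searchStepCost nextE okE accE w = Z
      simp only [Nat.mul_add]
      have key : ∀ a : ℕ, a ≤ (R.card + 1) * a := fun a => Nat.le_mul_of_pos_left a (by omega)
      have k1 := key (putCost (.reg 9) (.const 1) w)
      have k2 := key (putCost (.const 0) (.reg 9) w)
      have k3 := key (setCost (.const 0) w)
      have k4 := key (setCost (.const 1) w)
      omega
    · rw [hf]
      have all : ∀ s, Visited N ok L s₀ s → ∃ i < σ'.reg 7, σ'.arr 4 i = s := by
        intro s hs
        induction hs with
        | init => exact ⟨0, hI'.pos, hI'.first⟩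
        | step _ hc hok' ih =>
          obtain ⟨i, hi, rfl⟩ := ih
          exact hI'.closed i (by omega) _ hc hok'
      have : (∃ i < σ'.reg 6, acc (σ'.arr 4 i)) ↔ ∃ s, Visited N ok L s₀ s ∧ acc s := by
        constructor
        · rintro ⟨i, hi, ha⟩
          exact ⟨_, hI'.visited i (by have := hI'.head_le; omega), ha⟩
        · rintro ⟨s, hs, ha⟩
          obtain ⟨i, hi, rfl⟩ := all s hs
          exact ⟨i, by omega, ha⟩
      simp only [this]
  · rintro σ ⟨h, hf⟩ hlt
    set s := σ.arr 4 (σ.reg 6) with hs'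
    have hv : Visited N ok L s₀ s := h.visited _ hlt
    set τ₁ := σ.setReg 9 s with hτ₁
    have y1 : Exec (.set 9 (.load 4 (.reg 6))) (setCost (.load 4 (.reg 6)) w) σ τ₁ :=
      Exec.set (by decide) h.bdd rfl
    have c1 : τ₁.Bdd w := h.bdd.setReg (by norm_num) (h.bdd.arr _ _)
    have same1 : σ₀.SameInput τ₁ :=
      ⟨fun x hx => by simp [hτ₁, show x ≠ 9 by omega, h.same.1 x hx], h.same.2⟩
    have eacc : accE.eval τ₁ ≠ 0 ↔ acc s := by
      simpa [hτ₁] using haccE τ₁ same1 (by simpa [hτ₁] using hv)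
    set f := if ∃ i < σ.reg 6 + 1, acc (σ.arr 4 i) then 1 else 0 with hf'
    have hff : (XExpr.ite accE (.const 1) (.reg 12)).eval τ₁ = f := by
      by_cases ha : acc s
      · simp only [XExpr.eval, if_pos (eacc.2 ha)]
        rw [hf', if_pos ⟨σ.reg 6, by omega, ha⟩]
      · have h12 : τ₁.reg 12 = σ.reg 12 := by simp [hτ₁]
        simp only [XExpr.eval, if_neg (mt eacc.1 ha), h12, hf, hf']
        congr 1
        refine propext ⟨fun ⟨i, hi, hai⟩ => ⟨i, by omega, hai⟩, fun ⟨i, hi, hai⟩ => ?_⟩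
        rcases Nat.lt_succ_iff_lt_or_eq.1 hi with hi | rfl
        · exact ⟨i, hi, hai⟩
        · exact absurd hai ha
    set τ₂ := τ₁.setReg 12 f with hτ₂
    have y2 : Exec (.set 12 (.ite accE (.const 1) (.reg 12)))
        (setCost (.ite accE (.const 1) (.reg 12)) w) τ₁ τ₂ :=
      Exec.set (by simp [XExpr.ok64, hacc]) c1 hff
    have c2 : τ₂.Bdd w := c1.setReg (by norm_num) (by rw [hf']; split_ifs <;> simp; omega)
    set τ₃ := τ₂.setReg 8 0 with hτ₃
    have y3 : Exec (.set 8 (.const 0)) (setCost (.const 0) w) τ₂ τ₃ :=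
      Exec.set (by decide) c2 rfl
    have c3 : τ₃.Bdd w := c2.setReg (by norm_num) (by simp)
    have q6 : τ₃.reg 6 = σ.reg 6 := by simp [hτ₃, hτ₂, hτ₁]
    have q7 : τ₃.reg 7 = σ.reg 7 := by simp [hτ₃, hτ₂, hτ₁]
    have q9 : τ₃.reg 9 = s := by simp [hτ₃, hτ₂, hτ₁]
    have q12 : τ₃.reg 12 = f := by simp [hτ₃, hτ₂]
    have q8 : τ₃.reg 8 = 0 := by simp [hτ₃]
    have qa : τ₃.arr = σ.arr := by simp [hτ₃, hτ₂, hτ₁]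
    have inv3 : SearchInv N ok L s₀ w σ₀ τ₃ := by
      constructor
      · refine ⟨fun x hx => ?_, fun a h3 h4 => ?_⟩
        · simp only [hτ₃, hτ₂, hτ₁, State.setReg_reg]
          rw [if_neg (by omega), if_neg (by omega), if_neg (by omega), h.same.1 x hx]
        · rw [qa]; exact h.same.2 a h3 h4
      · exact c3
      · rw [q6, q7]; exact h.head_le
      · rw [q7]; exact h.pos
      · rw [qa]; exact h.first
      · rw [q7, qa]; exact h.visited
      · rw [q7, qa]; exact h.inj
      · rw [q7, qa]; exact h.mark
      · rw [q6, q7, qa]; exact h.closed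
    let J : State → Prop := fun τ => SearchInv N ok L s₀ w σ₀ τ ∧ τ.reg 6 = σ.reg 6 ∧
      τ.reg 9 = s ∧ τ.reg 12 = f ∧ σ.reg 7 ≤ τ.reg 7 ∧ (∀ i < σ.reg 7, τ.arr 4 i = σ.arr 4 i) ∧
      τ.reg 8 ≤ L ∧
      ∀ c < τ.reg 8, ok (N s c) → ∃ j < τ.reg 7, τ.arr 4 j = N s c
    have hJ : J τ₃ := ⟨inv3, q6, q9, q12, q7.ge, fun i _ => by rw [qa], by omega,
      fun c hc => by omega⟩
    have loop' := Exec.whileLt (x := 8) (y := 5) (P := searchBody nextE okE) (by norm_num)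
      (by norm_num) (w := w) (T := searchBodyCost nextE okE w) J
      (fun τ => L - τ.reg 8) (fun τ hτ => hτ.1.bdd) ?_ hJ
    · obtain ⟨τ₄, y4, ⟨inv4, p6, p9, p12, p7, pa, p8, pc⟩, hend⟩ := loop'
      have p5 : τ₄.reg 5 = L := by rw [inv4.same.1 5 (by norm_num), h5]
      set τ₅ := τ₄.setReg 6 (σ.reg 6 + 1) with hτ₅
      have y5 : Exec (.set 6 (.op .add (.reg 6) (.const 1)))
          (setCost (.op .add (.reg 6) (.const 1)) w) τ₄ τ₅ :=
        Exec.set (by decide) inv4.bdd (by simp [XExpr.eval, Op.eval, p6])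
      have ht4 := inv4.tail_le hR
      have c5 : τ₅.Bdd w := inv4.bdd.setReg (by norm_num)
        ((Nat.size_le_size (by omega)).trans hRw)
      have r6 : τ₅.reg 6 = σ.reg 6 + 1 := by simp [hτ₅]
      have r7 : τ₅.reg 7 = τ₄.reg 7 := by simp [hτ₅]
      have ra : τ₅.arr = τ₄.arr := rfl
      refine ⟨τ₅, (y1.seq (y2.seq (y3.seq (y4.seq y5)))).mono ?_, ⟨?_, ?_⟩, ?_⟩
      · rw [q8, Nat.sub_zero]
        simp only [searchStepCost]
        gcongr
      · constructor
        · refine ⟨fun x hx => ?_, fun a h3 h4 => inv4.same.2 a h3 h4⟩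
          simp only [hτ₅, State.setReg_reg]
          rw [if_neg (by omega), inv4.same.1 x hx]
        · exact c5
        · omega
        · rw [r7]; exact inv4.pos
        · exact inv4.first
        · rw [r7]; exact inv4.visited
        · rw [r7]; exact inv4.inj
        · rw [r7]; exact inv4.mark
        · intro i hi c hc hok'
          rw [r6] at hi
          rw [r7]
          rcases Nat.lt_succ_iff_lt_or_eq.1 hi with hi | rfl
          · exact inv4.closed i (by omega) c hc hok'
          · rw [ra, pa _ hlt] at hok' ⊢
            exact pc c (by omega) hok'
      · have : τ₅.reg 12 = f := by simp [hτ₅, p12]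
        rw [this, hf', r6, ra]
        congr 1
        refine propext ⟨?_, ?_⟩ <;> rintro ⟨i, hi, ha⟩ <;> refine ⟨i, hi, ?_⟩
        · rwa [pa i (by omega)]
        · rwa [pa i (by omega)] at ha
      · have := h.tail_le hR
        simp only [r6]
        omega
    · rintro τ ⟨inv, p6, p9, p12, p7, pa, p8, pc⟩ hlt'
      have p5 : τ.reg 5 = L := by rw [inv.same.1 5 (by norm_num), h5]
      obtain ⟨τ', y, inv', k6, k9, k12, k8, k7, ka, kc⟩ := exec_searchBody hnext hok hw hR hRw hLw
        hs hnextE hokE inv (by omega) (by rw [p9, p6, pa _ hlt]) (by omega)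
        (by rw [p9]; exact pc)
      refine ⟨τ', y, ⟨inv', by omega, by omega, by omega, by omega, ?_, by omega, ?_⟩, ?_⟩
      · intro i hi; rw [ka i (by omega), pa i hi]
      · rw [p9] at kc; exact kc
      · simp only [k8]; omega

end Search

/-! ### Cliques outside a twin cover -/

section TwinCover

variable {n : ℕ} {G : SimpleGraph (Fin n)} {S : Finset (Fin n)}

open Classical in
/-- The vertices outside `S` that are equal or adjacent to `c`. If `S` is a twin cover and `c ∉ S`,
this is the connected component of `c` in `G - S`, a clique of true twins. -/
noncomputable def clq (G : SimpleGraph (Fin n)) (S : Finset (Fin n)) (c : Fin n) :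
    Finset (Fin n) :=
  univ.filter fun w => w ∉ S ∧ (w = c ∨ G.Adj w c)

/-- `c` is the smallest vertex of its clique. -/
def IsRep (G : SimpleGraph (Fin n)) (S : Finset (Fin n)) (c : Fin n) : Prop :=
  c ∉ S ∧ ∀ w < c, w ∉ S → ¬ G.Adj w c

@[simp] theorem mem_clq {c w : Fin n} : w ∈ clq G S c ↔ w ∉ S ∧ (w = c ∨ G.Adj w c) := by
  simp [clq]

theorem IsTwinCover.adj_iff (hS : IsTwinCover G S) {u v w : Fin n} (hu : u ∉ S) (hv : v ∉ S)
    (huv : G.Adj u v) (hwu : w ≠ u) (hwv : w ≠ v) : G.Adj w u ↔ G.Adj w v := by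
  rcases hS u v huv with h | h | h
  · have := Set.ext_iff.1 h w
    simpa [closedNeighborSet, hwu, hwv, G.adj_comm w] using this
  · exact absurd h hu
  · exact absurd h hv

theorem IsTwinCover.adj_iff_of_mem_clq (hS : IsTwinCover G S) {x u c : Fin n} (hx : x ∈ S)
    (hc : c ∉ S) (hu : u ∈ clq G S c) : G.Adj x u ↔ G.Adj x c := by
  rw [mem_clq] at hu
  rcases hu.2 with rfl | h
  · rfl
  · exact hS.adj_iff hu.1 hc h (by rintro rfl; exact hu.1 hx) (by rintro rfl; exact hc hx)

theorem self_mem_clq {c : Fin n} (hc : c ∉ S) : c ∈ clq G S c := by simp [hc]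

theorem mem_clq_comm {u c : Fin n} (hc : c ∉ S) (h : u ∈ clq G S c) : c ∈ clq G S u := by
  simp only [mem_clq] at h ⊢
  rcases h.2 with rfl | h
  · exact ⟨hc, Or.inl rfl⟩
  · exact ⟨hc, Or.inr h.symm⟩

theorem IsTwinCover.mem_clq_trans (hS : IsTwinCover G S) {u v c : Fin n} (hv : v ∈ clq G S c)
    (hc : c ∉ S) (hu : u ∈ clq G S v) : u ∈ clq G S c := by
  simp only [mem_clq] at *
  obtain ⟨hvS, hv⟩ := hv
  obtain ⟨huS, hu⟩ := hu
  refine ⟨huS, ?_⟩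
  rcases hv with rfl | hv
  · exact hu
  rcases hu with rfl | hu
  · exact Or.inr hv
  by_cases huc : u = c
  · exact Or.inl huc
  · exact Or.inr ((hS.adj_iff hvS hc hv hu.ne huc).1 hu)

theorem IsTwinCover.adj_of_mem_clq (hS : IsTwinCover G S) {u v c : Fin n} (hc : c ∉ S)
    (hu : u ∈ clq G S c) (hv : v ∈ clq G S c) (huv : u ≠ v) : G.Adj u v := by
  have := hS.mem_clq_trans (mem_clq_comm hc hv) (by rw [mem_clq] at hv; exact hv.1) hu
  rw [mem_clq] at this
  exact this.2.resolve_left huv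

/-- Every vertex outside `S` lies in the clique of a smallest vertex. -/
theorem IsTwinCover.exists_isRep (hS : IsTwinCover G S) {v : Fin n} (hv : v ∉ S) :
    ∃ c, IsRep G S c ∧ v ∈ clq G S c := by
  have hne : (clq G S v).Nonempty := ⟨v, self_mem_clq hv⟩
  have hmem := Finset.min'_mem _ hne
  set c := (clq G S v).min' hne with hc
  have hcS : c ∉ S := (mem_clq.1 hmem).1
  refine ⟨c, ⟨hcS, fun w hw hwS hadj => ?_⟩, mem_clq_comm hv hmem⟩
  have : w ∈ clq G S v := hS.mem_clq_trans hmem hv (by simp [hwS, hadj])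
  exact absurd (Finset.min'_le _ w this) (not_le.2 hw)

theorem IsTwinCover.isRep_unique (hS : IsTwinCover G S) {u c c' : Fin n} (hc : IsRep G S c)
    (hc' : IsRep G S c') (hu : u ∈ clq G S c) (hu' : u ∈ clq G S c') : c = c' := by
  by_contra hne
  have h : c ∈ clq G S c' := hS.mem_clq_trans hu' hc'.1 (mem_clq_comm hc.1 hu)
  have hadj : G.Adj c c' := (mem_clq.1 h).2.resolve_left hne
  rcases lt_or_gt_of_ne hne with hlt | hlt
  · exact hc'.2 c hlt hc.1 hadj
  · exact hc.2 c' hlt hc'.1 hadj.symm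

theorem connected_induce_singleton (v : Fin n) : (G.induce ({v} : Set (Fin n))).Connected := by
  rw [SimpleGraph.induce_singleton_eq_top]
  exact SimpleGraph.connected_top

theorem IsTwinCover.connected_of_subset_clq (hS : IsTwinCover G S) {c : Fin n} (hc : c ∉ S)
    {D : Finset (Fin n)} (hD : D ⊆ clq G S c) (hne : D.Nonempty) :
    (G.induce (D : Set (Fin n))).Connected := by
  obtain ⟨d, hd⟩ := hne
  have : Nonempty (D : Set (Fin n)) := ⟨⟨d, hd⟩⟩
  refine ⟨fun u v => ?_⟩
  by_cases huv : u = v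
  · subst huv; rfl
  · exact SimpleGraph.Adj.reachable (hS.adj_of_mem_clq hc (hD u.2) (hD v.2) fun h =>
      huv (Subtype.ext h))

/-- In a connected set that meets the twin cover, each vertex outside the twin cover has a
neighbour in the twin cover. -/
theorem IsTwinCover.exists_adj_of_connected (hS : IsTwinCover G S) {D : Finset (Fin n)}
    (hD : (G.induce (D : Set (Fin n))).Connected) {u x : Fin n} (hu : u ∈ D) (huS : u ∉ S)
    (hx : x ∈ D) (hxS : x ∈ S) : ∃ y ∈ D, y ∈ S ∧ G.Adj y u := by
  obtain ⟨p⟩ := hD.preconnected ⟨u, hu⟩ ⟨x, hx⟩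
  have key : ∀ {a b : (D : Set (Fin n))}, (G.induce (D : Set (Fin n))).Walk a b →
      (a : Fin n) ∉ S → (b : Fin n) ∈ S → ∃ y ∈ D, y ∈ S ∧ G.Adj y a := by
    intro a b p
    induction p with
    | nil => intro h h'; exact absurd h' h
    | @cons a a' b hadj p ih =>
      intro ha hb
      have hadj' : G.Adj a a' := hadj
      by_cases ha' : (a' : Fin n) ∈ S
      · exact ⟨a', a'.2, ha', hadj'.symm⟩
      · obtain ⟨y, hy, hyS, hya⟩ := ih ha' hb
        refine ⟨y, hy, hyS, ?_⟩
        exact (hS.adj_iff ha' ha hadj'.symm hya.ne (by rintro rfl; exact ha hyS)).1 hya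
  exact key p huS hxS

/-- A connected set that avoids the twin cover lies in one clique. -/
theorem IsTwinCover.subset_clq_of_connected (hS : IsTwinCover G S) {D : Finset (Fin n)}
    (hD : (G.induce (D : Set (Fin n))).Connected) (hDS : ∀ v ∈ D, v ∉ S) {u : Fin n} (hu : u ∈ D) :
    D ⊆ clq G S u := by
  have key : ∀ {a b : (D : Set (Fin n))}, (G.induce (D : Set (Fin n))).Walk a b →
      (a : Fin n) ∈ clq G S b := by
    intro a b p
    induction p with
    | @nil a => exact self_mem_clq (hDS _ a.2)
    | @cons a a' b hadj p ih =>
      have hadj' : G.Adj a a' := hadj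
      exact hS.mem_clq_trans ih (hDS _ b.2) (by simp [hDS _ a.2, hadj'])
  intro v hv
  obtain ⟨p⟩ := hD.preconnected ⟨v, hv⟩ ⟨u, hu⟩
  exact key p

end TwinCover

/-! ### Configurations of the dynamic program -/

/-- A configuration of the dynamic program for a graph on `Fin n` and a twin cover `S`. The label
`lab v` of `v ∈ S` is `0` if `v` is neither used nor dominated, `1` if it is not used, but
dominated, `2` if it belongs to a finished unit, and `3 + ℓ` if it belongs to the unfinished
fragment with name `ℓ`, whose number of vertices is `cnt ℓ`. The cliques outside `S` are processed
in the order of their smallest vertices; `pos` is the current one, of which `used` vertices are in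
use. If `link = x + 1`, then the fragment of `x` contains a vertex of the current clique. The
number of finished units is `units`. -/
@[ext] structure Config (n : ℕ) where
  lab : Fin n → ℕ
  cnt : Fin n → ℕ
  pos : Fin n
  used : ℕ
  link : ℕ
  units : ℕ

/-- The moves: a vertex of the twin cover becomes a fragment, two fragments are joined, a vertex of
the current clique is added to the fragment of `x`, a unit is placed inside the current clique, the
next vertex becomes the current one, and a fragment of the right size is declared a unit. -/
inductive Move (n : ℕ)
  | new (x : Fin n)
  | join (x y : Fin n)
  | attach (x : Fin n)
  | inner
  | next
  | finish (x : Fin n)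

section Moves

variable {n : ℕ} (G : SimpleGraph (Fin n)) (S : Finset (Fin n)) (r : ℕ)

namespace Config

/-- The size of the fragment of `x`. -/
def size (st : Config n) (x : Fin n) : ℕ :=
  ∑ v : Fin n, if (v : ℕ) + 3 = st.lab x then st.cnt v else 0

open Classical in
/-- The labels after `u` has been used: the neighbours of `u` in `S` are dominated now. -/
noncomputable def touch (st : Config n) (u v : Fin n) : ℕ :=
  if v ∈ S ∧ st.lab v = 0 ∧ G.Adj v u then 1 else st.lab v

/-- The initial configuration. -/
def start (hn : 0 < n) : Config n := ⟨fun _ => 0, fun _ => 0, ⟨0, hn⟩, 0, 0, 0⟩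

end Config

open Classical in
/-- The number of vertices of the clique, if `c` is its smallest vertex. -/
noncomputable def cap (c : Fin n) : ℕ := if IsRep G S c then (clq G S c).card else 0

/-- The condition under which a move is possible. -/
def Config.Can (st : Config n) : Move n → Prop
  | .new x => x ∈ S ∧ st.lab x < 2
  | .join x y => 3 ≤ st.lab x ∧ 3 ≤ st.lab y ∧ st.lab x ≠ st.lab y ∧
      st.size x + st.size y < r + 1 ∧ (G.Adj x y ∨ st.link = x + 1 ∧ G.Adj y st.pos)
  | .attach x => 3 ≤ st.lab x ∧ G.Adj x st.pos ∧ st.used < cap G S st.pos ∧ st.size x < r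
  | .inner => st.used + r < cap G S st.pos + 1
  | .next => (st.pos : ℕ) + 1 < n
  | .finish x => 3 ≤ st.lab x ∧ st.size x = r

open Classical in
/-- The configuration after a move. -/
noncomputable def Config.apply (st : Config n) : Move n → Config n
  | .new x =>
    { st with
      lab := fun v => if v = x then x + 3 else st.touch G S x v
      cnt := fun v => if v = x then 1 else st.cnt v
      link := 0 }
  | .join x y =>
    { st with
      lab := fun v => if st.lab v = st.lab y then st.lab x else st.lab v
      cnt := fun v => if (v : ℕ) + 3 = st.lab x then st.cnt v + st.size y else
        if (v : ℕ) + 3 = st.lab y then 0 else st.cnt v }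
  | .attach x =>
    { st with
      lab := st.touch G S st.pos
      cnt := fun v => if (v : ℕ) + 3 = st.lab x then st.cnt v + 1 else st.cnt v
      used := st.used + 1
      link := x + 1 }
  | .inner =>
    { st with
      lab := st.touch G S st.pos
      used := st.used + r
      link := 0
      units := st.units + 1 }
  | .next =>
    { st with
      pos := if h : (st.pos : ℕ) + 1 < n then ⟨st.pos + 1, h⟩ else st.pos
      used := 0
      link := 0 }
  | .finish x =>
    { st with
      lab := fun v => if st.lab v = st.lab x then 2 else st.lab v
      cnt := fun v => if (v : ℕ) + 3 = st.lab x then 0 else st.cnt v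
      link := 0
      units := st.units + 1 }

/-- The vertex `v` is loose: it belongs to an unfinished fragment other than `{v, b}` with
`b ∉ S` and `r = 3`. -/
def Config.Loose (st : Config n) (v : Fin n) : Prop :=
  3 ≤ st.lab v ∧ ¬ (st.lab v = v + 3 ∧ st.cnt v = 2 ∧ r = 3)

open Classical in
/-- For `r ∈ {2, 3}`, only configurations with at most three loose vertices are considered. This
leaves room for the vertices of one unit in an arbitrary state. -/
def Config.Tidy (st : Config n) : Prop :=
  (r = 2 ∨ r = 3) → (univ.filter fun v => st.Loose r v).card < 4

/-- The configurations that the dynamic program reaches. -/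
inductive Reach (hn : 0 < n) : Config n → Prop
  | start : Reach hn (Config.start hn)
  | step {st : Config n} {m : Move n} : Reach hn st → st.Can G S r m → (st.apply G S r m).Tidy r →
      Reach hn (st.apply G S r m)

/-- A vertex outside the twin cover none of whose neighbours in the twin cover belongs to a
unit. -/
def Config.Isolated (st : Config n) (w : Fin n) : Prop :=
  w ∉ S ∧ ∀ x, st.lab x = 2 → ¬ G.Adj x w

open Classical in
/-- The test at the end: there are no unfinished fragments, and, besides the finished units, one
unit inside each clique of isolated vertices suffices for a grouped dominating set with at most
`k` units. -/
def Config.Accept (k : ℕ) (st : Config n) : Prop :=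
  (∀ v, st.lab v < 3) ∧ (∀ w, st.Isolated G S w → r < (clq G S w).card + 1) ∧
  (∀ v ∈ S, st.lab v = 0 → ∃ w, st.Isolated G S w ∧ G.Adj v w) ∧
  st.units + (univ.filter fun w => IsRep G S w ∧ st.Isolated G S w).card < k + 1

end Moves

/-! ### Partial solutions -/

/-- A partial solution: the finished units, and the unfinished fragments with their names. -/
structure Partial (n : ℕ) where
  fin : Finset (Finset (Fin n))
  op : Fin n → Finset (Fin n)

/-- The vertices of a partial solution. -/
def Partial.used {n : ℕ} (g : Partial n) : Finset (Fin n) := g.fin.sup id ∪ univ.biUnion g.op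

theorem Partial.mem_used {n : ℕ} {g : Partial n} {v : Fin n} :
    v ∈ g.used ↔ (∃ D ∈ g.fin, v ∈ D) ∨ ∃ ℓ, v ∈ g.op ℓ := by
  simp [Partial.used, Finset.mem_sup]

section Match

variable {n : ℕ} {G : SimpleGraph (Fin n)} {S : Finset (Fin n)} {r : ℕ}

open Classical in
/-- The configuration `st` describes the partial solution `g`. -/
structure Matches (G : SimpleGraph (Fin n)) (S : Finset (Fin n)) (r : ℕ) (st : Config n)
    (g : Partial n) : Prop where
  fin_card : ∀ D ∈ g.fin, D.card = r
  fin_conn : ∀ D ∈ g.fin, (G.induce (D : Set (Fin n))).Connected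
  fin_disj : ∀ D ∈ g.fin, ∀ D' ∈ g.fin, ∀ v, v ∈ D → v ∈ D' → D = D'
  op_conn : ∀ ℓ, (g.op ℓ).Nonempty → (G.induce (g.op ℓ : Set (Fin n))).Connected
  op_name : ∀ ℓ v, v ∈ g.op ℓ → ℓ ∈ S ∧ ℓ ∈ g.op ℓ
  op_disj : ∀ ℓ ℓ' v, v ∈ g.op ℓ → v ∈ g.op ℓ' → ℓ = ℓ'
  fin_op : ∀ D ∈ g.fin, ∀ ℓ v, v ∈ D → v ∉ g.op ℓ
  op_le : ∀ ℓ, (g.op ℓ).card ≤ r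
  lab_out : ∀ v ∉ S, st.lab v = 0
  lab_fin : ∀ v ∈ S, ∀ D ∈ g.fin, v ∈ D → st.lab v = 2
  lab_op : ∀ v ∈ S, ∀ ℓ, v ∈ g.op ℓ → st.lab v = ℓ + 3
  lab_unused : ∀ v ∈ S, v ∉ g.used → st.lab v = if ∃ u ∈ g.used, G.Adj v u then 1 else 0
  cnt_eq : ∀ ℓ, st.cnt ℓ = (g.op ℓ).card
  units_eq : st.units = g.fin.card
  pos_le : ∀ v ∈ g.used, v ∉ S → ∃ w ∈ clq G S v, w ≤ st.pos
  used_eq : st.used = if IsRep G S st.pos then (clq G S st.pos ∩ g.used).card else 0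
  link_le : st.link ≤ n
  link_eq : ∀ x : Fin n, st.link = x + 1 → ∀ ℓ, x ∈ g.op ℓ →
    IsRep G S st.pos ∧ ∃ b ∈ g.op ℓ, b ∈ clq G S st.pos

namespace Matches

variable {st : Config n} {g : Partial n}

theorem lab_eq_two (h : Matches G S r st g) {v : Fin n} :
    st.lab v = 2 ↔ v ∈ S ∧ ∃ D ∈ g.fin, v ∈ D := by
  constructor
  · intro h2
    have hv : v ∈ S := by by_contra hv; rw [h.lab_out v hv] at h2; omega
    refine ⟨hv, ?_⟩
    by_contra hD
    by_cases hop : ∃ ℓ, v ∈ g.op ℓ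
    · obtain ⟨ℓ, hℓ⟩ := hop
      have := h.lab_op v hv ℓ hℓ
      omega
    · have := h.lab_unused v hv (by rw [Partial.mem_used]; exact not_or.2 ⟨hD, hop⟩)
      split_ifs at this <;> omega
  · rintro ⟨hv, D, hD, hvD⟩
    exact h.lab_fin v hv D hD hvD

theorem three_le_lab (h : Matches G S r st g) {v : Fin n} :
    3 ≤ st.lab v ↔ v ∈ S ∧ ∃ ℓ, v ∈ g.op ℓ := by
  constructor
  · intro h3
    have hv : v ∈ S := by by_contra hv; rw [h.lab_out v hv] at h3; omega
    refine ⟨hv, ?_⟩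
    by_contra hop
    by_cases hD : ∃ D ∈ g.fin, v ∈ D
    · have := h.lab_eq_two.2 ⟨hv, hD⟩
      omega
    · have := h.lab_unused v hv (by rw [Partial.mem_used]; exact not_or.2 ⟨hD, hop⟩)
      split_ifs at this <;> omega
  · rintro ⟨hv, ℓ, hℓ⟩
    have := h.lab_op v hv ℓ hℓ
    omega

theorem lab_lt_two (h : Matches G S r st g) {v : Fin n} (hv : v ∈ S) :
    st.lab v < 2 ↔ v ∉ g.used := by
  have h2 := h.lab_eq_two (v := v)
  have h3 := h.three_le_lab (v := v)
  simp only [hv, true_and] at h2 h3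
  simp only [Partial.mem_used, not_or, ← h2, ← h3]
  omega

theorem size_eq (h : Matches G S r st g) {x ℓ : Fin n} (hx : x ∈ S) (hℓ : x ∈ g.op ℓ) :
    st.size x = (g.op ℓ).card := by
  have hl := h.lab_op x hx ℓ hℓ
  have : ∀ v : Fin n, ((v : ℕ) + 3 = st.lab x) ↔ v = ℓ := fun v => by
    rw [hl]; exact ⟨fun e => Fin.ext (by omega), fun e => by rw [e]⟩
  simp only [Config.size, this, Finset.sum_ite_eq', Finset.mem_univ, if_true, h.cnt_eq]

/-- The labels of unused vertices after the vertices in `N` have been used, whose neighbours in `S`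
are the neighbours of `c`. -/
theorem touch_unused (h : Matches G S r st g) {used' N : Finset (Fin n)} {c v : Fin n}
    (hu : ∀ u, u ∈ used' ↔ u ∈ g.used ∨ u ∈ N) (hv : v ∈ S) (hvu : v ∉ used')
    (hN : (∃ u ∈ N, G.Adj v u) ↔ G.Adj v c) [Decidable (∃ u ∈ used', G.Adj v u)] :
    st.touch G S c v = if ∃ u ∈ used', G.Adj v u then 1 else 0 := by
  have h0 := h.lab_unused v hv (fun h' => hvu ((hu v).2 (Or.inl h')))
  have e : (∃ u ∈ used', G.Adj v u) ↔ (∃ u ∈ g.used, G.Adj v u) ∨ G.Adj v c := by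
    rw [← hN]
    constructor
    · rintro ⟨u, hu', ha⟩
      rcases (hu u).1 hu' with h' | h'
      exacts [Or.inl ⟨u, h', ha⟩, Or.inr ⟨u, h', ha⟩]
    · rintro (⟨u, h', ha⟩ | ⟨u, h', ha⟩)
      exacts [⟨u, (hu u).2 (Or.inl h'), ha⟩, ⟨u, (hu u).2 (Or.inr h'), ha⟩]
  rw [Config.touch, h0]
  by_cases h1 : ∃ u ∈ g.used, G.Adj v u
  · rw [if_pos h1, if_neg (by simp), if_pos (e.2 (Or.inl h1))]
  · rw [if_neg h1]
    by_cases h2 : G.Adj v c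
    · rw [if_pos ⟨hv, rfl, h2⟩, if_pos (e.2 (Or.inr h2))]
    · rw [if_neg (by tauto), if_neg (fun h' => (e.1 h').elim h1 h2)]

theorem touch_of_two_le {c v : Fin n} (h2 : 2 ≤ st.lab v) : st.touch G S c v = st.lab v := by
  rw [Config.touch, if_neg (by omega)]

theorem touch_out {c v : Fin n} (hv : v ∉ S) : st.touch G S c v = st.lab v := by
  rw [Config.touch, if_neg (by tauto)]

theorem start (hn : 0 < n) : Matches G S r (Config.start hn) ⟨∅, fun _ => ∅⟩ := by
  constructor <;> simp [Config.start, Partial.used, Finset.biUnion]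
  exact (ite_self 0).symm

end Matches

end Match

/-! ### The effect of the moves on partial solutions -/

section MatchMoves

variable {n : ℕ} {G : SimpleGraph (Fin n)} {S : Finset (Fin n)} {r : ℕ}

namespace Partial

/-- The vertex `x` becomes a fragment. -/
def new (g : Partial n) (x : Fin n) : Partial n := ⟨g.fin, fun m => if m = x then {x} else g.op m⟩

/-- The fragment named `ℓ'` is merged into the one named `ℓ`. -/
def join (g : Partial n) (ℓ ℓ' : Fin n) : Partial n :=
  ⟨g.fin, fun m => if m = ℓ then g.op ℓ ∪ g.op ℓ' else if m = ℓ' then ∅ else g.op m⟩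

/-- The vertex `b` is added to the fragment named `ℓ`. -/
def attach (g : Partial n) (ℓ b : Fin n) : Partial n :=
  ⟨g.fin, fun m => if m = ℓ then insert b (g.op ℓ) else g.op m⟩

/-- The set `D` is added to the finished units. -/
def inner (g : Partial n) (D : Finset (Fin n)) : Partial n := ⟨insert D g.fin, g.op⟩

/-- The fragment named `ℓ` is declared a unit. -/
def finish (g : Partial n) (ℓ : Fin n) : Partial n :=
  ⟨insert (g.op ℓ) g.fin, fun m => if m = ℓ then ∅ else g.op m⟩

variable {g : Partial n}

theorem mem_op_new {x m v : Fin n} (hx : g.op x = ∅) :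
    v ∈ (g.new x).op m ↔ v ∈ g.op m ∨ (v = x ∧ m = x) := by
  by_cases hm : m = x
  · subst hm; simp [new, hx]
  · simp [new, hm]

theorem mem_op_join {ℓ ℓ' m v : Fin n} (hne : ℓ ≠ ℓ') : v ∈ (g.join ℓ ℓ').op m ↔
    (v ∈ g.op m ∧ m ≠ ℓ') ∨ (v ∈ g.op ℓ' ∧ m = ℓ) := by
  by_cases hm : m = ℓ
  · subst hm; simp [join, hne]
  · by_cases hm' : m = ℓ'
    · subst hm'; simp [join, hm]
    · simp [join, hm, hm']

theorem mem_op_attach {ℓ b m v : Fin n} :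
    v ∈ (g.attach ℓ b).op m ↔ v ∈ g.op m ∨ (v = b ∧ m = ℓ) := by
  by_cases hm : m = ℓ
  · subst hm; simp [attach, or_comm]
  · simp [attach, hm]

theorem mem_op_finish {ℓ m v : Fin n} : v ∈ (g.finish ℓ).op m ↔ v ∈ g.op m ∧ m ≠ ℓ := by
  by_cases hm : m = ℓ <;> simp [finish, hm]

theorem mem_used_new {x v : Fin n} (hx : g.op x = ∅) :
    v ∈ (g.new x).used ↔ v ∈ g.used ∨ v ∈ ({x} : Finset (Fin n)) := by
  simp only [mem_used, mem_op_new hx, Finset.mem_singleton]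
  simp only [new]
  grind

theorem mem_used_join {ℓ ℓ' v : Fin n} (hne : ℓ ≠ ℓ') :
    v ∈ (g.join ℓ ℓ').used ↔ v ∈ g.used := by
  simp only [mem_used, mem_op_join hne]
  simp only [join]
  grind

theorem mem_used_attach {ℓ b v : Fin n} :
    v ∈ (g.attach ℓ b).used ↔ v ∈ g.used ∨ v ∈ ({b} : Finset (Fin n)) := by
  simp only [mem_used, mem_op_attach, Finset.mem_singleton]
  simp only [attach]
  grind

theorem mem_used_inner {D : Finset (Fin n)} {v : Fin n} :
    v ∈ (g.inner D).used ↔ v ∈ g.used ∨ v ∈ D := by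
  simp only [mem_used, inner, Finset.mem_insert]
  grind

theorem mem_used_finish {ℓ v : Fin n} : v ∈ (g.finish ℓ).used ↔ v ∈ g.used := by
  simp only [mem_used, mem_op_finish]
  simp only [finish, Finset.mem_insert]
  grind

end Partial

open Partial

namespace Matches

variable {st : Config n} {g : Partial n}

theorem op_eq_empty (h : Matches G S r st g) {x : Fin n} (hx : x ∉ g.used) : g.op x = ∅ := by
  by_contra hne
  obtain ⟨v, hv⟩ := Finset.nonempty_iff_ne_empty.2 hne
  exact hx (mem_used.2 (Or.inr ⟨x, (h.op_name x v hv).2⟩))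

theorem new (h : Matches G S r st g) (hr : 1 ≤ r) {x : Fin n} (hx : x ∈ S) (hu : x ∉ g.used) :
    Matches G S r (st.apply G S r (.new x)) (g.new x) := by
  classical
  have he := h.op_eq_empty hu
  have hux : ∀ D ∈ g.fin, x ∉ D := fun D hD hxD => hu (mem_used.2 (Or.inl ⟨D, hD, hxD⟩))
  have hux' : ∀ ℓ, x ∉ g.op ℓ := fun ℓ hxD => hu (mem_used.2 (Or.inr ⟨ℓ, hxD⟩))
  have hop : ∀ m v, v ∈ (g.new x).op m ↔ v ∈ g.op m ∨ (v = x ∧ m = x) := fun m v => mem_op_new he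
  have hus : ∀ v, v ∈ (g.new x).used ↔ v ∈ g.used ∨ v ∈ ({x} : Finset (Fin n)) := fun v =>
    mem_used_new he
  have hlab : ∀ v, (st.apply G S r (.new x)).lab v = if v = x then (x : ℕ) + 3
      else st.touch G S x v := fun v => rfl
  have hopx : (g.new x).op x = {x} := by simp [Partial.new]
  have hop' : ∀ m, m ≠ x → (g.new x).op m = g.op m := fun m hm => by simp [Partial.new, hm]
  constructor
  case fin_card => exact h.fin_card
  case fin_conn => exact h.fin_conn
  case fin_disj => exact h.fin_disj
  case op_conn =>
    intro ℓ hne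
    by_cases hℓ : ℓ = x
    · subst hℓ
      rw [hopx, Finset.coe_singleton]
      exact connected_induce_singleton _
    · rw [hop' ℓ hℓ] at hne ⊢
      exact h.op_conn ℓ hne
  case op_name =>
    intro ℓ v hv
    rw [hop] at hv ⊢
    rcases hv with hv | ⟨rfl, rfl⟩
    · exact ⟨(h.op_name ℓ v hv).1, Or.inl (h.op_name ℓ v hv).2⟩
    · exact ⟨hx, Or.inr ⟨rfl, rfl⟩⟩
  case op_disj =>
    intro ℓ ℓ' v hv hv'
    rw [hop] at hv hv'
    have := h.op_disj ℓ ℓ' v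
    grind
  case fin_op =>
    intro D hD ℓ v hv hv'
    rw [hop] at hv'
    rcases hv' with hv' | ⟨rfl, rfl⟩
    · exact h.fin_op D hD ℓ v hv hv'
    · exact hux D hD hv
  case op_le =>
    intro ℓ
    by_cases hℓ : ℓ = x
    · subst hℓ; rw [hopx]; simpa using hr
    · rw [hop' ℓ hℓ]; exact h.op_le ℓ
  case lab_out =>
    intro v hv
    rw [hlab, if_neg (by rintro rfl; exact hv hx), touch_out hv, h.lab_out v hv]
  case lab_fin =>
    intro v hv D hD hvD
    have := h.lab_fin v hv D hD hvD
    rw [hlab, if_neg (by rintro rfl; exact hux D hD hvD), touch_of_two_le (by omega), this]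
  case lab_op =>
    intro v hv ℓ hvℓ
    rw [hop] at hvℓ
    rcases hvℓ with hvℓ | ⟨rfl, rfl⟩
    · have := h.lab_op v hv ℓ hvℓ
      rw [hlab, if_neg (by rintro rfl; exact hux' ℓ hvℓ), touch_of_two_le (by omega), this]
    · rw [hlab, if_pos rfl]
  case lab_unused =>
    intro v hv hvu
    rw [hlab, if_neg (by rintro rfl; exact hvu ((hus v).2 (by simp)))]
    exact h.touch_unused hus hv hvu (by simp)
  case cnt_eq =>
    intro ℓ
    by_cases hℓ : ℓ = x
    · subst hℓ; simp [hopx, Config.apply]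
    · rw [hop' ℓ hℓ, ← h.cnt_eq]; simp [Config.apply, hℓ]
  case units_eq => exact h.units_eq
  case pos_le =>
    intro v hv hvS
    rcases (hus v).1 hv with hv | hv
    · exact h.pos_le v hv hvS
    · rw [Finset.mem_singleton.1 hv] at hvS; exact absurd hx hvS
  case used_eq =>
    have : clq G S st.pos ∩ (g.new x).used = clq G S st.pos ∩ g.used := by
      ext v
      simp only [Finset.mem_inter, hus, Finset.mem_singleton, mem_clq]
      grind
    exact this ▸ h.used_eq
  case link_le => exact Nat.zero_le _
  case link_eq =>
    intro y hy
    exact absurd hy (by simp [Config.apply])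

theorem join (h : Matches G S r st g) (hS : IsTwinCover G S) {x y ℓ ℓ' : Fin n} (hx : x ∈ S)
    (hy : y ∈ S) (hxℓ : x ∈ g.op ℓ) (hyℓ : y ∈ g.op ℓ') (hne : ℓ ≠ ℓ')
    (hcard : (g.op ℓ).card + (g.op ℓ').card ≤ r)
    (hadj : G.Adj x y ∨ st.link = x + 1 ∧ G.Adj y st.pos) :
    Matches G S r (st.apply G S r (.join x y)) (g.join ℓ ℓ') := by
  have hop : ∀ m v, v ∈ (g.join ℓ ℓ').op m ↔ (v ∈ g.op m ∧ m ≠ ℓ') ∨ (v ∈ g.op ℓ' ∧ m = ℓ) :=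
    fun m v => mem_op_join hne
  have hus : ∀ v, v ∈ (g.join ℓ ℓ').used ↔ v ∈ g.used := fun v => mem_used_join hne
  have hus' : (g.join ℓ ℓ').used = g.used := Finset.ext hus
  have hlx := h.lab_op x hx ℓ hxℓ
  have hly := h.lab_op y hy ℓ' hyℓ
  have hlab : ∀ v, (st.apply G S r (.join x y)).lab v =
    if st.lab v = st.lab y then st.lab x else st.lab v := fun v => rfl
  have hopℓ : (g.join ℓ ℓ').op ℓ = g.op ℓ ∪ g.op ℓ' := by simp [Partial.join]
  have hopℓ' : (g.join ℓ ℓ').op ℓ' = ∅ := by simp [Partial.join, hne.symm]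
  have hop' : ∀ m, m ≠ ℓ → m ≠ ℓ' → (g.join ℓ ℓ').op m = g.op m := fun m hm hm' => by
    simp [Partial.join, hm, hm']
  have hdisj : Disjoint (g.op ℓ) (g.op ℓ') := Finset.disjoint_left.2 fun v hv hv' =>
    hne (h.op_disj ℓ ℓ' v hv hv')
  constructor
  case fin_card => exact h.fin_card
  case fin_conn => exact h.fin_conn
  case fin_disj => exact h.fin_disj
  case op_conn =>
    intro m hm
    by_cases h1 : m = ℓ
    · subst h1
      rw [hopℓ, Finset.coe_union]
      have c1 := (h.op_conn m ⟨x, hxℓ⟩).preconnected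
      have c2 := (h.op_conn ℓ' ⟨y, hyℓ⟩).preconnected
      rcases hadj with hadj | ⟨hl, hadj⟩
      · exact SimpleGraph.connected_induce_union c1 c2 hxℓ hyℓ hadj
      · obtain ⟨hrep, b, hb, hbc⟩ := h.link_eq x hl m hxℓ
        exact SimpleGraph.connected_induce_union c1 c2 hb hyℓ
          ((hS.adj_iff_of_mem_clq hy hrep.1 hbc).2 hadj).symm
    · by_cases h2 : m = ℓ'
      · subst h2; rw [hopℓ'] at hm; exact absurd hm (by simp)
      · rw [hop' m h1 h2] at hm ⊢; exact h.op_conn m hm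
  case op_name =>
    intro m v hv
    have h1 := h.op_name m
    have h2 := h.op_name ℓ x hxℓ
    rw [hop] at hv ⊢
    rcases hv with ⟨hv, hm⟩ | ⟨hv, rfl⟩
    · exact ⟨(h1 v hv).1, Or.inl ⟨(h1 v hv).2, hm⟩⟩
    · exact ⟨h2.1, Or.inl ⟨h2.2, hne⟩⟩
  case op_disj =>
    intro m m' v hv hv'
    rw [hop] at hv hv'
    have h1 := h.op_disj m m' v
    have h2 := h.op_disj m ℓ' v
    have h3 := h.op_disj m' ℓ' v
    grind
  case fin_op =>
    intro D hD m v hv hv'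
    rw [hop] at hv'
    rcases hv' with hv' | hv'
    · exact h.fin_op D hD m v hv hv'.1
    · exact h.fin_op D hD ℓ' v hv hv'.1
  case op_le =>
    intro m
    by_cases h1 : m = ℓ
    · rw [h1, hopℓ]; exact (Finset.card_union_le _ _).trans hcard
    · by_cases h2 : m = ℓ'
      · rw [h2, hopℓ']; simp
      · rw [hop' m h1 h2]; exact h.op_le m
  case lab_out =>
    intro v hv
    rw [hlab, h.lab_out v hv, if_neg (by omega)]
  case lab_fin =>
    intro v hv D hD hvD
    rw [hlab, h.lab_fin v hv D hD hvD, if_neg (by omega)]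
  case lab_op =>
    intro v hv m hvm
    rw [hop] at hvm
    rcases hvm with ⟨hvm, hm⟩ | ⟨hvm, rfl⟩
    · have := h.lab_op v hv m hvm
      rw [hlab, if_neg (by rw [this, hly]; intro e; exact hm (Fin.ext (by omega))), this]
    · rw [hlab, h.lab_op v hv ℓ' hvm, if_pos hly.symm, hlx]
  case lab_unused =>
    intro v hv hvu
    rw [hus'] at hvu
    have := (h.lab_lt_two hv).2 hvu
    rw [hlab, if_neg (by omega), hus', h.lab_unused v hv hvu]
  case cnt_eq =>
    intro m
    have hc : (st.apply G S r (.join x y)).cnt m = if (m : ℕ) + 3 = st.lab x then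
        st.cnt m + st.size y else if (m : ℕ) + 3 = st.lab y then 0 else st.cnt m := rfl
    rw [hc, hlx, hly, h.size_eq hy hyℓ, h.cnt_eq]
    by_cases h1 : m = ℓ
    · subst h1; rw [if_pos rfl, hopℓ, Finset.card_union_of_disjoint hdisj]
    · have h1' : (m : ℕ) ≠ ℓ := fun e => h1 (Fin.ext e)
      rw [if_neg (by omega)]
      by_cases h2 : m = ℓ'
      · subst h2; rw [if_pos rfl, hopℓ', Finset.card_empty]
      · have h2' : (m : ℕ) ≠ ℓ' := fun e => h2 (Fin.ext e)
        rw [if_neg (by omega), hop' m h1 h2]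
  case units_eq => exact h.units_eq
  case pos_le => rw [hus']; exact h.pos_le
  case used_eq => rw [hus']; exact h.used_eq
  case link_le => exact h.link_le
  case link_eq =>
    intro z hz m hzm
    have hz' : st.link = z + 1 := hz
    rw [hop] at hzm
    rcases hzm with ⟨hzm, hm⟩ | ⟨hzm, rfl⟩
    · obtain ⟨hrep, b, hb, hbc⟩ := h.link_eq z hz' m hzm
      exact ⟨hrep, b, (hop m b).2 (Or.inl ⟨hb, hm⟩), hbc⟩
    · obtain ⟨hrep, b, hb, hbc⟩ := h.link_eq z hz' ℓ' hzm
      exact ⟨hrep, b, (hop m b).2 (Or.inr ⟨hb, rfl⟩), hbc⟩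

theorem attach (h : Matches G S r st g) (hS : IsTwinCover G S) {x ℓ b : Fin n} (hx : x ∈ S)
    (hxℓ : x ∈ g.op ℓ) (hadj : G.Adj x st.pos) (hrep : IsRep G S st.pos)
    (hb : b ∈ clq G S st.pos) (hbu : b ∉ g.used) (hcard : (g.op ℓ).card < r) :
    Matches G S r (st.apply G S r (.attach x)) (g.attach ℓ b) := by
  classical
  have hop : ∀ m v, v ∈ (g.attach ℓ b).op m ↔ v ∈ g.op m ∨ (v = b ∧ m = ℓ) := fun m v =>
    mem_op_attach
  have hus : ∀ v, v ∈ (g.attach ℓ b).used ↔ v ∈ g.used ∨ v ∈ ({b} : Finset (Fin n)) := fun v =>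
    mem_used_attach
  have hux : ∀ D ∈ g.fin, b ∉ D := fun D hD hxD => hbu (mem_used.2 (Or.inl ⟨D, hD, hxD⟩))
  have hux' : ∀ ℓ, b ∉ g.op ℓ := fun ℓ hxD => hbu (mem_used.2 (Or.inr ⟨ℓ, hxD⟩))
  have hbS : b ∉ S := (mem_clq.1 hb).1
  have hlx := h.lab_op x hx ℓ hxℓ
  have hlab : ∀ v, (st.apply G S r (.attach x)).lab v = st.touch G S st.pos v := fun v => rfl
  have hopℓ : (g.attach ℓ b).op ℓ = insert b (g.op ℓ) := by simp [Partial.attach]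
  have hop' : ∀ m, m ≠ ℓ → (g.attach ℓ b).op m = g.op m := fun m hm => by
    simp [Partial.attach, hm]
  constructor
  case fin_card => exact h.fin_card
  case fin_conn => exact h.fin_conn
  case fin_disj => exact h.fin_disj
  case op_conn =>
    intro m hm
    by_cases h1 : m = ℓ
    · subst h1
      rw [hopℓ, Finset.coe_insert, Set.insert_eq]
      exact SimpleGraph.connected_induce_union
        (connected_induce_singleton _).preconnected
        (h.op_conn m ⟨x, hxℓ⟩).preconnected (Set.mem_singleton b) hxℓ
        ((hS.adj_iff_of_mem_clq hx hrep.1 hb).2 hadj).symm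
    · rw [hop' m h1] at hm ⊢; exact h.op_conn m hm
  case op_name =>
    intro m v hv
    rw [hop] at hv ⊢
    rcases hv with hv | ⟨-, rfl⟩
    · exact ⟨(h.op_name m v hv).1, Or.inl (h.op_name m v hv).2⟩
    · exact ⟨(h.op_name m x hxℓ).1, Or.inl (h.op_name m x hxℓ).2⟩
  case op_disj =>
    intro m m' v hv hv'
    rw [hop] at hv hv'
    have := h.op_disj m m' v
    grind
  case fin_op =>
    intro D hD m v hv hv'
    rw [hop] at hv'
    rcases hv' with hv' | ⟨rfl, -⟩
    · exact h.fin_op D hD m v hv hv'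
    · exact hux D hD hv
  case op_le =>
    intro m
    by_cases h1 : m = ℓ
    · rw [h1, hopℓ]; exact (Finset.card_insert_le _ _).trans hcard
    · rw [hop' m h1]; exact h.op_le m
  case lab_out =>
    intro v hv
    rw [hlab, touch_out hv, h.lab_out v hv]
  case lab_fin =>
    intro v hv D hD hvD
    have := h.lab_fin v hv D hD hvD
    rw [hlab, touch_of_two_le (by omega), this]
  case lab_op =>
    intro v hv m hvm
    rw [hop] at hvm
    rcases hvm with hvm | ⟨rfl, -⟩
    · have := h.lab_op v hv m hvm
      rw [hlab, touch_of_two_le (by omega), this]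
    · exact absurd hv hbS
  case lab_unused =>
    intro v hv hvu
    rw [hlab]
    exact h.touch_unused hus hv hvu (by simpa using hS.adj_iff_of_mem_clq hv hrep.1 hb)
  case cnt_eq =>
    intro m
    have hc : (st.apply G S r (.attach x)).cnt m = if (m : ℕ) + 3 = st.lab x then
        st.cnt m + 1 else st.cnt m := rfl
    rw [hc, hlx, h.cnt_eq]
    by_cases h1 : m = ℓ
    · subst h1; rw [if_pos rfl, hopℓ, Finset.card_insert_of_notMem (hux' m)]
    · have h1' : (m : ℕ) ≠ ℓ := fun e => h1 (Fin.ext e)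
      rw [if_neg (by omega), hop' m h1]
  case units_eq => exact h.units_eq
  case pos_le =>
    intro v hv hvS
    rcases (hus v).1 hv with hv | hv
    · exact h.pos_le v hv hvS
    · rw [Finset.mem_singleton.1 hv]
      exact ⟨st.pos, mem_clq_comm hrep.1 hb, le_rfl⟩
  case used_eq =>
    have e := h.used_eq
    rw [if_pos hrep] at e
    change st.used + 1 = if IsRep G S st.pos then _ else _
    rw [if_pos hrep, e]
    have : clq G S st.pos ∩ (g.attach ℓ b).used = insert b (clq G S st.pos ∩ g.used) := by
      ext v
      simp only [Finset.mem_inter, hus, Finset.mem_singleton, Finset.mem_insert]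
      grind
    rw [show clq G S (st.apply G S r (.attach x)).pos ∩ (g.attach ℓ b).used = _ from this,
      Finset.card_insert_of_notMem (fun h' => hbu (Finset.mem_inter.1 h').2)]
  case link_le => exact x.2
  case link_eq =>
    intro z hz m hzm
    have hz' : (x : ℕ) + 1 = z + 1 := hz
    obtain rfl : x = z := Fin.ext (by omega)
    rw [hop] at hzm
    refine ⟨hrep, b, ?_, hb⟩
    rw [hop]
    right
    refine ⟨rfl, ?_⟩
    rcases hzm with hzm | ⟨-, rfl⟩
    · exact h.op_disj m ℓ x hzm hxℓ
    · rfl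

theorem inner (h : Matches G S r st g) (hS : IsTwinCover G S) (hr : 1 ≤ r)
    (hrep : IsRep G S st.pos) {D : Finset (Fin n)} (hD : D ⊆ clq G S st.pos) (hcard : D.card = r)
    (hDu : ∀ v ∈ D, v ∉ g.used) :
    Matches G S r (st.apply G S r .inner) (g.inner D) := by
  classical
  have hus : ∀ v, v ∈ (g.inner D).used ↔ v ∈ g.used ∨ v ∈ D := fun v => mem_used_inner
  have hDS : ∀ v ∈ D, v ∉ S := fun v hv => (mem_clq.1 (hD hv)).1
  have hne : D.Nonempty := Finset.card_pos.1 (by omega)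
  have hfin : ∀ E, E ∈ (g.inner D).fin ↔ E = D ∨ E ∈ g.fin := fun E => by simp [Partial.inner]
  have hux : ∀ E ∈ g.fin, ∀ v ∈ D, v ∉ E := fun E hE v hv hvE =>
    hDu v hv (mem_used.2 (Or.inl ⟨E, hE, hvE⟩))
  have hlab : ∀ v, (st.apply G S r .inner).lab v = st.touch G S st.pos v := fun v => rfl
  constructor
  case fin_card =>
    intro E hE
    rcases (hfin E).1 hE with rfl | hE
    exacts [hcard, h.fin_card E hE]
  case fin_conn =>
    intro E hE
    rcases (hfin E).1 hE with rfl | hE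
    exacts [hS.connected_of_subset_clq hrep.1 hD hne, h.fin_conn E hE]
  case fin_disj =>
    intro E hE E' hE' v hv hv'
    rcases (hfin E).1 hE with h1 | h1 <;> rcases (hfin E').1 hE' with h2 | h2
    · rw [h1, h2]
    · exact absurd hv' (hux E' h2 v (h1 ▸ hv))
    · exact absurd hv (hux E h1 v (h2 ▸ hv'))
    · exact h.fin_disj E h1 E' h2 v hv hv'
  case op_conn => exact h.op_conn
  case op_name => exact h.op_name
  case op_disj => exact h.op_disj
  case fin_op =>
    intro E hE ℓ v hv hv'
    rcases (hfin E).1 hE with rfl | hE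
    · exact hDu v hv (mem_used.2 (Or.inr ⟨ℓ, hv'⟩))
    · exact h.fin_op E hE ℓ v hv hv'
  case op_le => exact h.op_le
  case lab_out =>
    intro v hv
    rw [hlab, touch_out hv, h.lab_out v hv]
  case lab_fin =>
    intro v hv E hE hvE
    rcases (hfin E).1 hE with rfl | hE
    · exact absurd hv (hDS v hvE)
    · have := h.lab_fin v hv E hE hvE
      rw [hlab, touch_of_two_le (by omega), this]
  case lab_op =>
    intro v hv m hvm
    have := h.lab_op v hv m hvm
    rw [hlab, touch_of_two_le (by omega), this]
  case lab_unused =>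
    intro v hv hvu
    rw [hlab]
    refine h.touch_unused hus hv hvu ⟨fun ⟨u, hu, ha⟩ => ?_, fun ha => ?_⟩
    · exact (hS.adj_iff_of_mem_clq hv hrep.1 (hD hu)).1 ha
    · obtain ⟨d, hd⟩ := hne
      exact ⟨d, hd, (hS.adj_iff_of_mem_clq hv hrep.1 (hD hd)).2 ha⟩
  case cnt_eq => exact h.cnt_eq
  case units_eq =>
    change st.units + 1 = (insert D g.fin).card
    rw [Finset.card_insert_of_notMem, h.units_eq]
    intro hDf
    obtain ⟨d, hd⟩ := hne
    exact hux D hDf d hd hd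
  case pos_le =>
    intro v hv hvS
    rcases (hus v).1 hv with hv | hv
    · exact h.pos_le v hv hvS
    · exact ⟨st.pos, mem_clq_comm hrep.1 (hD hv), le_rfl⟩
  case used_eq =>
    have e := h.used_eq
    rw [if_pos hrep] at e
    change st.used + r = if IsRep G S st.pos then _ else _
    rw [if_pos hrep, e]
    have : clq G S st.pos ∩ (g.inner D).used = (clq G S st.pos ∩ g.used) ∪ D := by
      ext v
      have := @hD v
      simp only [Finset.mem_inter, hus, Finset.mem_union]
      grind
    rw [show clq G S (st.apply G S r .inner).pos ∩ (g.inner D).used = _ from this,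
      Finset.card_union_of_disjoint, hcard]
    exact Finset.disjoint_left.2 fun v hv hv' => hDu v hv' (Finset.mem_inter.1 hv).2
  case link_le => exact Nat.zero_le _
  case link_eq =>
    intro y hy
    exact absurd hy (by simp [Config.apply])

theorem next (h : Matches G S r st g) (hS : IsTwinCover G S) (hp : (st.pos : ℕ) + 1 < n) :
    Matches G S r (st.apply G S r .next) g := by
  have hpos : (st.apply G S r .next).pos = ⟨st.pos + 1, hp⟩ := by simp [Config.apply, hp]
  refine ⟨h.fin_card, h.fin_conn, h.fin_disj, h.op_conn, h.op_name, h.op_disj, h.fin_op, h.op_le,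
    h.lab_out, h.lab_fin, h.lab_op, h.lab_unused, h.cnt_eq, h.units_eq, ?_, ?_, Nat.zero_le _, ?_⟩
  · intro v hv hvS
    obtain ⟨w, hw, hle⟩ := h.pos_le v hv hvS
    refine ⟨w, hw, hle.trans ?_⟩
    rw [hpos]
    exact Fin.mk_le_mk.2 (Nat.le_succ _)
  · change 0 = _
    rw [hpos]
    split_ifs with hrep
    · symm
      rw [Finset.card_eq_zero]
      by_contra hne
      obtain ⟨v, hv⟩ := Finset.nonempty_iff_ne_empty.2 hne
      obtain ⟨hvc, hvu⟩ := Finset.mem_inter.1 hv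
      obtain ⟨w, hw, hle⟩ := h.pos_le v hvu (mem_clq.1 hvc).1
      have hw' := hS.mem_clq_trans hvc hrep.1 hw
      have hlt : w < (⟨st.pos + 1, hp⟩ : Fin n) := by
        rw [Fin.lt_def]; exact Nat.lt_succ_of_le hle
      rw [mem_clq] at hw'
      exact hrep.2 w hlt hw'.1 (hw'.2.resolve_left hlt.ne)
    · rfl
  · intro y hy
    exact absurd hy (by simp [Config.apply])

theorem finish (h : Matches G S r st g) {x ℓ : Fin n} (hx : x ∈ S) (hxℓ : x ∈ g.op ℓ)
    (hcard : (g.op ℓ).card = r) :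
    Matches G S r (st.apply G S r (.finish x)) (g.finish ℓ) := by
  have hop : ∀ m v, v ∈ (g.finish ℓ).op m ↔ v ∈ g.op m ∧ m ≠ ℓ := fun m v => mem_op_finish
  have hus' : (g.finish ℓ).used = g.used := Finset.ext fun v => mem_used_finish
  have hfin : ∀ E, E ∈ (g.finish ℓ).fin ↔ E = g.op ℓ ∨ E ∈ g.fin := fun E => by
    simp [Partial.finish]
  have hlx := h.lab_op x hx ℓ hxℓ
  have hlab : ∀ v, (st.apply G S r (.finish x)).lab v =
    if st.lab v = st.lab x then 2 else st.lab v := fun v => rfl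
  have hopℓ : (g.finish ℓ).op ℓ = ∅ := by simp [Partial.finish]
  have hop' : ∀ m, m ≠ ℓ → (g.finish ℓ).op m = g.op m := fun m hm => by
    simp [Partial.finish, hm]
  constructor
  case fin_card =>
    intro E hE
    rcases (hfin E).1 hE with rfl | hE
    exacts [hcard, h.fin_card E hE]
  case fin_conn =>
    intro E hE
    rcases (hfin E).1 hE with rfl | hE
    exacts [h.op_conn ℓ ⟨x, hxℓ⟩, h.fin_conn E hE]
  case fin_disj =>
    intro E hE E' hE' v hv hv'
    rcases (hfin E).1 hE with h1 | h1 <;> rcases (hfin E').1 hE' with h2 | h2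
    · rw [h1, h2]
    · exact absurd (h1 ▸ hv) (h.fin_op E' h2 ℓ v hv')
    · exact absurd (h2 ▸ hv') (h.fin_op E h1 ℓ v hv)
    · exact h.fin_disj E h1 E' h2 v hv hv'
  case op_conn =>
    intro m hm
    by_cases h1 : m = ℓ
    · subst h1; rw [hopℓ] at hm; exact absurd hm (by simp)
    · rw [hop' m h1] at hm ⊢; exact h.op_conn m hm
  case op_name =>
    intro m v hv
    rw [hop] at hv ⊢
    have := h.op_name m v hv.1
    exact ⟨this.1, this.2, hv.2⟩
  case op_disj =>
    intro m m' v hv hv'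
    rw [hop] at hv hv'
    exact h.op_disj m m' v hv.1 hv'.1
  case fin_op =>
    intro E hE m v hv hv'
    rw [hop] at hv'
    rcases (hfin E).1 hE with rfl | hE
    · exact hv'.2 (h.op_disj m ℓ v hv'.1 hv)
    · exact h.fin_op E hE m v hv hv'.1
  case op_le =>
    intro m
    by_cases h1 : m = ℓ
    · rw [h1, hopℓ]; simp
    · rw [hop' m h1]; exact h.op_le m
  case lab_out =>
    intro v hv
    rw [hlab, h.lab_out v hv, if_neg (by omega)]
  case lab_fin =>
    intro v hv E hE hvE
    rcases (hfin E).1 hE with rfl | hE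
    · rw [hlab, h.lab_op v hv ℓ hvE, if_pos hlx.symm]
    · rw [hlab, h.lab_fin v hv E hE hvE, if_neg (by omega)]
  case lab_op =>
    intro v hv m hvm
    rw [hop] at hvm
    have := h.lab_op v hv m hvm.1
    rw [hlab, if_neg (by rw [this, hlx]; intro e; exact hvm.2 (Fin.ext (by omega))), this]
  case lab_unused =>
    intro v hv hvu
    rw [hus'] at hvu
    have := (h.lab_lt_two hv).2 hvu
    rw [hlab, if_neg (by omega), hus', h.lab_unused v hv hvu]
  case cnt_eq =>
    intro m
    have hc : (st.apply G S r (.finish x)).cnt m = if (m : ℕ) + 3 = st.lab x then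
        0 else st.cnt m := rfl
    rw [hc, hlx, h.cnt_eq]
    by_cases h1 : m = ℓ
    · subst h1; rw [if_pos rfl, hopℓ, Finset.card_empty]
    · have h1' : (m : ℕ) ≠ ℓ := fun e => h1 (Fin.ext e)
      rw [if_neg (by omega), hop' m h1]
  case units_eq =>
    change st.units + 1 = (insert (g.op ℓ) g.fin).card
    rw [Finset.card_insert_of_notMem, h.units_eq]
    exact fun hf => h.fin_op _ hf ℓ x hxℓ hxℓ
  case pos_le => rw [hus']; exact h.pos_le
  case used_eq => rw [hus']; exact h.used_eq
  case link_le => exact Nat.zero_le _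
  case link_eq =>
    intro y hy
    exact absurd hy (by simp [Config.apply])

end Matches

end MatchMoves

/-! ### Reached configurations describe partial solutions -/

section Soundness

variable {n : ℕ} {G : SimpleGraph (Fin n)} {S : Finset (Fin n)} {r k : ℕ}

theorem Matches.exists_apply {st : Config n} {g : Partial n} (h : Matches G S r st g)
    (hS : IsTwinCover G S) (hr : 1 ≤ r) {m : Move n} (hm : st.Can G S r m) :
    ∃ g', Matches G S r (st.apply G S r m) g' := by
  cases m with
  | new x => exact ⟨_, h.new hr hm.1 ((h.lab_lt_two hm.1).1 hm.2)⟩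
  | join x y =>
    obtain ⟨h1, h2, hne, hsize, hadj⟩ := hm
    obtain ⟨hx, ℓ, hℓ⟩ := h.three_le_lab.1 h1
    obtain ⟨hy, ℓ', hℓ'⟩ := h.three_le_lab.1 h2
    rw [h.size_eq hx hℓ, h.size_eq hy hℓ'] at hsize
    refine ⟨_, h.join hS hx hy hℓ hℓ' ?_ (by omega) hadj⟩
    rintro rfl
    exact hne (by rw [h.lab_op x hx ℓ hℓ, h.lab_op y hy ℓ hℓ'])
  | attach x =>
    obtain ⟨h1, hadj, hcap, hsize⟩ := hm
    obtain ⟨hx, ℓ, hℓ⟩ := h.three_le_lab.1 h1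
    rw [h.size_eq hx hℓ] at hsize
    have hrep : IsRep G S st.pos := by
      by_contra hrep
      rw [cap, if_neg hrep] at hcap
      omega
    have hu := h.used_eq
    rw [if_pos hrep] at hu
    rw [cap, if_pos hrep, hu] at hcap
    have : ∃ b ∈ clq G S st.pos, b ∉ clq G S st.pos ∩ g.used := by
      by_contra hcon
      push Not at hcon
      exact absurd (Finset.card_le_card hcon) (not_le.2 hcap)
    obtain ⟨b, hb, hbu⟩ := this
    exact ⟨_, h.attach hS hx hℓ hadj hrep hb
      (fun hbu' => hbu (Finset.mem_inter.2 ⟨hb, hbu'⟩)) hsize⟩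
  | inner =>
    have hcap : st.used + r < cap G S st.pos + 1 := hm
    have hrep : IsRep G S st.pos := by
      by_contra hrep
      rw [cap, if_neg hrep] at hcap
      omega
    have hu := h.used_eq
    rw [if_pos hrep] at hu
    rw [cap, if_pos hrep, hu] at hcap
    have hle : r ≤ (clq G S st.pos \ g.used).card := by
      have := Finset.card_sdiff_add_card_inter (clq G S st.pos) g.used
      omega
    obtain ⟨D, hD, hcard⟩ := Finset.exists_subset_card_eq hle
    exact ⟨_, h.inner hS hr hrep (fun v hv => (Finset.mem_sdiff.1 (hD hv)).1) hcard
      fun v hv => (Finset.mem_sdiff.1 (hD hv)).2⟩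
  | next => exact ⟨_, h.next hS hm⟩
  | finish x =>
    obtain ⟨hx, ℓ, hℓ⟩ := h.three_le_lab.1 hm.1
    exact ⟨_, h.finish hx hℓ (by rw [← h.size_eq hx hℓ]; exact hm.2)⟩

theorem Reach.exists_matches {hn : 0 < n} {st : Config n} (h : Reach G S r hn st)
    (hS : IsTwinCover G S) (hr : 1 ≤ r) : ∃ g, Matches G S r st g := by
  induction h with
  | start => exact ⟨_, Matches.start hn⟩
  | step _ hm _ ih =>
    obtain ⟨g, hg⟩ := ih
    exact hg.exists_apply hS hr hm

theorem Matches.isolated_iff {st : Config n} {g : Partial n} (h : Matches G S r st g)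
    {w : Fin n} : st.Isolated G S w ↔
      w ∉ S ∧ ∀ x ∈ S, ∀ D ∈ g.fin, x ∈ D → ¬ G.Adj x w := by
  simp only [Config.Isolated, h.lab_eq_two]
  grind

/-- An accepting configuration yields a grouped dominating set: a unit is placed in each clique of
isolated vertices that contains no used vertex. -/
theorem Matches.hasGroupedDominatingSet {st : Config n} {g : Partial n} (h : Matches G S r st g)
    (hS : IsTwinCover G S) (hr : 1 ≤ r) (hacc : st.Accept G S r k) :
    HasGroupedDominatingSet G r k := by
  classical
  obtain ⟨h1, h2, h3, h4⟩ := hacc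
  have hop : ∀ ℓ v, v ∉ g.op ℓ := fun ℓ v hv => by
    obtain ⟨hℓS, hℓ⟩ := h.op_name ℓ v hv
    have := h.three_le_lab.2 ⟨hℓS, ℓ, hℓ⟩
    have := h1 ℓ
    omega
  have hused : ∀ v, v ∈ g.used ↔ ∃ D ∈ g.fin, v ∈ D := fun v => by
    rw [Partial.mem_used]
    exact or_iff_left (fun ⟨ℓ, hℓ⟩ => hop ℓ v hℓ)
  set T := univ.filter fun w => IsRep G S w ∧ st.Isolated G S w with hT
  set T' := T.filter fun w => Disjoint (clq G S w) g.used with hT'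
  have hchoice : ∀ w, ∃ D : Finset (Fin n), w ∈ T → D ⊆ clq G S w ∧ D.card = r := by
    intro w
    by_cases hw : w ∈ T
    · have := h2 w (Finset.mem_filter.1 hw).2.2
      obtain ⟨D, hD, hc⟩ := Finset.exists_subset_card_eq (show r ≤ (clq G S w).card by omega)
      exact ⟨D, fun _ => ⟨hD, hc⟩⟩
    · exact ⟨∅, fun h => absurd h hw⟩
  choose C hC using hchoice
  have hTrep : ∀ w ∈ T, IsRep G S w := fun w hw => (Finset.mem_filter.1 hw).2.1
  have hsub : ∀ w ∈ T', w ∈ T := fun w hw => (Finset.mem_filter.1 hw).1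
  have hnewS : ∀ w ∈ T', ∀ v ∈ C w, v ∉ S := fun w hw v hv =>
    (mem_clq.1 ((hC w (hsub w hw)).1 hv)).1
  have hnew : ∀ w ∈ T', ∀ v ∈ C w, v ∉ g.used := fun w hw v hv =>
    Finset.disjoint_left.1 (Finset.mem_filter.1 hw).2 ((hC w (hsub w hw)).1 hv)
  have hCne : ∀ w ∈ T, (C w).Nonempty := fun w hw =>
    Finset.card_pos.1 (by rw [(hC w hw).2]; omega)
  -- every clique of isolated vertices contains a vertex of a unit
  have hhit : ∀ w, st.Isolated G S w → ∃ u ∈ clq G S w, ∃ D ∈ g.fin ∪ T'.image C, u ∈ D := by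
    intro w hw
    obtain ⟨c, hc, hwc⟩ := hS.exists_isRep hw.1
    have hciso : st.Isolated G S c := by
      refine ⟨hc.1, fun x hx hadj => hw.2 x hx ?_⟩
      exact (hS.adj_iff_of_mem_clq (h.lab_eq_two.1 hx).1 hc.1 hwc).2 hadj
    have hcT : c ∈ T := Finset.mem_filter.2 ⟨Finset.mem_univ _, hc, hciso⟩
    have htr : ∀ u ∈ clq G S c, u ∈ clq G S w := fun u hu =>
      hS.mem_clq_trans (mem_clq_comm hc.1 hwc) hw.1 hu
    by_cases hd : Disjoint (clq G S c) g.used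
    · obtain ⟨u, hu⟩ := hCne c hcT
      exact ⟨u, htr u ((hC c hcT).1 hu), C c, Finset.mem_union_right _
        (Finset.mem_image_of_mem _ (Finset.mem_filter.2 ⟨hcT, hd⟩)), hu⟩
    · obtain ⟨u, hu, huu⟩ := Finset.not_disjoint_iff.1 hd
      obtain ⟨D, hD, huD⟩ := (hused u).1 huu
      exact ⟨u, htr u hu, D, Finset.mem_union_left _ hD, huD⟩
  refine ⟨g.fin ∪ T'.image C, ?_, ?_, ?_, ?_⟩
  · calc _ ≤ g.fin.card + (T'.image C).card := Finset.card_union_le _ _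
      _ ≤ g.fin.card + T.card :=
        Nat.add_le_add_left (Finset.card_image_le.trans (Finset.card_filter_le _ _)) _
      _ ≤ k := by rw [← h.units_eq]; omega
  · intro D hD
    rcases Finset.mem_union.1 hD with hD | hD
    · exact ⟨h.fin_card D hD, h.fin_conn D hD⟩
    · obtain ⟨w, hw, rfl⟩ := Finset.mem_image.1 hD
      have hwT := hsub w hw
      exact ⟨(hC w hwT).2, hS.connected_of_subset_clq (hTrep w hwT).1 (hC w hwT).1 (hCne w hwT)⟩
  · have key : ∀ D ∈ g.fin ∪ T'.image C, ∀ D' ∈ g.fin ∪ T'.image C, ∀ v, v ∈ D → v ∈ D' →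
        D = D' := by
      intro D hD D' hD' v hv hv'
      rcases Finset.mem_union.1 hD with hD | hD <;> rcases Finset.mem_union.1 hD' with hD' | hD'
      · exact h.fin_disj D hD D' hD' v hv hv'
      · obtain ⟨w, hw, rfl⟩ := Finset.mem_image.1 hD'
        exact absurd ((hused v).2 ⟨D, hD, hv⟩) (hnew w hw v hv')
      · obtain ⟨w, hw, rfl⟩ := Finset.mem_image.1 hD
        exact absurd ((hused v).2 ⟨D', hD', hv'⟩) (hnew w hw v hv)
      · obtain ⟨w, hw, rfl⟩ := Finset.mem_image.1 hD
        obtain ⟨w', hw', rfl⟩ := Finset.mem_image.1 hD'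
        rw [hS.isRep_unique (hTrep w (hsub w hw)) (hTrep w' (hsub w' hw'))
          ((hC w (hsub w hw)).1 hv) ((hC w' (hsub w' hw')).1 hv')]
    intro D hD D' hD' hne
    exact Finset.disjoint_left.2 fun v hv hv' => hne (key D hD D' hD' v hv hv')
  · intro v
    by_cases hv : v ∈ S
    · have hl := h1 v
      by_cases hvu : v ∈ g.used
      · obtain ⟨D, hD, hvD⟩ := (hused v).1 hvu
        exact Or.inl ⟨D, Finset.mem_union_left _ hD, hvD⟩
      · have hl' := h.lab_unused v hv hvu
        by_cases hex : ∃ u ∈ g.used, G.Adj v u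
        · obtain ⟨u, hu, hadj⟩ := hex
          obtain ⟨D, hD, huD⟩ := (hused u).1 hu
          exact Or.inr ⟨u, ⟨D, Finset.mem_union_left _ hD, huD⟩, hadj⟩
        · rw [if_neg hex] at hl'
          obtain ⟨w, hw, hadj⟩ := h3 v hv hl'
          obtain ⟨u, hu, D, hD, huD⟩ := hhit w hw
          exact Or.inr ⟨u, ⟨D, hD, huD⟩, (hS.adj_iff_of_mem_clq hv hw.1 hu).2 hadj⟩
    · by_cases hiso : st.Isolated G S v
      · obtain ⟨u, hu, D, hD, huD⟩ := hhit v hiso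
        rcases (mem_clq.1 hu).2 with rfl | hadj
        · exact Or.inl ⟨D, hD, huD⟩
        · exact Or.inr ⟨u, ⟨D, hD, huD⟩, hadj.symm⟩
      · rw [h.isolated_iff] at hiso
        push Not at hiso
        obtain ⟨x, -, D, hD, hxD, hadj⟩ := hiso hv
        exact Or.inr ⟨x, ⟨D, Finset.mem_union_left _ hD, hxD⟩, hadj.symm⟩

end Soundness

/-! ### Every grouped dominating set is found -/

section Completeness

variable {n : ℕ} {G : SimpleGraph (Fin n)} {S : Finset (Fin n)} {r k : ℕ} {hn : 0 < n}
  {𝒟 : Finset (Finset (Fin n))}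

/-- Adjacent vertices of `D`, at least one of which lies in `S`, belong to the same fragment. -/
def Partial.Closed (S : Finset (Fin n)) (G : SimpleGraph (Fin n)) (g : Partial n)
    (D : Finset (Fin n)) : Prop :=
  ∀ u ∈ D, u ∈ S → ∀ v ∈ D, G.Adj u v → ∀ ℓ ℓ', u ∈ g.op ℓ → v ∈ g.op ℓ' → ℓ = ℓ'

/-- The unit `D` of the solution is untouched, or finished, or all its vertices in `S` and at least
one other are in use, and adjacent vertices belong to the same fragment. -/
def Partial.Settled (S : Finset (Fin n)) (G : SimpleGraph (Fin n)) (g : Partial n)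
    (D : Finset (Fin n)) : Prop :=
  (∀ v ∈ D, v ∉ g.used) ∨ D ∈ g.fin ∨
    ((∀ v ∈ D, v ∈ S → v ∈ g.used) ∧ g.Closed S G D ∧ (∃ b ∈ D, b ∉ S ∧ b ∈ g.used) ∧
      ∃ v ∈ D, v ∉ g.used)

/-- The partial solution is a part of the solution `𝒟`, and all units except possibly `D₀` are
settled. -/
structure Partial.Good (S : Finset (Fin n)) (G : SimpleGraph (Fin n)) (𝒟 : Finset (Finset (Fin n)))
    (D₀ : Finset (Fin n)) (g : Partial n) : Prop where
  fin_sub : ∀ D ∈ g.fin, D ∈ 𝒟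
  op_sub : ∀ D ∈ 𝒟, ∀ ℓ v, v ∈ D → v ∈ g.op ℓ → g.op ℓ ⊆ D
  op_cov : ∀ ℓ v, v ∈ g.op ℓ → ∃ D ∈ 𝒟, v ∈ D
  settled : ∀ D ∈ 𝒟, D ≠ D₀ → g.Settled S G D

theorem Partial.Settled.congr {g g' : Partial n} {D : Finset (Fin n)} (h : g.Settled S G D)
    (hu : ∀ v ∈ D, v ∈ g'.used ↔ v ∈ g.used) (hf : D ∈ g.fin → D ∈ g'.fin)
    (hop : ∀ v ∈ D, ∀ ℓ, v ∈ g'.op ℓ → v ∈ g.op ℓ) : g'.Settled S G D := by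
  rcases h with h | h | ⟨h1, h2, ⟨b, hb, hbS, hbu⟩, ⟨v, hv, hvu⟩⟩
  · exact Or.inl fun v hv hv' => h v hv ((hu v hv).1 hv')
  · exact Or.inr (Or.inl (hf h))
  · refine Or.inr (Or.inr ⟨fun v hv hvS => (hu v hv).2 (h1 v hv hvS), ?_,
      ⟨b, hb, hbS, (hu b hb).2 hbu⟩, ⟨v, hv, fun h => hvu ((hu v hv).1 h)⟩⟩)
    intro u hu' huS v hv hadj ℓ ℓ' hℓ hℓ'
    exact h2 u hu' huS v hv hadj ℓ ℓ' (hop u hu' ℓ hℓ) (hop v hv ℓ' hℓ')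

/-- The properties of a grouped dominating set, with disjointness spelled out. -/
structure IsSolution (G : SimpleGraph (Fin n)) (r : ℕ) (𝒟 : Finset (Finset (Fin n))) : Prop where
  card_eq : ∀ D ∈ 𝒟, D.card = r
  conn : ∀ D ∈ 𝒟, (G.induce (D : Set (Fin n))).Connected
  disj : ∀ D ∈ 𝒟, ∀ D' ∈ 𝒟, ∀ v, v ∈ D → v ∈ D' → D = D'
  dom : ∀ v, ∃ D ∈ 𝒟, ∃ u ∈ D, v = u ∨ G.Adj v u

theorem IsGroupedDominatingSet.isSolution (h : IsGroupedDominatingSet G r 𝒟) :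
    IsSolution G r 𝒟 := by
  refine ⟨fun D hD => (h.1 D hD).1, fun D hD => (h.1 D hD).2, fun D hD D' hD' v hv hv' => ?_,
    fun v => ?_⟩
  · by_contra hne
    exact Finset.disjoint_left.1 (h.2.1 D hD D' hD' hne) hv hv'
  · rcases h.2.2 v with ⟨D, hD, hv⟩ | ⟨u, ⟨D, hD, hu⟩, hadj⟩
    · exact ⟨D, hD, v, hv, Or.inl rfl⟩
    · exact ⟨D, hD, u, hu, Or.inr hadj⟩

/-- In a configuration for a partial solution with at most one unsettled unit, few vertices are
loose: for `r ≤ 3`, a settled unfinished unit has used exactly one vertex of `S` and one other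
vertex. -/
theorem Matches.tidy {st : Config n} {g : Partial n} (h : Matches G S r st g)
    (hS : IsTwinCover G S) (h𝒟 : IsSolution G r 𝒟) {D₀ : Finset (Fin n)} (hD₀ : D₀.card ≤ r)
    (hg : g.Good S G 𝒟 D₀) : st.Tidy r := by
  classical
  intro hr
  suffices hsub : (univ.filter fun v => st.Loose r v) ⊆ D₀ by
    have := Finset.card_le_card hsub
    convert (show (univ.filter fun v => st.Loose r v).card < 4 by omega)
  intro v hv
  obtain ⟨h3, hloose⟩ := (Finset.mem_filter.1 hv).2
  obtain ⟨hvS, ℓ, hℓ⟩ := h.three_le_lab.1 h3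
  by_contra hvD₀
  obtain ⟨D, hD, hvD⟩ := hg.op_cov ℓ v hℓ
  have hvu : v ∈ g.used := Partial.mem_used.2 (Or.inr ⟨ℓ, hℓ⟩)
  rcases hg.settled D hD (by rintro rfl; exact hvD₀ hvD) with h1 | h1 | ⟨h1, h2, hb, hw⟩
  · exact h1 v hvD hvu
  · exact h.fin_op D h1 ℓ v hvD hℓ
  obtain ⟨b, hbD, hbS, hbu⟩ := hb
  obtain ⟨w, hwD, hwu⟩ := hw
  have hDf : D ∉ g.fin := fun hDf => h.fin_op D hDf ℓ v hvD hℓ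
  have hvb : v ≠ b := by rintro rfl; exact hbS hvS
  have hvw : v ≠ w := by rintro rfl; exact hwu hvu
  have hbw : b ≠ w := by rintro rfl; exact hwu hbu
  -- `r ≤ 3` leaves no other vertices in `D`
  have hsub3 : ({v, b, w} : Finset (Fin n)) ⊆ D := by
    intro z hz
    simp only [Finset.mem_insert, Finset.mem_singleton] at hz
    rcases hz with rfl | rfl | rfl <;> assumption
  have hc3 : ({v, b, w} : Finset (Fin n)).card = 3 := Finset.card_eq_three.2
    ⟨v, b, w, hvb, hvw, hbw, rfl⟩
  have hcD := h𝒟.card_eq D hD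
  have hle := Finset.card_le_card hsub3
  have hDeq : ({v, b, w} : Finset (Fin n)) = D := Finset.eq_of_subset_of_card_le hsub3 (by omega)
  have hmemD : ∀ z ∈ D, z = v ∨ z = b ∨ z = w := fun z hz => by
    rw [← hDeq] at hz; simpa using hz
  have hwS : w ∉ S := fun hwS => hwu (h1 w hwD hwS)
  have honly : ∀ z ∈ D, z ∈ S → z = v := fun z hz hzS => by
    rcases hmemD z hz with rfl | rfl | rfl
    exacts [rfl, absurd hzS hbS, absurd hzS hwS]
  obtain ⟨y, hy, hyS, hyb⟩ := hS.exists_adj_of_connected (h𝒟.conn D hD) hbD hbS hvD hvS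
  rw [honly y hy hyS] at hyb
  have hbop : b ∈ g.op ℓ := by
    rcases Partial.mem_used.1 hbu with ⟨D', hD', hbD'⟩ | ⟨ℓ', hℓ'⟩
    · rw [h𝒟.disj D' (hg.fin_sub D' hD') D hD b hbD' hbD] at hD'
      exact absurd hD' hDf
    · rw [h2 v hvD hvS b hbD hyb ℓ ℓ' hℓ hℓ']; exact hℓ'
  have hopsub := hg.op_sub D hD ℓ v hvD hℓ
  have hopeq : g.op ℓ = {v, b} := by
    ext z
    simp only [Finset.mem_insert, Finset.mem_singleton]
    constructor
    · intro hz
      rcases hmemD z (hopsub hz) with rfl | rfl | rfl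
      · exact Or.inl rfl
      · exact Or.inr rfl
      · exact absurd (Partial.mem_used.2 (Or.inr ⟨ℓ, hz⟩)) hwu
    · rintro (rfl | rfl) <;> assumption
  obtain ⟨hℓS, hℓop⟩ := h.op_name ℓ v hℓ
  obtain rfl : ℓ = v := honly ℓ (hopsub hℓop) hℓS
  refine hloose ⟨h.lab_op _ hvS _ hℓ, ?_, by omega⟩
  rw [h.cnt_eq, hopeq, Finset.card_pair hvb]

/-- A reached configuration with current vertex `c` and link `κ` describes the partial solution `g`,
which is a part of `𝒟` whose units, except possibly `D₀`, are settled. As all units are nonempty,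
`D₀ = ∅` means that there is no exception. -/
def Stage (G : SimpleGraph (Fin n)) (S : Finset (Fin n)) (r : ℕ) (hn : 0 < n)
    (𝒟 : Finset (Finset (Fin n))) (D₀ : Finset (Fin n)) (g : Partial n) (c : Fin n) (κ : ℕ) :
    Prop :=
  (∃ st : Config n, Reach G S r hn st ∧ Matches G S r st g ∧ st.pos = c ∧ st.link = κ) ∧
    g.Good S G 𝒟 D₀

namespace Stage

variable {g : Partial n} {c : Fin n} {κ : ℕ} {D₀ : Finset (Fin n)}

theorem weaken (h : Stage G S r hn 𝒟 ∅ g c κ) (hr : 1 ≤ r) (h𝒟 : IsSolution G r 𝒟)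
    (D₀ : Finset (Fin n)) : Stage G S r hn 𝒟 D₀ g c κ :=
  ⟨h.1, h.2.fin_sub, h.2.op_sub, h.2.op_cov, fun D hD _ => h.2.settled D hD (by
    rintro rfl
    have := h𝒟.card_eq ∅ hD
    simp at this
    omega)⟩

theorem all_settled (h : Stage G S r hn 𝒟 ∅ g c κ) (hr : 1 ≤ r) (h𝒟 : IsSolution G r 𝒟)
    {D : Finset (Fin n)} (hD : D ∈ 𝒟) : g.Settled S G D :=
  h.2.settled D hD (by
    rintro rfl
    have := h𝒟.card_eq ∅ hD
    simp at this
    omega)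

theorem op_of_used (h : Stage G S r hn 𝒟 D₀ g c κ) (h𝒟 : IsSolution G r 𝒟)
    {D : Finset (Fin n)} (hD : D ∈ 𝒟) (hDf : D ∉ g.fin) {v : Fin n} (hv : v ∈ D)
    (hvu : v ∈ g.used) : ∃ ℓ, v ∈ g.op ℓ := by
  rcases Partial.mem_used.1 hvu with ⟨D', hD', hvD'⟩ | h'
  · rw [h𝒟.disj D' (h.2.fin_sub D' hD') D hD v hvD' hv] at hD'
    exact absurd hD' hDf
  · exact h'

/-- One more move. -/
theorem move (h : ∃ st : Config n, Reach G S r hn st ∧ Matches G S r st g ∧ st.pos = c ∧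
      st.link = κ) (hS : IsTwinCover G S) (h𝒟 : IsSolution G r 𝒟) (hD₀ : D₀.card ≤ r) (m : Move n)
    (g' : Partial n) (c' : Fin n) (κ' : ℕ)
    (hm : ∀ st : Config n, Matches G S r st g → st.pos = c → st.link = κ → st.Can G S r m ∧
      Matches G S r (st.apply G S r m) g' ∧ (st.apply G S r m).pos = c' ∧
      (st.apply G S r m).link = κ')
    (hg' : g'.Good S G 𝒟 D₀) : Stage G S r hn 𝒟 D₀ g' c' κ' := by
  obtain ⟨st, hreach, hmat, hpos, hlink⟩ := h
  obtain ⟨hcan, hmat', hpos', hlink'⟩ := hm st hmat hpos hlink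
  exact ⟨⟨_, hreach.step hcan (hmat'.tidy hS h𝒟 hD₀ hg'), hmat', hpos', hlink'⟩, hg'⟩

theorem new (h : Stage G S r hn 𝒟 D₀ g c κ) (hS : IsTwinCover G S) (hr : 1 ≤ r)
    (h𝒟 : IsSolution G r 𝒟) (hD₀ : D₀ ∈ 𝒟) {x : Fin n} (hx : x ∈ S) (hxD : x ∈ D₀)
    (hxu : x ∉ g.used) : Stage G S r hn 𝒟 D₀ (g.new x) c 0 := by
  obtain ⟨st, -, hmat, -⟩ := id h.1
  have he := hmat.op_eq_empty hxu
  have hop : ∀ m v, v ∈ (g.new x).op m ↔ v ∈ g.op m ∨ (v = x ∧ m = x) := fun m v =>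
    Partial.mem_op_new he
  have hus : ∀ v, v ∈ (g.new x).used ↔ v ∈ g.used ∨ v ∈ ({x} : Finset (Fin n)) := fun v =>
    Partial.mem_used_new he
  have hout : ∀ D ∈ 𝒟, D ≠ D₀ → ∀ v ∈ D, v ≠ x := by
    rintro D hD hne v hv rfl
    exact hne (h𝒟.disj D hD D₀ hD₀ v hv hxD)
  refine move h.1 hS h𝒟 (h𝒟.card_eq D₀ hD₀).le (.new x) _ _ _ (fun st hmat hpos hlink =>
    ⟨⟨hx, (hmat.lab_lt_two hx).2 hxu⟩, hmat.new hr hx hxu, hpos, rfl⟩)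
    ⟨h.2.fin_sub, ?_, ?_, fun D hD hne => (h.2.settled D hD hne).congr ?_ id ?_⟩
  · intro D hD ℓ v hv hvℓ u hu
    rw [hop] at hvℓ hu
    have h1 := h.2.op_sub D hD ℓ v hv
    rcases hvℓ with hvℓ | ⟨rfl, rfl⟩
    · rcases hu with hu | ⟨rfl, rfl⟩
      · exact h1 hvℓ hu
      · rw [he] at hvℓ; exact absurd hvℓ (Finset.notMem_empty _)
    · rcases hu with hu | ⟨rfl, -⟩
      · rw [he] at hu; exact absurd hu (Finset.notMem_empty _)
      · exact hv
  · intro ℓ v hv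
    rcases (hop ℓ v).1 hv with hv | ⟨rfl, -⟩
    exacts [h.2.op_cov ℓ v hv, ⟨D₀, hD₀, hxD⟩]
  · intro v hv
    rw [hus, Finset.mem_singleton]
    exact or_iff_left (hout D hD hne v hv)
  · intro v hv ℓ hvℓ
    exact ((hop ℓ v).1 hvℓ).resolve_right fun h' => hout D hD hne v hv h'.1

theorem attach (h : Stage G S r hn 𝒟 D₀ g c κ) (hS : IsTwinCover G S)
    (h𝒟 : IsSolution G r 𝒟) (hD₀ : D₀ ∈ 𝒟) (hc : IsRep G S c) {x ℓ b : Fin n} (hx : x ∈ S)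
    (hxℓ : x ∈ g.op ℓ) (hxD : x ∈ D₀) (hb : b ∈ clq G S c) (hbD : b ∈ D₀) (hbu : b ∉ g.used)
    (hadj : G.Adj x b) : Stage G S r hn 𝒟 D₀ (g.attach ℓ b) c (x + 1) := by
  have hop : ∀ m v, v ∈ (g.attach ℓ b).op m ↔ v ∈ g.op m ∨ (v = b ∧ m = ℓ) := fun m v =>
    Partial.mem_op_attach
  have hus : ∀ v, v ∈ (g.attach ℓ b).used ↔ v ∈ g.used ∨ v ∈ ({b} : Finset (Fin n)) := fun v =>
    Partial.mem_used_attach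
  have hsub := h.2.op_sub D₀ hD₀ ℓ x hxD hxℓ
  have hadj' := (hS.adj_iff_of_mem_clq hx hc.1 hb).1 hadj
  have hout : ∀ D ∈ 𝒟, D ≠ D₀ → ∀ v ∈ D, v ≠ b := by
    rintro D hD hne v hv rfl
    exact hne (h𝒟.disj D hD D₀ hD₀ v hv hbD)
  have hlt : (g.op ℓ).card < r := by
    rw [← h𝒟.card_eq D₀ hD₀]
    refine Finset.card_lt_card ⟨hsub, fun h' => hbu ?_⟩
    exact Partial.mem_used.2 (Or.inr ⟨ℓ, h' hbD⟩)
  refine move h.1 hS h𝒟 (h𝒟.card_eq D₀ hD₀).le (.attach x) _ _ _ ?_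
    ⟨h.2.fin_sub, ?_, ?_, fun D hD hne => (h.2.settled D hD hne).congr ?_ id ?_⟩
  · rintro st hmat rfl hlink
    refine ⟨⟨hmat.three_le_lab.2 ⟨hx, ℓ, hxℓ⟩, hadj', ?_, ?_⟩,
      hmat.attach hS hx hxℓ hadj' hc hb hbu hlt, rfl, rfl⟩
    · rw [cap, if_pos hc, hmat.used_eq, if_pos hc]
      exact Finset.card_lt_card ⟨Finset.inter_subset_left, fun h' =>
        hbu (Finset.mem_inter.1 (h' hb)).2⟩
    · rw [hmat.size_eq hx hxℓ]; exact hlt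
  · intro D hD m v hv hvm u hu
    have h1 := h.2.op_sub D hD m
    rw [hop] at hvm hu
    rcases hvm with hvm | ⟨rfl, rfl⟩
    · rcases hu with hu | ⟨rfl, rfl⟩
      · exact h1 v hv hvm hu
      · rw [h𝒟.disj D hD D₀ hD₀ v hv (hsub hvm)]; exact hbD
    · rw [h𝒟.disj D hD D₀ hD₀ v hv hbD]
      rcases hu with hu | ⟨rfl, -⟩
      exacts [hsub hu, hbD]
  · intro m v hv
    rcases (hop m v).1 hv with hv | ⟨rfl, -⟩
    exacts [h.2.op_cov m v hv, ⟨D₀, hD₀, hbD⟩]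
  · intro v hv
    rw [hus, Finset.mem_singleton]
    exact or_iff_left (hout D hD hne v hv)
  · intro v hv m hvm
    exact ((hop m v).1 hvm).resolve_right fun h' => hout D hD hne v hv h'.1

/-- Two vertices of `S` in the same unit get into the same fragment. -/
theorem join (h : Stage G S r hn 𝒟 D₀ g c κ) (hS : IsTwinCover G S)
    (h𝒟 : IsSolution G r 𝒟) (hD₀ : D₀ ∈ 𝒟) {x y : Fin n} (hx : x ∈ S) (hy : y ∈ S)
    (hxD : x ∈ D₀) (hyD : y ∈ D₀) (hxo : ∃ ℓ, x ∈ g.op ℓ) (hyo : ∃ ℓ, y ∈ g.op ℓ)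
    (hadj : G.Adj x y ∨ κ = x + 1 ∧ G.Adj y c) :
    ∃ g', Stage G S r hn 𝒟 D₀ g' c κ ∧ g'.fin = g.fin ∧ g'.used = g.used ∧
      (∀ u v, (∃ ℓ, u ∈ g.op ℓ ∧ v ∈ g.op ℓ) → ∃ ℓ, u ∈ g'.op ℓ ∧ v ∈ g'.op ℓ) ∧
      ∃ ℓ, x ∈ g'.op ℓ ∧ y ∈ g'.op ℓ := by
  obtain ⟨ℓ, hxℓ⟩ := hxo
  obtain ⟨ℓ', hyℓ⟩ := hyo
  by_cases hne : ℓ = ℓ'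
  · subst hne
    exact ⟨g, h, rfl, rfl, fun u v h => h, ℓ, hxℓ, hyℓ⟩
  have hop : ∀ m v, v ∈ (g.join ℓ ℓ').op m ↔ (v ∈ g.op m ∧ m ≠ ℓ') ∨ (v ∈ g.op ℓ' ∧ m = ℓ) :=
    fun m v => Partial.mem_op_join hne
  have hus : (g.join ℓ ℓ').used = g.used := Finset.ext fun v => Partial.mem_used_join hne
  have hsub := h.2.op_sub D₀ hD₀ ℓ x hxD hxℓ
  have hsub' := h.2.op_sub D₀ hD₀ ℓ' y hyD hyℓ
  refine ⟨g.join ℓ ℓ', ?_, rfl, hus, ?_, ℓ, (hop ℓ x).2 (Or.inl ⟨hxℓ, hne⟩),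
    (hop ℓ y).2 (Or.inr ⟨hyℓ, rfl⟩)⟩
  · refine move h.1 hS h𝒟 (h𝒟.card_eq D₀ hD₀).le (.join x y) _ _ _ ?_
      ⟨h.2.fin_sub, ?_, ?_, fun D hD hne' => (h.2.settled D hD hne').congr (fun v _ => by rw [hus])
        id ?_⟩
    · rintro st hmat rfl rfl
      have hle : (g.op ℓ).card + (g.op ℓ').card ≤ r := by
        rw [← Finset.card_union_of_disjoint (Finset.disjoint_left.2 fun v hv hv' =>
          hne (hmat.op_disj ℓ ℓ' v hv hv')), ← h𝒟.card_eq D₀ hD₀]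
        exact Finset.card_le_card (Finset.union_subset hsub hsub')
      refine ⟨⟨hmat.three_le_lab.2 ⟨hx, ℓ, hxℓ⟩, hmat.three_le_lab.2 ⟨hy, ℓ', hyℓ⟩, ?_, ?_, hadj⟩,
        hmat.join hS hx hy hxℓ hyℓ hne hle hadj, rfl, rfl⟩
      · rw [hmat.lab_op x hx ℓ hxℓ, hmat.lab_op y hy ℓ' hyℓ]
        exact fun e => hne (Fin.ext (by omega))
      · rw [hmat.size_eq hx hxℓ, hmat.size_eq hy hyℓ]; omega
    · intro D hD m v hv hvm u hu
      rw [hop] at hvm hu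
      have h1 := h.2.op_sub D hD m v hv
      have hDD : v ∈ D₀ → D = D₀ := h𝒟.disj D hD D₀ hD₀ v hv
      rcases hvm with ⟨hvm, hm⟩ | ⟨hvm, rfl⟩
      · rcases hu with ⟨hu, -⟩ | ⟨hu, rfl⟩
        · exact h1 hvm hu
        · rw [hDD (hsub hvm)]; exact hsub' hu
      · rw [hDD (hsub' hvm)]
        rcases hu with ⟨hu, -⟩ | ⟨hu, -⟩
        exacts [hsub hu, hsub' hu]
    · intro m v hv
      rcases (hop m v).1 hv with ⟨hv, -⟩ | ⟨hv, -⟩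
      exacts [h.2.op_cov m v hv, h.2.op_cov ℓ' v hv]
    · intro v hv m hvm
      rcases (hop m v).1 hvm with ⟨hvm, -⟩ | ⟨hvm, -⟩
      · exact hvm
      · exact absurd (h𝒟.disj D hD D₀ hD₀ v hv (hsub' hvm)) hne'
  · rintro u v ⟨m, hu, hv⟩
    by_cases hm : m = ℓ'
    · subst hm
      exact ⟨ℓ, (hop ℓ u).2 (Or.inr ⟨hu, rfl⟩), (hop ℓ v).2 (Or.inr ⟨hv, rfl⟩)⟩
    · exact ⟨m, (hop m u).2 (Or.inl ⟨hu, hm⟩), (hop m v).2 (Or.inl ⟨hv, hm⟩)⟩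

/-- The pairs in `E` get into the same fragments, one pair after the other. -/
theorem joinAll (h : Stage G S r hn 𝒟 D₀ g c κ) (hS : IsTwinCover G S)
    (h𝒟 : IsSolution G r 𝒟) (hD₀ : D₀ ∈ 𝒟) (E : Finset (Fin n × Fin n))
    (hE : ∀ p ∈ E, (p.1 ∈ S ∧ p.1 ∈ D₀ ∧ ∃ ℓ, p.1 ∈ g.op ℓ) ∧
      (p.2 ∈ S ∧ p.2 ∈ D₀ ∧ ∃ ℓ, p.2 ∈ g.op ℓ) ∧
      (G.Adj p.1 p.2 ∨ κ = p.1 + 1 ∧ G.Adj p.2 c)) :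
    ∃ g', Stage G S r hn 𝒟 D₀ g' c κ ∧ g'.fin = g.fin ∧ g'.used = g.used ∧
      (∀ u v, (∃ ℓ, u ∈ g.op ℓ ∧ v ∈ g.op ℓ) → ∃ ℓ, u ∈ g'.op ℓ ∧ v ∈ g'.op ℓ) ∧
      ∀ p ∈ E, ∃ ℓ, p.1 ∈ g'.op ℓ ∧ p.2 ∈ g'.op ℓ := by
  classical
  induction E using Finset.induction_on with
  | empty => exact ⟨g, h, rfl, rfl, fun u v h => h, by simp⟩
  | insert p E _ ih =>
    obtain ⟨g₁, s₁, f₁, u₁, m₁, e₁⟩ := ih fun q hq => hE q (Finset.mem_insert_of_mem hq)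
    obtain ⟨⟨hx, hxD, ℓ, hxℓ⟩, ⟨hy, hyD, ℓ', hyℓ⟩, hadj⟩ := hE p (Finset.mem_insert_self p E)
    obtain ⟨m, hm, -⟩ := m₁ p.1 p.1 ⟨ℓ, hxℓ, hxℓ⟩
    obtain ⟨m', hm', -⟩ := m₁ p.2 p.2 ⟨ℓ', hyℓ, hyℓ⟩
    obtain ⟨g₂, s₂, f₂, u₂, m₂, e₂⟩ := s₁.join hS h𝒟 hD₀ hx hy hxD hyD ⟨m, hm⟩ ⟨m', hm'⟩ hadj
    refine ⟨g₂, s₂, f₂.trans f₁, u₂.trans u₁, fun u v h => m₂ u v (m₁ u v h), fun q hq => ?_⟩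
    rcases Finset.mem_insert.1 hq with rfl | hq
    · exact e₂
    · exact m₂ _ _ (e₁ q hq)

/-- All vertices in `S` of an untouched unit become fragments. -/
theorem newAll (h : Stage G S r hn 𝒟 D₀ g c κ) (hS : IsTwinCover G S) (hr : 1 ≤ r)
    (h𝒟 : IsSolution G r 𝒟) (hD₀ : D₀ ∈ 𝒟) (hD₀u : ∀ v ∈ D₀, v ∉ g.used)
    (A : Finset (Fin n)) (hA : ∀ v ∈ A, v ∈ D₀ ∧ v ∈ S) :
    ∃ g' κ', Stage G S r hn 𝒟 D₀ g' c κ' ∧ g'.fin = g.fin ∧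
      ∀ v, v ∈ g'.used ↔ v ∈ g.used ∨ v ∈ A := by
  classical
  induction A using Finset.induction_on with
  | empty => exact ⟨g, κ, h, rfl, by simp⟩
  | insert x A hxA ih =>
    obtain ⟨g₁, κ₁, s₁, f₁, u₁⟩ := ih fun v hv => hA v (Finset.mem_insert_of_mem hv)
    obtain ⟨hxD, hx⟩ := hA x (Finset.mem_insert_self x A)
    have hxu : x ∉ g₁.used := by
      rw [u₁]; exact not_or.2 ⟨hD₀u x hxD, hxA⟩
    obtain ⟨st, -, hmat, -⟩ := id s₁.1
    refine ⟨g₁.new x, 0, s₁.new hS hr h𝒟 hD₀ hx hxD hxu, f₁, fun v => ?_⟩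
    rw [Partial.mem_used_new (hmat.op_eq_empty hxu), u₁, Finset.mem_singleton,
      Finset.mem_insert]
    tauto

/-- An untouched unit is opened: its vertices in `S` form fragments according to the edges between
them. -/
theorem openUnit (h : Stage G S r hn 𝒟 D₀ g c κ) (hS : IsTwinCover G S) (hr : 1 ≤ r)
    (h𝒟 : IsSolution G r 𝒟) (hD₀ : D₀ ∈ 𝒟) (hD₀u : ∀ v ∈ D₀, v ∉ g.used) :
    ∃ g' κ', Stage G S r hn 𝒟 D₀ g' c κ' ∧ D₀ ∉ g'.fin ∧ g'.Closed S G D₀ ∧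
      ∀ v, v ∈ g'.used ↔ v ∈ g.used ∨ v ∈ D₀ ∧ v ∈ S := by
  classical
  have hne : D₀.Nonempty := Finset.card_pos.1 (by rw [h𝒟.card_eq D₀ hD₀]; omega)
  obtain ⟨d, hd⟩ := hne
  have hDf : D₀ ∉ g.fin := fun hDf => hD₀u d hd (Partial.mem_used.2 (Or.inl ⟨D₀, hDf, hd⟩))
  obtain ⟨g₁, κ₁, s₁, f₁, u₁⟩ := h.newAll hS hr h𝒟 hD₀ hD₀u (D₀.filter (· ∈ S))
    fun v hv => by simpa using hv
  have hin : ∀ v ∈ D₀, v ∈ S → ∃ ℓ, v ∈ g₁.op ℓ := fun v hv hvS =>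
    s₁.op_of_used h𝒟 hD₀ (f₁ ▸ hDf) hv ((u₁ v).2 (Or.inr (by simp [hv, hvS])))
  obtain ⟨g₂, s₂, f₂, u₂, m₂, e₂⟩ := s₁.joinAll hS h𝒟 hD₀
    ((D₀.filter (· ∈ S) ×ˢ D₀.filter (· ∈ S)).filter fun p => G.Adj p.1 p.2) (by
      intro p hp
      simp only [Finset.mem_filter, Finset.mem_product] at hp
      obtain ⟨⟨⟨h1, h2⟩, h3, h4⟩, h5⟩ := hp
      exact ⟨⟨h2, h1, hin _ h1 h2⟩, ⟨h4, h3, hin _ h3 h4⟩, Or.inl h5⟩)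
  have hu : ∀ v, v ∈ g₂.used ↔ v ∈ g.used ∨ v ∈ D₀ ∧ v ∈ S := fun v => by
    rw [u₂, u₁, Finset.mem_filter]
  refine ⟨g₂, κ₁, s₂, by rw [f₂, f₁]; exact hDf, ?_, hu⟩
  intro u huD huS v hv hadj ℓ ℓ' hℓ hℓ'
  obtain ⟨st, -, hmat, -⟩ := id s₂.1
  have hvS : v ∈ S := by
    have := (hu v).1 (Partial.mem_used.2 (Or.inr ⟨ℓ', hℓ'⟩))
    exact (this.resolve_left (hD₀u v hv)).2
  obtain ⟨m, hm, hm'⟩ := e₂ (u, v) (by simp [huD, huS, hv, hvS, hadj])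
  rw [hmat.op_disj ℓ m u hℓ hm, hmat.op_disj ℓ' m v hℓ' hm']

/-- A unit all of whose vertices are in use, and whose adjacent vertices belong to the same
fragments, is one fragment. It is declared a unit. -/
theorem finishUnit (h : Stage G S r hn 𝒟 D₀ g c κ) (hS : IsTwinCover G S)
    (h𝒟 : IsSolution G r 𝒟) (hD₀ : D₀ ∈ 𝒟) (hDf : D₀ ∉ g.fin) (hcl : g.Closed S G D₀)
    (hall : ∀ v ∈ D₀, v ∈ g.used) {x : Fin n} (hx : x ∈ D₀) (hxS : x ∈ S) :
    ∃ g' κ', Stage G S r hn 𝒟 ∅ g' c κ' ∧ g'.used = g.used := by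
  obtain ⟨st, -, hmat, -⟩ := id h.1
  obtain ⟨ℓ, hxℓ⟩ := h.op_of_used h𝒟 hD₀ hDf hx (hall x hx)
  have hconn := h𝒟.conn D₀ hD₀
  have edge : ∀ u ∈ D₀, ∀ v ∈ D₀, G.Adj u v → u ∈ g.op ℓ → v ∈ g.op ℓ := by
    intro u hu v hv hadj huℓ
    obtain ⟨ℓ', hvℓ⟩ := h.op_of_used h𝒟 hD₀ hDf hv (hall v hv)
    by_cases huS : u ∈ S
    · rw [hcl u hu huS v hv hadj ℓ ℓ' huℓ hvℓ]; exact hvℓ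
    by_cases hvS : v ∈ S
    · rw [← hcl v hv hvS u hu hadj.symm ℓ' ℓ hvℓ huℓ]; exact hvℓ
    · obtain ⟨y, hy, hyS, hyu⟩ := hS.exists_adj_of_connected hconn hu huS hx hxS
      have hyv : G.Adj y v := (hS.adj_iff huS hvS hadj hyu.ne (by rintro rfl; exact hvS hyS)).1 hyu
      obtain ⟨m, hym⟩ := h.op_of_used h𝒟 hD₀ hDf hy (hall y hy)
      rw [← hcl y hy hyS u hu hyu m ℓ hym huℓ, hcl y hy hyS v hv hyv m ℓ' hym hvℓ]
      exact hvℓ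
  have hwalk : ∀ {a b : (D₀ : Set (Fin n))}, (G.induce (D₀ : Set (Fin n))).Walk a b →
      (a : Fin n) ∈ g.op ℓ → (b : Fin n) ∈ g.op ℓ := by
    intro a b p
    induction p with
    | nil => exact id
    | @cons a a' b hadj p ih =>
      intro ha
      exact ih (edge a a.2 a' a'.2 hadj ha)
  have hsub := h.2.op_sub D₀ hD₀ ℓ x hx hxℓ
  have heq : g.op ℓ = D₀ := by
    refine Finset.Subset.antisymm hsub fun v hv => ?_
    obtain ⟨p⟩ := hconn.preconnected ⟨x, hx⟩ ⟨v, hv⟩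
    exact hwalk p hxℓ
  have hcard : (g.op ℓ).card = r := by rw [heq, h𝒟.card_eq D₀ hD₀]
  have hop : ∀ m v, v ∈ (g.finish ℓ).op m ↔ v ∈ g.op m ∧ m ≠ ℓ := fun m v =>
    Partial.mem_op_finish
  have hus : (g.finish ℓ).used = g.used := Finset.ext fun v => Partial.mem_used_finish
  have hfin : ∀ E, E ∈ (g.finish ℓ).fin ↔ E = D₀ ∨ E ∈ g.fin := fun E => by
    simp [Partial.finish, heq]
  refine ⟨g.finish ℓ, 0, move h.1 hS h𝒟 (by simp) (.finish x) _ _ _ ?_ ⟨?_, ?_, ?_, ?_⟩, hus⟩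
  · rintro st hmat rfl hlink
    exact ⟨⟨hmat.three_le_lab.2 ⟨hxS, ℓ, hxℓ⟩, by rw [hmat.size_eq hxS hxℓ, hcard]⟩,
      hmat.finish hxS hxℓ hcard, rfl, rfl⟩
  · intro D hD
    rcases (hfin D).1 hD with rfl | hD
    exacts [hD₀, h.2.fin_sub D hD]
  · intro D hD m v hv hvm u hu
    rw [hop] at hvm hu
    exact h.2.op_sub D hD m v hv hvm.1 hu.1
  · intro m v hv
    exact h.2.op_cov m v ((hop m v).1 hv).1
  · intro D hD _
    by_cases hDD : D = D₀
    · exact Or.inr (Or.inl ((hfin D).2 (Or.inl hDD)))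
    · exact (h.2.settled D hD hDD).congr (fun v _ => by rw [hus])
        (fun h' => (hfin D).2 (Or.inr h')) fun v _ m hvm => ((hop m v).1 hvm).1

/-- A unit inside `S` is realized. -/
theorem addSubset (h : Stage G S r hn 𝒟 ∅ g c κ) (hS : IsTwinCover G S) (hr : 1 ≤ r)
    (h𝒟 : IsSolution G r 𝒟) {D : Finset (Fin n)} (hD : D ∈ 𝒟) (hDS : ∀ v ∈ D, v ∈ S) :
    ∃ g' κ', Stage G S r hn 𝒟 ∅ g' c κ' ∧ ∀ v, v ∈ g'.used ↔ v ∈ g.used ∨ v ∈ D := by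
  obtain ⟨d, hd⟩ : D.Nonempty := Finset.card_pos.1 (by rw [h𝒟.card_eq D hD]; omega)
  rcases h.all_settled hr h𝒟 hD with h1 | h1 | ⟨-, -, ⟨b, hb, hbS, -⟩, -⟩
  · obtain ⟨g₁, κ₁, s₁, f₁, c₁, u₁⟩ := (h.weaken hr h𝒟 D).openUnit hS hr h𝒟 hD h1
    obtain ⟨g₂, κ₂, s₂, u₂⟩ := s₁.finishUnit hS h𝒟 hD f₁ c₁
      (fun v hv => (u₁ v).2 (Or.inr ⟨hv, hDS v hv⟩)) hd (hDS d hd)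
    refine ⟨g₂, κ₂, s₂, fun v => ?_⟩
    rw [u₂, u₁]
    exact or_congr_right (and_iff_left_of_imp (hDS v))
  · exact ⟨g, κ, h, fun v => (or_iff_left_of_imp fun hv =>
      Partial.mem_used.2 (Or.inl ⟨D, h1, hv⟩)).symm⟩
  · exact absurd (hDS b hb) hbS

/-- A vertex of the current clique that belongs to a unit meeting `S` is put in use. -/
theorem addVertex (h : Stage G S r hn 𝒟 ∅ g c κ) (hS : IsTwinCover G S) (hr : 1 ≤ r)
    (h𝒟 : IsSolution G r 𝒟) {D : Finset (Fin n)} (hD : D ∈ 𝒟) (hc : IsRep G S c) {b y : Fin n}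
    (hb : b ∈ clq G S c) (hbD : b ∈ D) (hyD : y ∈ D) (hyS : y ∈ S) :
    ∃ g' κ', Stage G S r hn 𝒟 ∅ g' c κ' ∧ b ∈ g'.used ∧ (∀ v ∈ g.used, v ∈ g'.used) ∧
      ∀ v ∈ g'.used, v ∈ g.used ∨ v ∈ D := by
  classical
  by_cases hbu : b ∈ g.used
  · exact ⟨g, κ, h, hbu, fun v => id, fun v => Or.inl⟩
  have hbS : b ∉ S := (mem_clq.1 hb).1
  have opened : ∃ g₁ κ₁, Stage G S r hn 𝒟 D g₁ c κ₁ ∧ D ∉ g₁.fin ∧ g₁.Closed S G D ∧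
      ∀ v, v ∈ g₁.used ↔ v ∈ g.used ∨ v ∈ D ∧ v ∈ S := by
    rcases h.all_settled hr h𝒟 hD with h1 | h1 | ⟨h1, h2, -, -⟩
    · exact (h.weaken hr h𝒟 D).openUnit hS hr h𝒟 hD h1
    · exact absurd (Partial.mem_used.2 (Or.inl ⟨D, h1, hbD⟩)) hbu
    · exact ⟨g, κ, h.weaken hr h𝒟 D, fun h1 => hbu (Partial.mem_used.2 (Or.inl ⟨D, h1, hbD⟩)), h2,
        fun v => (or_iff_left_of_imp fun hv => h1 v hv.1 hv.2).symm⟩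
  obtain ⟨g₁, κ₁, s₁, f₁, c₁, u₁⟩ := opened
  obtain ⟨x, hxD, hxS, hadj⟩ := hS.exists_adj_of_connected (h𝒟.conn D hD) hbD hbS hyD hyS
  have hin : ∀ v ∈ D, v ∈ S → ∃ ℓ, v ∈ g₁.op ℓ := fun v hv hvS =>
    s₁.op_of_used h𝒟 hD f₁ hv ((u₁ v).2 (Or.inr ⟨hv, hvS⟩))
  obtain ⟨ℓ, hxℓ⟩ := hin x hxD hxS
  have hbu₁ : b ∉ g₁.used := by
    rw [u₁]; exact not_or.2 ⟨hbu, fun h' => hbS h'.2⟩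
  have s₂ := s₁.attach hS h𝒟 hD hc hxS hxℓ hxD hb hbD hbu₁ hadj
  have hop₂ : ∀ m v, v ∈ (g₁.attach ℓ b).op m ↔ v ∈ g₁.op m ∨ (v = b ∧ m = ℓ) := fun m v =>
    Partial.mem_op_attach
  -- the link of `x` to the clique allows joins with the fragments of the other neighbours of `b`
  obtain ⟨g₃, s₃, f₃, u₃, m₃, e₃⟩ := s₂.joinAll hS h𝒟 hD
    (((D.filter (· ∈ S)).filter fun y => G.Adj y b).image fun y => (x, y)) (by
      intro p hp
      simp only [Finset.mem_image, Finset.mem_filter] at hp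
      obtain ⟨y, ⟨⟨hyD, hyS⟩, hyb⟩, rfl⟩ := hp
      obtain ⟨m, hm⟩ := hin y hyD hyS
      exact ⟨⟨hxS, hxD, ℓ, (hop₂ ℓ x).2 (Or.inl hxℓ)⟩, ⟨hyS, hyD, m, (hop₂ m y).2 (Or.inl hm)⟩,
        Or.inr ⟨rfl, (hS.adj_iff_of_mem_clq hyS hc.1 hb).1 hyb⟩⟩)
  have hu : ∀ v, v ∈ g₃.used ↔ (v ∈ g.used ∨ v ∈ D ∧ v ∈ S) ∨ v = b := fun v => by
    rw [u₃, Partial.mem_used_attach, u₁, Finset.mem_singleton]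
  have hDf₃ : D ∉ g₃.fin := by rw [f₃]; exact f₁
  have hbu₃ : b ∈ g₃.used := (hu b).2 (Or.inr rfl)
  have hold : ∀ v ∈ g.used, v ∈ g₃.used := fun v hv => (hu v).2 (Or.inl (Or.inl hv))
  have hnew : ∀ v ∈ g₃.used, v ∈ g.used ∨ v ∈ D := fun v hv => by
    rcases (hu v).1 hv with (h' | h') | rfl
    exacts [Or.inl h', Or.inr h'.1, Or.inr hbD]
  obtain ⟨st, -, hmat, -⟩ := id s₃.1
  have hcl : g₃.Closed S G D := by
    intro u huD huS v hv huv m m' hm hm'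
    have same : ∃ ℓ, u ∈ g₃.op ℓ ∧ v ∈ g₃.op ℓ := by
      by_cases hvb : v = b
      · subst hvb
        obtain ⟨i, hi, hi'⟩ := e₃ (x, u) (by simp [huD, huS, huv])
        obtain ⟨j, hj, hj'⟩ := m₃ x v ⟨ℓ, (hop₂ ℓ x).2 (Or.inl hxℓ), (hop₂ ℓ v).2 (Or.inr ⟨rfl, rfl⟩)⟩
        obtain rfl := hmat.op_disj i j x hi hj
        exact ⟨i, hi', hj'⟩
      · obtain ⟨i, hi⟩ := hin u huD huS
        have hvu₁ : v ∈ g₁.used := by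
          have := (hu v).1 (Partial.mem_used.2 (Or.inr ⟨m', hm'⟩))
          exact (u₁ v).2 (this.resolve_right hvb)
        obtain ⟨j, hj⟩ := s₁.op_of_used h𝒟 hD f₁ hv hvu₁
        obtain rfl := c₁ u huD huS v hv huv i j hi hj
        exact m₃ u v ⟨i, (hop₂ i u).2 (Or.inl hi), (hop₂ i v).2 (Or.inl hj)⟩
    obtain ⟨i, hi, hi'⟩ := same
    rw [hmat.op_disj m i u hm hi, hmat.op_disj m' i v hm' hi']
  by_cases hall : ∀ v ∈ D, v ∈ g₃.used
  · obtain ⟨g₄, κ₄, s₄, u₄⟩ := s₃.finishUnit hS h𝒟 hD hDf₃ hcl hall hyD hyS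
    exact ⟨g₄, κ₄, s₄, u₄ ▸ hbu₃, u₄ ▸ hold, u₄ ▸ hnew⟩
  · push Not at hall
    refine ⟨g₃, _, ⟨s₃.1, s₃.2.fin_sub, s₃.2.op_sub, s₃.2.op_cov, fun D' hD' _ => ?_⟩, hbu₃, hold,
      hnew⟩
    by_cases hDD : D' = D
    · subst hDD
      exact Or.inr (Or.inr ⟨fun v hv hvS => (hu v).2 (Or.inl (Or.inr ⟨hv, hvS⟩)), hcl,
        ⟨b, hbD, hbS, hbu₃⟩, hall⟩)
    · exact s₃.2.settled D' hD' hDD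

/-- A unit inside the current clique is realized. -/
theorem addInner (h : Stage G S r hn 𝒟 ∅ g c κ) (hS : IsTwinCover G S) (hr : 1 ≤ r)
    (h𝒟 : IsSolution G r 𝒟) {D : Finset (Fin n)} (hD : D ∈ 𝒟) (hc : IsRep G S c)
    (hDc : D ⊆ clq G S c) :
    ∃ g' κ', Stage G S r hn 𝒟 ∅ g' c κ' ∧ ∀ v, v ∈ g'.used ↔ v ∈ g.used ∨ v ∈ D := by
  have hDS : ∀ v ∈ D, v ∉ S := fun v hv => (mem_clq.1 (hDc hv)).1
  have fin_case : D ∈ g.fin → ∃ g' κ', Stage G S r hn 𝒟 ∅ g' c κ' ∧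
      ∀ v, v ∈ g'.used ↔ v ∈ g.used ∨ v ∈ D := fun h1 =>
    ⟨g, κ, h, fun v => (or_iff_left_of_imp fun hv =>
      Partial.mem_used.2 (Or.inl ⟨D, h1, hv⟩)).symm⟩
  rcases h.all_settled hr h𝒟 hD with h1 | h1 | ⟨-, -, ⟨b, hb, hbS, hbu⟩, -⟩
  · have hcard := h𝒟.card_eq D hD
    have hus : ∀ v, v ∈ (g.inner D).used ↔ v ∈ g.used ∨ v ∈ D := fun v => Partial.mem_used_inner
    have hfin : ∀ E, E ∈ (g.inner D).fin ↔ E = D ∨ E ∈ g.fin := fun E => by simp [Partial.inner]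
    refine ⟨g.inner D, 0, move h.1 hS h𝒟 (by simp) .inner _ _ _ ?_
      ⟨?_, h.2.op_sub, h.2.op_cov, ?_⟩, hus⟩
    · rintro st hmat rfl hlink
      refine ⟨?_, hmat.inner hS hr hc hDc hcard h1, rfl, rfl⟩
      change st.used + r < cap G S st.pos + 1
      rw [cap, if_pos hc, hmat.used_eq, if_pos hc, ← hcard, ← Finset.card_union_of_disjoint]
      · exact Nat.lt_succ_of_le (Finset.card_le_card
          (Finset.union_subset Finset.inter_subset_left hDc))
      · exact Finset.disjoint_left.2 fun v hv hv' => h1 v hv' (Finset.mem_inter.1 hv).2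
    · intro E hE
      rcases (hfin E).1 hE with rfl | hE
      exacts [hD, h.2.fin_sub E hE]
    · intro E hE hne
      by_cases hED : E = D
      · exact Or.inr (Or.inl ((hfin E).2 (Or.inl hED)))
      · refine (h.2.settled E hE hne).congr (fun v hv => ?_) (fun h' => (hfin E).2 (Or.inr h'))
          fun v _ m hvm => hvm
        rw [hus]
        exact or_iff_left fun hvD => hED (h𝒟.disj E hE D hD v hv hvD)
  · exact fin_case h1
  · rcases Partial.mem_used.1 hbu with ⟨D', hD', hbD'⟩ | ⟨ℓ, hℓ⟩
    · rw [h𝒟.disj D' (h.2.fin_sub D' hD') D hD b hbD' hb] at hD'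
      exact fin_case hD'
    · obtain ⟨st, -, hmat, -⟩ := id h.1
      obtain ⟨hℓS, hℓop⟩ := hmat.op_name ℓ b hℓ
      exact absurd hℓS (hDS ℓ (h.2.op_sub D hD ℓ b hb hℓ hℓop))

theorem next (h : Stage G S r hn 𝒟 ∅ g c κ) (hS : IsTwinCover G S) (h𝒟 : IsSolution G r 𝒟)
    (hc : (c : ℕ) + 1 < n) : Stage G S r hn 𝒟 ∅ g ⟨c + 1, hc⟩ 0 := by
  refine move h.1 hS h𝒟 (by simp) .next _ _ _ ?_ h.2
  rintro st hmat rfl hlink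
  exact ⟨hc, hmat.next hS hc, by simp [Config.apply, hc], rfl⟩

end Stage

/-- The units that the dynamic program realizes: those that meet `S`, and those in a clique with a
neighbour in `S` that belongs to a unit. -/
def Selected (G : SimpleGraph (Fin n)) (S : Finset (Fin n)) (𝒟 : Finset (Finset (Fin n)))
    (D : Finset (Fin n)) : Prop :=
  (∃ x ∈ D, x ∈ S) ∨ ∃ x ∈ S, ∃ D' ∈ 𝒟, x ∈ D' ∧ ∃ v ∈ D, G.Adj x v

/-- All selected units are realized within the current clique. -/
theorem Stage.processClique (hS : IsTwinCover G S) (hr : 1 ≤ r) (h𝒟 : IsSolution G r 𝒟)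
    {c : Fin n} (hc : IsRep G S c) {g : Partial n} {κ : ℕ} (h : Stage G S r hn 𝒟 ∅ g c κ)
    (A : Finset (Fin n)) (hA : A ⊆ clq G S c) :
    ∃ g' κ', Stage G S r hn 𝒟 ∅ g' c κ' ∧ (∀ v ∈ g.used, v ∈ g'.used) ∧
      (∀ v ∈ g'.used, v ∈ g.used ∨ ∃ D ∈ 𝒟, Selected G S 𝒟 D ∧ v ∈ D) ∧
      ∀ v ∈ A, ∀ D ∈ 𝒟, Selected G S 𝒟 D → v ∈ D → v ∈ g'.used := by
  classical
  induction A using Finset.induction_on with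
  | empty => exact ⟨g, κ, h, fun v => id, fun v => Or.inl, by simp⟩
  | insert b A _ ih =>
    obtain ⟨g₁, κ₁, s₁, old, new, done⟩ := ih fun v hv => hA (Finset.mem_insert_of_mem hv)
    by_cases hb : ∃ D ∈ 𝒟, Selected G S 𝒟 D ∧ b ∈ D
    · obtain ⟨D, hD, hsel, hbD⟩ := hb
      have hbc := hA (Finset.mem_insert_self b A)
      have : ∃ g₂ κ₂, Stage G S r hn 𝒟 ∅ g₂ c κ₂ ∧ b ∈ g₂.used ∧ (∀ v ∈ g₁.used, v ∈ g₂.used) ∧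
          ∀ v ∈ g₂.used, v ∈ g₁.used ∨ v ∈ D := by
        by_cases hmeet : ∃ x ∈ D, x ∈ S
        · obtain ⟨x, hx, hxS⟩ := hmeet
          exact s₁.addVertex hS hr h𝒟 hD hc hbc hbD hx hxS
        · have hDS : ∀ v ∈ D, v ∉ S := fun v hv hvS => hmeet ⟨v, hv, hvS⟩
          have hDc : D ⊆ clq G S c := fun v hv => hS.mem_clq_trans hbc hc.1
            (hS.subset_clq_of_connected (h𝒟.conn D hD) hDS hbD hv)
          obtain ⟨g₂, κ₂, s₂, u₂⟩ := s₁.addInner hS hr h𝒟 hD hc hDc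
          exact ⟨g₂, κ₂, s₂, (u₂ b).2 (Or.inr hbD), fun v hv => (u₂ v).2 (Or.inl hv),
            fun v hv => (u₂ v).1 hv⟩
      obtain ⟨g₂, κ₂, s₂, hb₂, old₂, new₂⟩ := this
      refine ⟨g₂, κ₂, s₂, fun v hv => old₂ v (old v hv), fun v hv => ?_, fun v hv E hE hsE hvE => ?_⟩
      · rcases new₂ v hv with hv | hv
        exacts [new v hv, Or.inr ⟨D, hD, hsel, hv⟩]
      · rcases Finset.mem_insert.1 hv with rfl | hv
        exacts [hb₂, old₂ v (done v hv E hE hsE hvE)]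
    · refine ⟨g₁, κ₁, s₁, old, new, fun v hv E hE hsE hvE => ?_⟩
      rcases Finset.mem_insert.1 hv with rfl | hv
      exacts [absurd ⟨E, hE, hsE, hvE⟩ hb, done v hv E hE hsE hvE]

/-- All units inside `S` are realized. -/
theorem exists_stage_subsets (hS : IsTwinCover G S) (hr : 1 ≤ r) (h𝒟 : IsSolution G r 𝒟)
    (A : Finset (Finset (Fin n))) (hA : ∀ D ∈ A, D ∈ 𝒟 ∧ ∀ v ∈ D, v ∈ S) :
    ∃ g κ, Stage G S r hn 𝒟 ∅ g ⟨0, hn⟩ κ ∧ ∀ v, v ∈ g.used ↔ ∃ D ∈ A, v ∈ D := by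
  classical
  induction A using Finset.induction_on with
  | empty =>
    refine ⟨⟨∅, fun _ => ∅⟩, 0, ⟨⟨_, .start, Matches.start hn, rfl, rfl⟩, by simp, by simp, by simp,
      fun D _ _ => Or.inl ?_⟩, ?_⟩ <;> simp [Partial.mem_used]
  | insert D A _ ih =>
    obtain ⟨g₁, κ₁, s₁, u₁⟩ := ih fun E hE => hA E (Finset.mem_insert_of_mem hE)
    obtain ⟨hD, hDS⟩ := hA D (Finset.mem_insert_self D A)
    obtain ⟨g₂, κ₂, s₂, u₂⟩ := s₁.addSubset hS hr h𝒟 hD hDS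
    refine ⟨g₂, κ₂, s₂, fun v => ?_⟩
    rw [u₂, u₁]
    simp only [Finset.mem_insert, exists_eq_or_imp]
    exact or_comm

/-- After the first cliques have been processed, the selected units are realized within these
cliques. -/
theorem exists_stage (hS : IsTwinCover G S) (hr : 1 ≤ r) (h𝒟 : IsSolution G r 𝒟) (c : ℕ)
    (hc : c < n) : ∃ g κ, Stage G S r hn 𝒟 ∅ g ⟨c, hc⟩ κ ∧
      (∀ v ∈ g.used, ∃ D ∈ 𝒟, Selected G S 𝒟 D ∧ v ∈ D) ∧
      (∀ D ∈ 𝒟, (∀ v ∈ D, v ∈ S) → ∀ v ∈ D, v ∈ g.used) ∧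
      ∀ D ∈ 𝒟, Selected G S 𝒟 D → ∀ v ∈ D, v ∉ S → (∃ w ∈ clq G S v, w ≤ ⟨c, hc⟩) →
        v ∈ g.used := by
  classical
  -- what has been achieved before the current clique extends to the current clique
  have process : ∀ (c : Fin n) (g : Partial n) (κ : ℕ), Stage G S r hn 𝒟 ∅ g c κ →
      (∀ v ∈ g.used, ∃ D ∈ 𝒟, Selected G S 𝒟 D ∧ v ∈ D) →
      (∀ D ∈ 𝒟, (∀ v ∈ D, v ∈ S) → ∀ v ∈ D, v ∈ g.used) →
      (∀ D ∈ 𝒟, Selected G S 𝒟 D → ∀ v ∈ D, v ∉ S → (∃ w ∈ clq G S v, w < c) → v ∈ g.used) →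
      ∃ g' κ', Stage G S r hn 𝒟 ∅ g' c κ' ∧
      (∀ v ∈ g'.used, ∃ D ∈ 𝒟, Selected G S 𝒟 D ∧ v ∈ D) ∧
      (∀ D ∈ 𝒟, (∀ v ∈ D, v ∈ S) → ∀ v ∈ D, v ∈ g'.used) ∧
      ∀ D ∈ 𝒟, Selected G S 𝒟 D → ∀ v ∈ D, v ∉ S → (∃ w ∈ clq G S v, w ≤ c) → v ∈ g'.used := by
    intro c g κ h h1 h2 h3
    by_cases hrep : IsRep G S c
    · obtain ⟨g', κ', s', old, new, done⟩ := Stage.processClique hS hr h𝒟 hrep h _ subset_rfl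
      refine ⟨g', κ', s', fun v hv => ?_, fun D hD hDS v hv => old v (h2 D hD hDS v hv), ?_⟩
      · rcases new v hv with hv | hv
        exacts [h1 v hv, hv]
      · rintro D hD hsel v hv hvS ⟨w, hw, hle⟩
        rcases hle.lt_or_eq with hlt | rfl
        · exact old v (h3 D hD hsel v hv hvS ⟨w, hw, hlt⟩)
        · exact done v (mem_clq_comm hvS hw) D hD hsel hv
    · refine ⟨g, κ, h, h1, h2, ?_⟩
      rintro D hD hsel v hv hvS ⟨w, hw, hle⟩
      rcases hle.lt_or_eq with hlt | rfl
      · exact h3 D hD hsel v hv hvS ⟨w, hw, hlt⟩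
      · have hwS : w ∉ S := (mem_clq.1 hw).1
        have : ∃ z < w, z ∉ S ∧ G.Adj z w := by
          by_contra hcon
          push Not at hcon
          exact hrep ⟨hwS, hcon⟩
        obtain ⟨z, hz, hzS, hadj⟩ := this
        exact h3 D hD hsel v hv hvS ⟨z, hS.mem_clq_trans hw hvS (by simp [hzS, hadj]), hz⟩
  induction c with
  | zero =>
    obtain ⟨g, κ, s, hu⟩ := exists_stage_subsets (hn := hn) hS hr h𝒟
      (𝒟.filter fun D => ∀ v ∈ D, v ∈ S) (fun D hD => by simpa using hD)
    refine process ⟨0, hc⟩ g κ s (fun v hv => ?_) (fun D hD hDS v hv =>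
      (hu v).2 ⟨D, Finset.mem_filter.2 ⟨hD, hDS⟩, hv⟩) ?_
    · obtain ⟨D, hD, hv⟩ := (hu v).1 hv
      rw [Finset.mem_filter] at hD
      exact ⟨D, hD.1, Or.inl ⟨v, hv, hD.2 v hv⟩, hv⟩
    · rintro D hD hsel v hv hvS ⟨w, _, hlt⟩
      exact absurd hlt (Nat.not_lt_zero _)
  | succ c ih =>
    obtain ⟨g, κ, s, h1, h2, h3⟩ := ih (by omega)
    refine process ⟨c + 1, hc⟩ g 0 (s.next hS h𝒟 hc) h1 h2 ?_
    rintro D hD hsel v hv hvS ⟨w, hw, hlt⟩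
    exact h3 D hD hsel v hv hvS ⟨w, hw, Nat.lt_succ_iff.1 hlt⟩

/-- The dynamic program accepts if there is a grouped dominating set with at most `k` units: it
realizes the selected units, and each of the other units lies in a clique of isolated vertices. -/
theorem HasGroupedDominatingSet.exists_accept (h : HasGroupedDominatingSet G r k)
    (hS : IsTwinCover G S) (hr : 1 ≤ r) (hn : 0 < n) :
    ∃ st, Reach G S r hn st ∧ st.Accept G S r k := by
  classical
  obtain ⟨𝒟, hk, hD⟩ := h
  have h𝒟 := hD.isSolution
  obtain ⟨g, κ, s, h1, h2, h3⟩ := exists_stage (hn := hn) hS hr h𝒟 (n - 1) (by omega)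
  have hne : ∀ D ∈ 𝒟, D.Nonempty := fun D hD =>
    Finset.card_pos.1 (by rw [h𝒟.card_eq D hD]; omega)
  have hout : ∀ D ∈ 𝒟, Selected G S 𝒟 D → ∀ v ∈ D, v ∉ S → v ∈ g.used :=
    fun D hD hsel v hv hvS => h3 D hD hsel v hv hvS
      ⟨v, self_mem_clq hvS, Fin.le_def.2 (by have := v.2; simp only; omega)⟩
  have hselfin : ∀ D ∈ 𝒟, Selected G S 𝒟 D → D ∈ g.fin := by
    intro D hD hsel
    rcases s.all_settled hr h𝒟 hD with hu | hf | ⟨hu, -, -, v, hv, hvu⟩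
    · by_cases hDS : ∀ v ∈ D, v ∈ S
      · obtain ⟨v, hv⟩ := hne D hD
        exact absurd (h2 D hD hDS v hv) (hu v hv)
      · push Not at hDS
        obtain ⟨v, hv, hvS⟩ := hDS
        exact absurd (hout D hD hsel v hv hvS) (hu v hv)
    · exact hf
    · exfalso
      by_cases hvS : v ∈ S
      · exact hvu (hu v hv hvS)
      · exact hvu (hout D hD hsel v hv hvS)
  have hfinsel : ∀ D ∈ g.fin, Selected G S 𝒟 D := by
    intro D hD
    obtain ⟨v, hv⟩ := hne D (s.2.fin_sub D hD)
    obtain ⟨D', hD', hsel, hv'⟩ := h1 v (Partial.mem_used.2 (Or.inl ⟨D, hD, hv⟩))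
    rwa [h𝒟.disj D (s.2.fin_sub D hD) D' hD' v hv hv']
  obtain ⟨⟨st, hreach, hmat, -, -⟩, hgood⟩ := s
  have hop : ∀ ℓ v, v ∉ g.op ℓ := by
    intro ℓ v hv
    obtain ⟨D, hD, hsel, hvD⟩ := h1 v (Partial.mem_used.2 (Or.inr ⟨ℓ, hv⟩))
    exact hmat.fin_op D (hselfin D hD hsel) ℓ v hvD hv
  have hused : ∀ v, v ∈ g.used ↔ ∃ D ∈ g.fin, v ∈ D := fun v => by
    simp [Partial.mem_used, hop]
  -- the unit that dominates an isolated vertex lies in its clique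
  have hunit : ∀ w, st.Isolated G S w → ∃ D ∈ 𝒟, D ∉ g.fin ∧ D ⊆ clq G S w := by
    intro w hw
    obtain ⟨hwS, hw⟩ := hmat.isolated_iff.1 hw
    obtain ⟨D, hD, u, hu, huw⟩ := h𝒟.dom w
    have hsel : ∀ x ∈ S, ∀ D' ∈ 𝒟, x ∈ D' → ¬ G.Adj x w := fun x hx D' hD' hxD' =>
      hw x hx D' (hselfin D' hD' (Or.inl ⟨x, hxD', hx⟩)) hxD'
    have huS : u ∉ S := by
      intro huS
      rcases huw with rfl | hadj
      · exact hwS huS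
      · exact hsel u huS D hD hu hadj.symm
    have huc : u ∈ clq G S w := by
      rw [mem_clq]
      exact ⟨huS, huw.imp Eq.symm SimpleGraph.Adj.symm⟩
    have hDS : ∀ v ∈ D, v ∉ S := by
      intro v hv hvS
      obtain ⟨y, hy, hyS, hadj⟩ := hS.exists_adj_of_connected (h𝒟.conn D hD) hu huS hv hvS
      exact hsel y hyS D hD hy ((hS.adj_iff_of_mem_clq hyS hwS huc).1 hadj)
    have hDc : D ⊆ clq G S w := fun v hv =>
      hS.mem_clq_trans huc hwS (hS.subset_clq_of_connected (h𝒟.conn D hD) hDS hu hv)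
    refine ⟨D, hD, fun hf => ?_, hDc⟩
    rcases hfinsel D hf with ⟨x, hx, hxS⟩ | ⟨x, hxS, D', hD', hxD', v, hv, hadj⟩
    · exact hDS x hx hxS
    · exact hsel x hxS D' hD' hxD' ((hS.adj_iff_of_mem_clq hxS hwS (hDc hv)).1 hadj)
  refine ⟨st, hreach, fun v => ?_, fun w hw => ?_, fun v hvS hv => ?_, ?_⟩
  · by_contra h3
    obtain ⟨-, ℓ, hℓ⟩ := hmat.three_le_lab.1 (not_lt.1 h3)
    exact hop ℓ v hℓ
  · obtain ⟨D, hD, -, hsub⟩ := hunit w hw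
    have := Finset.card_le_card hsub
    rw [h𝒟.card_eq D hD] at this
    omega
  · have hvu : v ∉ g.used := (hmat.lab_lt_two hvS).1 (by omega)
    have h0 := hmat.lab_unused v hvS hvu
    rw [hv] at h0
    have hno : ∀ u ∈ g.used, ¬ G.Adj v u := by
      intro u hu hadj
      rw [if_pos ⟨u, hu, hadj⟩] at h0
      omega
    obtain ⟨D, hD, u, hu, huv⟩ := h𝒟.dom v
    have hnsel : ¬ Selected G S 𝒟 D := by
      intro hsel
      have hu' := (hused u).2 ⟨D, hselfin D hD hsel, hu⟩
      rcases huv with rfl | hadj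
      exacts [hvu hu', hno u hu' hadj]
    have huS : u ∉ S := fun huS => hnsel (Or.inl ⟨u, hu, huS⟩)
    refine ⟨u, hmat.isolated_iff.2 ⟨huS, fun x hx D' hD' hxD' hadj => hnsel
      (Or.inr ⟨x, hx, D', hgood.fin_sub D' hD', hxD', u, hu, hadj⟩)⟩, ?_⟩
    rcases huv with rfl | hadj
    exacts [absurd hvS huS, hadj]
  · choose! U hU1 hU2 hU3 using hunit
    have hcard : (univ.filter fun w => IsRep G S w ∧ st.Isolated G S w).card ≤
        (𝒟 \ g.fin).card := by
      refine Finset.card_le_card_of_injOn U (fun w hw => ?_) (fun w hw w' hw' he => ?_)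
      · have hw := (Finset.mem_filter.1 hw).2.2
        exact Finset.mem_coe.2 (Finset.mem_sdiff.2 ⟨hU1 w hw, hU2 w hw⟩)
      · have hw := (Finset.mem_filter.1 hw).2
        have hw' := (Finset.mem_filter.1 hw').2
        obtain ⟨v, hv⟩ := hne _ (hU1 w hw.2)
        exact hS.isRep_unique hw.1 hw'.1 (hU3 w hw.2 hv) (hU3 w' hw'.2 (he ▸ hv))
    rw [Finset.card_sdiff_of_subset (fun D hD => hgood.fin_sub D hD)] at hcard
    have := Finset.card_le_card (show g.fin ⊆ 𝒟 from fun D hD => hgood.fin_sub D hD)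
    have := hmat.units_eq
    have e : ∀ i : DecidablePred fun w => IsRep G S w ∧ st.Isolated G S w,
      (@Finset.filter _ _ i univ).card ≤ 𝒟.card - g.fin.card := fun i => by convert hcard
    have := e (fun _ => Classical.propDecidable _)
    omega

/-- The dynamic program is correct. -/
theorem hasGroupedDominatingSet_iff (hS : IsTwinCover G S) (hr : 1 ≤ r) (hn : 0 < n) :
    HasGroupedDominatingSet G r k ↔ ∃ st, Reach G S r hn st ∧ st.Accept G S r k := by
  refine ⟨fun h => h.exists_accept hS hr hn, fun ⟨st, hst, hacc⟩ => ?_⟩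
  obtain ⟨g, hg⟩ := hst.exists_matches hS hr
  exact hg.hasGroupedDominatingSet hS hr hacc

end Completeness

/-! ### Configurations as numbers -/

theorem sum_mul_pow_lt {B : ℕ} {f : ℕ → ℕ} (m : ℕ) (hf : ∀ i < m, f i < B) :
    ∑ i ∈ range m, f i * B ^ i < B ^ m := by
  induction m with
  | zero => simp
  | succ m ih =>
    have h1 := ih fun i hi => hf i (by omega)
    have h2 : (f m + 1) * B ^ m ≤ B * B ^ m := Nat.mul_le_mul_right _ (hf m (by omega))
    rw [sum_range_succ, pow_succ']
    linarith [add_mul (f m) 1 (B ^ m), one_mul (B ^ m)]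

/-- The digits of a number in base `B`. -/
theorem sum_mul_pow_div_mod {B : ℕ} {f : ℕ → ℕ} (m : ℕ) (hf : ∀ i < m, f i < B) {j : ℕ}
    (hj : j < m) : (∑ i ∈ range m, f i * B ^ i) / B ^ j % B = f j := by
  have hB : 0 < B := (Nat.zero_le _).trans_lt (hf j hj)
  induction m with
  | zero => omega
  | succ m ih =>
    have h1 := sum_mul_pow_lt m fun i hi => hf i (by omega)
    rw [sum_range_succ]
    rcases Nat.lt_succ_iff_lt_or_eq.1 hj with hlt | rfl
    · rw [← ih (fun i hi => hf i (by omega)) hlt]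
      obtain ⟨d, rfl⟩ : ∃ d, m = j + 1 + d := ⟨m - (j + 1), by omega⟩
      rw [show f (j + 1 + d) * B ^ (j + 1 + d) = B ^ j * (B * (f (j + 1 + d) * B ^ d)) by ring,
        Nat.add_mul_div_left _ _ (pow_pos hB _), Nat.add_mul_mod_self_left]
    · rw [Nat.add_mul_div_right _ _ (pow_pos hB _), Nat.div_eq_of_lt h1, zero_add,
        Nat.mod_eq_of_lt (hf _ hj)]

section Coding

variable {n : ℕ}

/-- The digits of the code of a configuration. -/
def Config.digit (st : Config n) (i : ℕ) : ℕ :=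
  if h : i < n then st.lab ⟨i, h⟩
  else if h : i - n < n then st.cnt ⟨i - n, h⟩
  else if i = 2 * n then st.pos
  else if i = 2 * n + 1 then st.used
  else if i = 2 * n + 2 then st.link
  else st.units

/-- The code of a configuration: a number with `2 n + 4` digits in base `n + 4`. -/
def Config.code (st : Config n) : ℕ := ∑ i ∈ range (2 * n + 4), st.digit i * (n + 4) ^ i

/-- The configuration with a given code. -/
def Config.decode (hn : 0 < n) (s : ℕ) : Config n where
  lab v := s / (n + 4) ^ (v : ℕ) % (n + 4)
  cnt v := s / (n + 4) ^ (n + (v : ℕ)) % (n + 4)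
  pos := ⟨s / (n + 4) ^ (2 * n) % (n + 4) % n, Nat.mod_lt _ hn⟩
  used := s / (n + 4) ^ (2 * n + 1) % (n + 4)
  link := s / (n + 4) ^ (2 * n + 2) % (n + 4)
  units := s / (n + 4) ^ (2 * n + 3) % (n + 4)

/-- The configuration can be recovered from its code. -/
structure Config.Valid (st : Config n) : Prop where
  lab : ∀ v, st.lab v < n + 4
  cnt : ∀ v, st.cnt v < n + 4
  used : st.used < n + 4
  link : st.link < n + 4
  units : st.units < n + 4

theorem Config.Valid.digit_lt {st : Config n} (h : st.Valid) (i : ℕ) : st.digit i < n + 4 := by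
  unfold Config.digit
  split_ifs
  exacts [h.lab _, h.cnt _, by have := st.pos.2; omega, h.used, h.link, h.units]

theorem Config.Valid.decode_code {st : Config n} (h : st.Valid) (hn : 0 < n) :
    Config.decode hn st.code = st := by
  have key : ∀ j, j < 2 * n + 4 → st.code / (n + 4) ^ j % (n + 4) = st.digit j := fun j hj =>
    sum_mul_pow_div_mod _ (fun i _ => h.digit_lt i) hj
  ext v
  · simp [Config.decode, key v (by omega), Config.digit]
  · simp [Config.decode, key (n + v) (by omega), Config.digit]
  · have := st.pos.2
    simp [Config.decode, key (2 * n) (by omega), Config.digit, show ¬ 2 * n < n by omega,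
      show ¬ 2 * n - n < n by omega, Nat.mod_eq_of_lt this]
  · simp [Config.decode, key (2 * n + 1) (by omega), Config.digit, show ¬ 2 * n + 1 < n by omega,
      show ¬ 2 * n + 1 - n < n by omega]
  · simp [Config.decode, key (2 * n + 2) (by omega), Config.digit, show ¬ 2 * n + 2 < n by omega,
      show ¬ 2 * n + 2 - n < n by omega]
  · simp [Config.decode, key (2 * n + 3) (by omega), Config.digit, show ¬ 2 * n + 3 < n by omega,
      show ¬ 2 * n + 3 - n < n by omega]

theorem Config.Valid.code_lt {st : Config n} (h : st.Valid) :
    st.code < (n + 4) ^ (2 * n + 4) :=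
  sum_mul_pow_lt _ fun i _ => h.digit_lt i

theorem Config.code_eq (st : Config n) : st.code =
    (∑ v : Fin n, (st.lab v * (n + 4) ^ (v : ℕ) + st.cnt v * (n + 4) ^ (n + (v : ℕ)))) +
      (st.pos * (n + 4) ^ (2 * n) + (st.used * (n + 4) ^ (2 * n + 1) +
        (st.link * (n + 4) ^ (2 * n + 2) + st.units * (n + 4) ^ (2 * n + 3)))) := by
  rw [Config.code, show 2 * n + 4 = n + n + 4 by ring, Finset.sum_range_add, Finset.sum_range_add,
    Finset.sum_add_distrib, Finset.sum_range, Finset.sum_range]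
  have e : ∀ i, n + n + i = 2 * n + i := fun i => by ring
  simp only [Finset.sum_range_succ, Finset.sum_range_zero, Config.digit, e]
  simp [show ¬ 2 * n < n by omega, show ¬ 2 * n - n < n by omega, show ∀ i, ¬ 2 * n + i < n by omega,
    show ∀ i, ¬ 2 * n + i - n < n by omega, add_assoc]

theorem Config.code_start (hn : 0 < n) : (Config.start hn).code = 0 := by
  simp [Config.code_eq, Config.start]

/-- The move with a given number below `6 n²`. -/
def Move.ofNat (hn : 0 < n) (c : ℕ) : Move n :=
  if c / (n * n) = 0 then .new ⟨c / n % n, Nat.mod_lt _ hn⟩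
  else if c / (n * n) = 1 then .join ⟨c / n % n, Nat.mod_lt _ hn⟩ ⟨c % n, Nat.mod_lt _ hn⟩
  else if c / (n * n) = 2 then .attach ⟨c / n % n, Nat.mod_lt _ hn⟩
  else if c / (n * n) = 3 then .inner
  else if c / (n * n) = 4 then .next
  else .finish ⟨c / n % n, Nat.mod_lt _ hn⟩

theorem Move.exists_ofNat (hn : 0 < n) (m : Move n) : ∃ c < 6 * (n * n), Move.ofNat hn c = m := by
  have key : ∀ (i : ℕ) (x y : Fin n), i < 6 → ∃ c < 6 * (n * n), c / (n * n) = i ∧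
      (⟨c / n % n, Nat.mod_lt _ hn⟩ : Fin n) = x ∧ (⟨c % n, Nat.mod_lt _ hn⟩ : Fin n) = y := by
    intro i x y hi
    have hxy : (x : ℕ) * n + y < n * n := by
      have : ((x : ℕ) + 1) * n ≤ n * n := Nat.mul_le_mul_right _ x.2
      have := y.2
      linarith [add_mul (x : ℕ) 1 n, one_mul n]
    refine ⟨i * (n * n) + (x * n + y), ?_, ?_, Fin.ext ?_, Fin.ext ?_⟩
    · have : (i + 1) * (n * n) ≤ 6 * (n * n) := Nat.mul_le_mul_right _ hi
      linarith [add_mul i 1 (n * n), one_mul (n * n)]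
    · rw [add_comm, Nat.add_mul_div_right _ _ (Nat.mul_pos hn hn), Nat.div_eq_of_lt hxy, zero_add]
    · show (i * (n * n) + (x * n + y)) / n % n = x
      rw [show i * (n * n) + (x * n + y) = y + (x + n * i) * n by ring,
        Nat.add_mul_div_right _ _ hn, Nat.div_eq_of_lt y.2, zero_add, Nat.add_mul_mod_self_left,
        Nat.mod_eq_of_lt x.2]
    · show (i * (n * n) + (x * n + y)) % n = y
      rw [show i * (n * n) + (x * n + y) = y + (x + n * i) * n by ring,
        Nat.add_mul_mod_self_right, Nat.mod_eq_of_lt y.2]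
  let z : Fin n := ⟨0, hn⟩
  cases m with
  | new x =>
    obtain ⟨c, hc, h1, h2, -⟩ := key 0 x z (by norm_num)
    exact ⟨c, hc, by simp [ofNat, h1, h2]⟩
  | join x y =>
    obtain ⟨c, hc, h1, h2, h3⟩ := key 1 x y (by norm_num)
    exact ⟨c, hc, by simp [ofNat, h1, h2, h3]⟩
  | attach x =>
    obtain ⟨c, hc, h1, h2, -⟩ := key 2 x z (by norm_num)
    exact ⟨c, hc, by simp [ofNat, h1, h2]⟩
  | inner =>
    obtain ⟨c, hc, h1, -, -⟩ := key 3 z z (by norm_num)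
    exact ⟨c, hc, by simp [ofNat, h1]⟩
  | next =>
    obtain ⟨c, hc, h1, -, -⟩ := key 4 z z (by norm_num)
    exact ⟨c, hc, by simp [ofNat, h1]⟩
  | finish x =>
    obtain ⟨c, hc, h1, h2, -⟩ := key 5 x z (by norm_num)
    exact ⟨c, hc, by simp [ofNat, h1, h2]⟩

end Coding

section ReachCodes

variable {n : ℕ} {G : SimpleGraph (Fin n)} {S : Finset (Fin n)} {r : ℕ} {hn : 0 < n}

theorem Matches.fin_card_le {st : Config n} {g : Partial n} (h : Matches G S r st g)
    (hr : 1 ≤ r) : g.fin.card ≤ n := by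
  have hne : ∀ D ∈ g.fin, ∃ v, v ∈ D := fun D hD =>
    Finset.card_pos.1 (by rw [h.fin_card D hD]; omega)
  rcases g.fin.eq_empty_or_nonempty with h0 | ⟨D₀, hD₀⟩
  · simp [h0]
  have : Nonempty (Fin n) := ⟨(hne D₀ hD₀).choose⟩
  choose! f hf using hne
  have := Finset.card_le_card_of_injOn (s := g.fin) (t := univ) f (fun D _ => by simp)
    (fun D hD D' hD' he => h.fin_disj D hD D' hD' (f D) (hf D hD) (he ▸ hf D' hD'))
  simpa using this

theorem Matches.lab_cases {st : Config n} {g : Partial n} (h : Matches G S r st g) (v : Fin n) :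
    st.lab v < 3 ∨ ∃ ℓ ∈ S, st.lab v = ℓ + 3 := by
  by_cases h3 : 3 ≤ st.lab v
  · obtain ⟨hv, ℓ, hℓ⟩ := h.three_le_lab.1 h3
    exact Or.inr ⟨ℓ, (h.op_name ℓ v hℓ).1, h.lab_op v hv ℓ hℓ⟩
  · exact Or.inl (by omega)

theorem Matches.used_le {st : Config n} {g : Partial n} (h : Matches G S r st g) :
    st.used ≤ n := by
  classical
  rw [h.used_eq]
  split_ifs
  · exact (Finset.card_le_univ _).trans_eq (Fintype.card_fin n)
  · omega

theorem Matches.valid {st : Config n} {g : Partial n} (h : Matches G S r st g) (hr : 1 ≤ r) :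
    st.Valid := by
  refine ⟨fun v => ?_, fun v => ?_, ?_, ?_, ?_⟩
  · rcases h.lab_cases v with h | ⟨ℓ, -, h⟩ <;> omega
  · have := Finset.card_le_univ (g.op v)
    rw [Fintype.card_fin] at this
    rw [h.cnt_eq]
    omega
  · have := h.used_le
    omega
  · have := h.link_le
    omega
  · have := h.fin_card_le hr
    rw [h.units_eq]
    omega

theorem Reach.valid {st : Config n} (h : Reach G S r hn st) (hS : IsTwinCover G S) (hr : 1 ≤ r) :
    st.Valid := by
  obtain ⟨g, hg⟩ := h.exists_matches hS hr
  exact hg.valid hr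

open Classical in
/-- The transition function on codes: a move that is not possible changes nothing. -/
noncomputable def nextCode (G : SimpleGraph (Fin n)) (S : Finset (Fin n)) (r : ℕ) (hn : 0 < n)
    (s c : ℕ) : ℕ :=
  if (Config.decode hn s).Can G S r (Move.ofNat hn c) then
    ((Config.decode hn s).apply G S r (Move.ofNat hn c)).code
  else s

/-- The visited codes are those of the reached configurations. -/
theorem visited_iff (hS : IsTwinCover G S) (hr : 1 ≤ r) {s : ℕ} :
    Visited (nextCode G S r hn) (fun t => (Config.decode hn t).Tidy r) (6 * (n * n)) 0 s ↔
      ∃ st, Reach G S r hn st ∧ s = st.code := by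
  constructor
  · intro h
    induction h with
    | init => exact ⟨_, .start, (Config.code_start hn).symm⟩
    | @step s c _ _ hok ih =>
      obtain ⟨st, hst, rfl⟩ := ih
      have hd := (hst.valid hS hr).decode_code hn
      by_cases hcan : st.Can G S r (Move.ofNat hn c)
      · have hd' : (st.apply G S r (Move.ofNat hn c)).Valid := by
          obtain ⟨g, hg⟩ := hst.exists_matches hS hr
          obtain ⟨g', hg'⟩ := hg.exists_apply hS hr hcan
          exact hg'.valid hr
        rw [nextCode, hd, if_pos hcan, hd'.decode_code] at hok
        exact ⟨_, hst.step hcan hok, by rw [nextCode, hd, if_pos hcan]⟩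
      · exact ⟨st, hst, by rw [nextCode, hd, if_neg hcan]⟩
  · rintro ⟨st, hst, rfl⟩
    induction hst with
    | start => rw [Config.code_start]; exact .init
    | @step st m hst hcan htidy ih =>
      obtain ⟨c, hc, rfl⟩ := Move.exists_ofNat hn m
      have hd := (hst.valid hS hr).decode_code hn
      have hd' := ((hst.step hcan htidy).valid hS hr).decode_code hn
      have e : nextCode G S r hn st.code c = (st.apply G S r (Move.ofNat hn c)).code := by
        rw [nextCode, hd, if_pos hcan]
      rw [← e]
      exact ih.step hc (by rw [e, hd']; exact htidy)

/-! ### Counting configurations -/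

theorem Matches.cnt_out {st : Config n} {g : Partial n} (h : Matches G S r st g) {v : Fin n}
    (hv : st.lab v < 3) : st.cnt v = 0 := by
  rw [h.cnt_eq, Finset.card_eq_zero, Finset.eq_empty_iff_forall_notMem]
  intro u hu
  obtain ⟨hvS, hvv⟩ := h.op_name v u hu
  have := h.lab_op v hvS v hvv
  omega

open Classical in
/-- Each vertex of the twin cover has `|S| + 3` possible labels and `r + 1` possible counters. -/
theorem exists_configs (hS : IsTwinCover G S) (hr : 1 ≤ r) :
    ∃ T : Finset (Config n), (∀ st, Reach G S r hn st → st ∈ T) ∧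
      T.card ≤ ((S.card + 3) * (r + 1)) ^ S.card * (n * ((n + 1) * ((n + 1) * (n + 1)))) := by
  let Par := (S → (Fin 3 ⊕ S) × Fin (r + 1)) × (Fin n × (Fin (n + 1) × (Fin (n + 1) × Fin (n + 1))))
  let e : Par → Config n := fun p =>
    { lab := fun v => if h : v ∈ S then (p.1 ⟨v, h⟩).1.elim (fun i : Fin 3 => (i : ℕ)) (fun ℓ : S => ((ℓ : Fin n) : ℕ) + 3) else 0
      cnt := fun v => if h : v ∈ S then (p.1 ⟨v, h⟩).2 else 0
      pos := p.2.1
      used := p.2.2.1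
      link := p.2.2.2.1
      units := p.2.2.2.2 }
  refine ⟨univ.image e, fun st hst => ?_, Finset.card_image_le.trans (le_of_eq ?_)⟩
  · obtain ⟨g, hg⟩ := hst.exists_matches hS hr
    have hlab : ∀ v : Fin n, ∃ l : Fin 3 ⊕ S, st.lab v = l.elim (fun i : Fin 3 => (i : ℕ))
        (fun ℓ : S => ((ℓ : Fin n) : ℕ) + 3) := by
      intro v
      rcases hg.lab_cases v with h | ⟨ℓ, hℓ, h⟩
      exacts [⟨.inl ⟨_, h⟩, rfl⟩, ⟨.inr ⟨ℓ, hℓ⟩, h⟩]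
    choose l hl using hlab
    have hcnt : ∀ v, st.cnt v < r + 1 := fun v => by
      have := hg.op_le v
      rw [hg.cnt_eq]
      omega
    have h1 := hg.used_le
    have h2 := hg.link_le
    have h3 := hg.fin_card_le hr
    rw [← hg.units_eq] at h3
    refine Finset.mem_image.2 ⟨⟨fun v => (l v, ⟨st.cnt v, hcnt v⟩), st.pos, ⟨st.used, by omega⟩,
      ⟨st.link, by omega⟩, ⟨st.units, by omega⟩⟩, Finset.mem_univ _, ?_⟩
    ext v
    · by_cases hv : v ∈ S
      · simp [e, hv, hl]
      · simp [e, hv, hg.lab_out v hv]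
    · by_cases hv : v ∈ S
      · simp [e, hv]
      · simp [e, hv, hg.cnt_out (v := v) (by rw [hg.lab_out v hv]; norm_num)]
    all_goals rfl
  · simp only [Finset.card_univ, Par, Fintype.card_prod, Fintype.card_fun, Fintype.card_sum,
      Fintype.card_fin, Fintype.card_coe]
    ring

theorem exists_fin_cover {α : Type*} [Nonempty α] {F : Finset α} {m : ℕ} (hF : F.card ≤ m) :
    ∃ p : Fin m → α, ∀ v ∈ F, ∃ i, p i = v := by
  classical
  obtain ⟨f⟩ : Nonempty (F ↪ Fin m) :=
    Function.Embedding.nonempty_of_card_le (by simpa using hF)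
  refine ⟨fun i => if h : ∃ v, f v = i then (h.choose : α) else Classical.arbitrary α,
    fun v hv => ⟨f ⟨v, hv⟩, ?_⟩⟩
  have h : ∃ u, f u = f ⟨v, hv⟩ := ⟨_, rfl⟩
  simp only [dif_pos h]
  rw [f.injective h.choose_spec]

open Classical in
/-- For `r ∈ {2, 3}`, all but three vertices of the twin cover have `r + 1` possible labels, which
determine the counter. -/
theorem exists_configs_tidy (hS : IsTwinCover G S) (hr : r = 2 ∨ r = 3) :
    ∃ T : Finset (Config n), (∀ st, Reach G S r hn st → st ∈ T) ∧
      T.card ≤ (r + 1) ^ S.card * ((n * ((n + 3) * (r + 1))) ^ 3 *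
        (n * ((n + 1) * ((n + 1) * (n + 1))))) := by
  -- the second component lists three vertices with their labels and counters, which override the
  -- regular values given by the first component
  let Par := (S → Fin (r + 1)) × ((Fin 3 → Fin n × (Fin (n + 3) × Fin (r + 1))) ×
    (Fin n × (Fin (n + 1) × (Fin (n + 1) × Fin (n + 1)))))
  let e : Par → Config n := fun p =>
    { lab := fun v => if h : ∃ i, (p.2.1 i).1 = v then (p.2.1 h.choose).2.1 else
        if h : v ∈ S then if (p.1 ⟨v, h⟩ : ℕ) < 3 then p.1 ⟨v, h⟩ else v + 3 else 0
      cnt := fun v => if h : ∃ i, (p.2.1 i).1 = v then (p.2.1 h.choose).2.2 else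
        if h : v ∈ S then if (p.1 ⟨v, h⟩ : ℕ) < 3 then 0 else 2 else 0
      pos := p.2.2.1
      used := p.2.2.2.1
      link := p.2.2.2.2.1
      units := p.2.2.2.2.2 }
  refine ⟨univ.image e, fun st hst => ?_, Finset.card_image_le.trans (le_of_eq ?_)⟩
  · obtain ⟨g, hg⟩ := hst.exists_matches hS (by omega)
    have htidy : st.Tidy r := by
      cases hst with
      | start => intro _; simp [Config.Loose, Config.start]
      | step _ _ h => exact h
    have : Nonempty (Fin n) := ⟨⟨0, hn⟩⟩
    -- `p` lists the loose vertices, possibly among others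
    obtain ⟨p, hp⟩ := exists_fin_cover (Nat.lt_succ_iff.1 (htidy hr))
    have hlab : ∀ v, st.lab v < n + 3 := fun v => by
      rcases hg.lab_cases v with h | ⟨ℓ, -, h⟩ <;> omega
    have hcnt : ∀ v, st.cnt v < r + 1 := fun v => by
      have := hg.op_le v
      rw [hg.cnt_eq]
      omega
    have h1 := hg.used_le
    have h2 := hg.link_le
    have h3 := hg.fin_card_le (by omega)
    rw [← hg.units_eq] at h3
    have hbase : ∀ v, ∃ d : Fin (r + 1), (∃ i, p i = v) ∨
        st.lab v = (if (d : ℕ) < 3 then (d : ℕ) else v + 3) ∧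
          st.cnt v = if (d : ℕ) < 3 then 0 else 2 := by
      intro v
      by_cases hv : ∃ i, p i = v
      · exact ⟨0, Or.inl hv⟩
      · have hnl : ¬ st.Loose r v := fun h => hv (hp v (by simpa using h))
        by_cases h3 : st.lab v < 3
        · exact ⟨⟨st.lab v, by omega⟩, Or.inr ⟨by simp [h3], by simp [h3, hg.cnt_out h3]⟩⟩
        · have : st.lab v = v + 3 ∧ st.cnt v = 2 ∧ r = 3 := by
            by_contra hcon
            exact hnl ⟨by omega, hcon⟩
          exact ⟨⟨3, by omega⟩, Or.inr ⟨by simpa using this.1, by simpa using this.2.1⟩⟩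
    choose d hd using hbase
    refine Finset.mem_image.2 ⟨⟨fun v => d v, fun i => (p i, ⟨st.lab (p i), hlab _⟩,
      ⟨st.cnt (p i), hcnt _⟩), st.pos, ⟨st.used, by omega⟩, ⟨st.link, by omega⟩,
      ⟨st.units, by omega⟩⟩, Finset.mem_univ _, ?_⟩
    ext v
    · by_cases h : ∃ i, p i = v
      · simp only [e, dif_pos h]
        rw [h.choose_spec]
      · simp only [e, dif_neg h]
        by_cases hv : v ∈ S
        · rw [dif_pos hv, ((hd v).resolve_left h).1]
        · rw [dif_neg hv, hg.lab_out v hv]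
    · by_cases h : ∃ i, p i = v
      · simp only [e, dif_pos h]
        rw [h.choose_spec]
      · simp only [e, dif_neg h]
        by_cases hv : v ∈ S
        · rw [dif_pos hv, ((hd v).resolve_left h).2]
        · rw [dif_neg hv, hg.cnt_out (v := v) (by rw [hg.lab_out v hv]; norm_num)]
    all_goals rfl
  · simp only [Finset.card_univ, Par, Fintype.card_prod, Fintype.card_fun,
      Fintype.card_fin, Fintype.card_coe]

end ReachCodes

/-! ### Expressions with a meaning -/

namespace XExpr

/-- Negation. -/
def neg (e : XExpr) : XExpr := .op .eq e (.const 0)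

/-- Conjunction. -/
def conj (a b : XExpr) : XExpr := .ite a b (.const 0)

/-- Disjunction. -/
def disj (a b : XExpr) : XExpr := .ite a (.const 1) b

/-- The number of values of register `x` below the content of register `0` for which `e` holds. -/
def count (x : ℕ) (e : XExpr) : XExpr := .sum x (.ite e (.const 1) (.const 0))

/-- Universal quantification over the values of register `x` below the content of register `0`. -/
def all (x : ℕ) (e : XExpr) : XExpr := .op .eq (count x (neg e)) (.const 0)

/-- The value of the expression is `v` in each state that agrees with `σ` on the arrays and on the
registers below `d`. The registers from `d` on are free to be used as summation variables. -/
def Den (d : ℕ) (σ : State) (e : XExpr) (v : ℕ) : Prop :=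
  ∀ τ : State, τ.EqvBelow d σ → e.eval τ = v

/-- The expression is non-zero if and only if `p`, in each state that agrees with `σ` on the arrays
and on the registers below `d`. -/
def Holds (d : ℕ) (σ : State) (e : XExpr) (p : Prop) : Prop :=
  ∀ τ : State, τ.EqvBelow d σ → (e.eval τ ≠ 0 ↔ p)

variable {d : ℕ} {σ : State} {e e₁ e₂ a b : XExpr} {v v₁ v₂ : ℕ} {p q : Prop}

theorem eqvBelow_refl (d : ℕ) (σ : State) : σ.EqvBelow d σ := ⟨fun _ _ => rfl, rfl⟩

theorem eqvBelow_setReg_of_eqvBelow {τ : State} (h : τ.EqvBelow d σ) (i : ℕ) :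
    (τ.setReg d i).EqvBelow (d + 1) (σ.setReg d i) := by
  refine ⟨fun x hx => ?_, h.2⟩
  simp only [State.setReg_reg]
  split_ifs
  · rfl
  · exact h.1 x (by omega)

theorem Den.eval (h : Den d σ e v) : e.eval σ = v := h σ (eqvBelow_refl d σ)

theorem Holds.eval (h : Holds d σ e p) : e.eval σ ≠ 0 ↔ p := h σ (eqvBelow_refl d σ)

theorem Den.congr (h : Den d σ e v₁) (hv : v₁ = v₂) : Den d σ e v₂ := hv ▸ h

theorem Holds.congr (h : Holds d σ e p) (hp : p ↔ q) : Holds d σ e q :=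
  fun τ hτ => (h τ hτ).trans hp

theorem Den.lift (h : Den d σ e v) (i : ℕ) : Den (d + 1) (σ.setReg d i) e v := fun τ hτ =>
  h τ ((hτ.mono (Nat.le_succ d)).trans (State.eqvBelow_setReg d σ i))

theorem Den.const (c : ℕ) : Den d σ (.const c) c := fun _ _ => rfl

theorem Den.reg {x : ℕ} (hx : x < d) : Den d σ (.reg x) (σ.reg x) := fun _ hτ => hτ.1 x hx

theorem Den.load (h : Den d σ e v) (a : ℕ) : Den d σ (.load a e) (σ.arr a v) := fun τ hτ => by
  rw [XExpr.eval, h τ hτ, hτ.2]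

theorem Den.op (o : Op) (h₁ : Den d σ e₁ v₁) (h₂ : Den d σ e₂ v₂) :
    Den d σ (.op o e₁ e₂) (o.eval v₁ v₂) := fun τ hτ => by
  rw [XExpr.eval, h₁ τ hτ, h₂ τ hτ]

theorem Den.ite (h : Holds d σ e p) (h₁ : Den d σ a v₁) (h₂ : Den d σ b v₂) [Decidable p] :
    Den d σ (.ite e a b) (if p then v₁ else v₂) := fun τ hτ => by
  rw [XExpr.eval, h₁ τ hτ, h₂ τ hτ]
  exact if_congr (h τ hτ) rfl rfl

theorem Den.sum {n : ℕ} (hn : σ.reg 0 = n) (hd : 0 < d) {f : Fin n → ℕ}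
    (h : ∀ i : Fin n, Den (d + 1) (σ.setReg d i) e (f i)) :
    Den d σ (.sum d e) (∑ i, f i) := fun τ hτ => by
  rw [XExpr.eval, hτ.1 0 hd, hn, Finset.sum_range]
  exact Finset.sum_congr rfl fun i _ => h i _ (eqvBelow_setReg_of_eqvBelow hτ i)

theorem Holds.lt (h₁ : Den d σ e₁ v₁) (h₂ : Den d σ e₂ v₂) :
    Holds d σ (.op .lt e₁ e₂) (v₁ < v₂) := fun τ hτ => by
  simp [XExpr.eval, Op.eval, h₁ τ hτ, h₂ τ hτ]

theorem Holds.eq (h₁ : Den d σ e₁ v₁) (h₂ : Den d σ e₂ v₂) :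
    Holds d σ (.op .eq e₁ e₂) (v₁ = v₂) := fun τ hτ => by
  simp [XExpr.eval, Op.eval, h₁ τ hτ, h₂ τ hτ]

theorem Holds.ite (h : Holds d σ e p) {q₁ q₂ : Prop} (h₁ : Holds d σ a q₁) (h₂ : Holds d σ b q₂)
    [Decidable p] : Holds d σ (.ite e a b) (if p then q₁ else q₂) := fun τ hτ => by
  rw [XExpr.eval]
  split_ifs with h3 h4 h4
  · exact h₁ τ hτ
  · exact absurd ((h τ hτ).1 h3) h4
  · exact absurd ((h τ hτ).2 h4) h3
  · exact h₂ τ hτ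

theorem Holds.neg (h : Holds d σ e p) : Holds d σ e.neg (¬ p) := fun τ hτ => by
  rw [← h τ hτ]
  by_cases h0 : e.eval τ = 0 <;> simp [XExpr.neg, XExpr.eval, Op.eval, h0]

theorem Holds.conj (h₁ : Holds d σ a p) (h₂ : Holds d σ b q) : Holds d σ (a.conj b) (p ∧ q) :=
  fun τ hτ => by
    classical
    refine ((h₁.ite h₂ (b := .const 0) (q₂ := False) fun τ _ => by simp [XExpr.eval]) τ hτ).trans ?_
    split_ifs <;> tauto

theorem Holds.disj (h₁ : Holds d σ a p) (h₂ : Holds d σ b q) : Holds d σ (a.disj b) (p ∨ q) :=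
  fun τ hτ => by
    classical
    refine ((h₁.ite (a := .const 1) (q₁ := True) (fun τ _ => by simp [XExpr.eval]) h₂) τ hτ).trans ?_
    split_ifs <;> tauto

theorem Den.count {n : ℕ} (hn : σ.reg 0 = n) (hd : 0 < d) {P : Fin n → Prop} [DecidablePred P]
    (h : ∀ i : Fin n, Holds (d + 1) (σ.setReg d i) e (P i)) :
    Den d σ (.count d e) (univ.filter P).card := by
  rw [Finset.card_filter]
  exact Den.sum hn hd fun i => .ite (h i) (.const 1) (.const 0)

theorem Holds.all {n : ℕ} (hn : σ.reg 0 = n) (hd : 0 < d) {P : Fin n → Prop}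
    (h : ∀ i : Fin n, Holds (d + 1) (σ.setReg d i) e (P i)) :
    Holds d σ (.all d e) (∀ i, P i) := by
  classical
  refine (Holds.eq (Den.count hn hd fun i => (h i).neg) (.const 0)).congr ?_
  simp [Finset.filter_eq_empty_iff]

end XExpr

/-! ### Expressions for the transitions -/

section Expressions

variable {n : ℕ} {G : SimpleGraph (Fin n)} {S : Finset (Fin n)} {r k : ℕ} {hn : 0 < n}

/-- Register `0` holds `n`, array `0` holds the adjacency matrix, and the vertices of `S` are those
whose entry in array `1` is the content of register `3`. The registers from `d` on are free. -/
structure Env (G : SimpleGraph (Fin n)) (S : Finset (Fin n)) (d : ℕ) (σ : State) : Prop where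
  reg_zero : σ.reg 0 = n
  adj : ∀ u v : Fin n, σ.arr 0 (u * n + v) ≠ 0 ↔ G.Adj u v
  cover : ∀ v : Fin n, σ.arr 1 v = σ.reg 3 ↔ v ∈ S
  free : 20 ≤ d

/-- The memory content during the search: moreover, registers `1`, `2` and `4` hold `r`, `k` and
`n + 4`, array `2` holds the powers of `n + 4`, and register `q` holds the code of `st`. -/
structure Ctx (G : SimpleGraph (Fin n)) (S : Finset (Fin n)) (r k : ℕ) (hn : 0 < n) (d q : ℕ)
    (σ : State) (st : Config n) : Prop extends Env G S d σ where
  reg_one : σ.reg 1 = r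
  reg_two : σ.reg 2 = k
  reg_four : σ.reg 4 = n + 4
  pow : ∀ i < 2 * n + 4, σ.arr 2 i = (n + 4) ^ i
  lt_free : q < d
  code : Config.decode hn (σ.reg q) = st

open XExpr

/-- Adjacency. -/
def adjE (u v : XExpr) : XExpr := .load 0 (.op .add (.op .mul u (.reg 0)) v)

/-- Membership in the twin cover. -/
def coverE (u : XExpr) : XExpr := .op .eq (.load 1 u) (.reg 3)

/-- The digit with index `i` of the number in register `q`. -/
def digitE (q : ℕ) (i : XExpr) : XExpr := .op .mod (.op .div (.reg q) (.load 2 i)) (.reg 4)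

/-- The label of a vertex. -/
def labE (q : ℕ) (u : XExpr) : XExpr := digitE q u

/-- The counter of a fragment. -/
def cntE (q : ℕ) (u : XExpr) : XExpr := digitE q (.op .add (.reg 0) u)

/-- The index of one of the last four digits of a code. -/
def lastE (i : ℕ) : XExpr := .op .add (.op .mul (.const 2) (.reg 0)) (.const i)

/-- The current vertex. -/
def posE (q : ℕ) : XExpr := .op .mod (digitE q (lastE 0)) (.reg 0)

/-- The size of the fragment of a vertex. -/
def sizeE (d q : ℕ) (u : XExpr) : XExpr :=
  .sum d (.ite (.op .eq (.op .add (.reg d) (.const 3)) (labE q u)) (cntE q (.reg d)) (.const 0))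

/-- Membership in the clique of `c`. -/
def clqE (u c : XExpr) : XExpr := (coverE u).neg.conj ((XExpr.op .eq u c).disj (adjE u c))

/-- The property of being the smallest vertex of a clique. -/
def repE (d : ℕ) (c : XExpr) : XExpr :=
  (coverE c).neg.conj (.all d
    (((XExpr.op .lt (.reg d) c).conj ((coverE (.reg d)).neg.conj (adjE (.reg d) c))).neg))

/-- The size of the clique of `c`. -/
def clqCardE (d : ℕ) (c : XExpr) : XExpr := .count d (clqE (.reg d) c)

/-- The size of the clique of `c`, if `c` is its smallest vertex. -/
def capE (d : ℕ) (c : XExpr) : XExpr := .ite (repE d c) (clqCardE d c) (.const 0)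

/-- The label of `v` after `u` has been used. -/
def touchE (q : ℕ) (u v : XExpr) : XExpr :=
  .ite ((coverE v).conj ((XExpr.op .eq (labE q v) (.const 0)).conj (adjE v u))) (.const 1)
    (labE q v)

/-- Looseness of a vertex. -/
def looseE (q : ℕ) (v : XExpr) : XExpr :=
  (XExpr.op .lt (.const 2) (labE q v)).conj
    (((XExpr.op .eq (labE q v) (.op .add v (.const 3))).conj
      ((XExpr.op .eq (cntE q v) (.const 2)).conj (.op .eq (.reg 1) (.const 3)))).neg)

/-- Tidiness of a configuration. -/
def tidyE (d q : ℕ) : XExpr :=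
  ((XExpr.op .eq (.reg 1) (.const 2)).disj (.op .eq (.reg 1) (.const 3))).neg.disj
    (.op .lt (.count d (looseE q (.reg d))) (.const 4))

/-- The property of being isolated. -/
def isolatedE (d q : ℕ) (w : XExpr) : XExpr :=
  (coverE w).neg.conj
    (.all d (((XExpr.op .eq (labE q (.reg d)) (.const 2)).conj (adjE (.reg d) w)).neg))

/-- The test at the end. -/
def acceptE (d q : ℕ) : XExpr :=
  (XExpr.all d (.op .lt (labE q (.reg d)) (.const 3))).conj <|
  (XExpr.all d ((isolatedE (d + 1) q (.reg d)).neg.disj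
    (.op .lt (.reg 1) (.op .add (clqCardE (d + 1) (.reg d)) (.const 1))))).conj <|
  (XExpr.all d (((coverE (.reg d)).conj (XExpr.op .eq (labE q (.reg d)) (.const 0))).neg.disj
    (XExpr.all (d + 1) (((isolatedE (d + 2) q (.reg (d + 1))).conj
      (adjE (.reg d) (.reg (d + 1)))).neg)).neg)).conj <|
  .op .lt (.op .add (digitE q (lastE 3))
    (.count d ((repE (d + 1) (.reg d)).conj (isolatedE (d + 1) q (.reg d)))))
    (.op .add (.reg 2) (.const 1))

/-- The vertices to which the choice in register `8` refers. -/
def fstE : XExpr := .op .mod (.op .div (.reg 8) (.reg 0)) (.reg 0)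

/-- The second vertex to which the choice in register `8` refers. -/
def sndE : XExpr := .op .mod (.reg 8) (.reg 0)

/-- Case distinction according to the kind of the move in register `8`. -/
def caseE (new join attach inner next finish : XExpr) : XExpr :=
  let kind : XExpr := .op .div (.reg 8) (.op .mul (.reg 0) (.reg 0))
  .ite (.op .eq kind (.const 0)) new <|
  .ite (.op .eq kind (.const 1)) join <|
  .ite (.op .eq kind (.const 2)) attach <|
  .ite (.op .eq kind (.const 3)) inner <|
  .ite (.op .eq kind (.const 4)) next finish

/-- The condition under which the move is possible. -/
def canE (d q : ℕ) : XExpr :=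
  caseE
    ((coverE fstE).conj (.op .lt (labE q fstE) (.const 2)))
    ((XExpr.op .lt (.const 2) (labE q fstE)).conj <|
      (XExpr.op .lt (.const 2) (labE q sndE)).conj <|
      (XExpr.op .eq (labE q fstE) (labE q sndE)).neg.conj <|
      (XExpr.op .lt (.op .add (sizeE d q fstE) (sizeE d q sndE)) (.op .add (.reg 1) (.const 1))).conj
        ((adjE fstE sndE).disj
          ((XExpr.op .eq (digitE q (lastE 2)) (.op .add fstE (.const 1))).conj
            (adjE sndE (posE q)))))
    ((XExpr.op .lt (.const 2) (labE q fstE)).conj <|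
      (adjE fstE (posE q)).conj <|
      (XExpr.op .lt (digitE q (lastE 1)) (capE d (posE q))).conj
        (.op .lt (sizeE d q fstE) (.reg 1)))
    (.op .lt (.op .add (digitE q (lastE 1)) (.reg 1)) (.op .add (capE d (posE q)) (.const 1)))
    (.op .lt (.op .add (posE q) (.const 1)) (.reg 0))
    ((XExpr.op .lt (.const 2) (labE q fstE)).conj (.op .eq (sizeE d q fstE) (.reg 1)))

/-- The label of `v` after the move. -/
def newLabE (q : ℕ) (v : XExpr) : XExpr :=
  caseE
    (.ite (.op .eq v fstE) (.op .add fstE (.const 3)) (touchE q fstE v))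
    (.ite (.op .eq (labE q v) (labE q sndE)) (labE q fstE) (labE q v))
    (touchE q (posE q) v)
    (touchE q (posE q) v)
    (labE q v)
    (.ite (.op .eq (labE q v) (labE q fstE)) (.const 2) (labE q v))

/-- The counter of `v` after the move. -/
def newCntE (d q : ℕ) (v : XExpr) : XExpr :=
  caseE
    (.ite (.op .eq v fstE) (.const 1) (cntE q v))
    (.ite (.op .eq (.op .add v (.const 3)) (labE q fstE)) (.op .add (cntE q v) (sizeE d q sndE))
      (.ite (.op .eq (.op .add v (.const 3)) (labE q sndE)) (.const 0) (cntE q v)))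
    (.ite (.op .eq (.op .add v (.const 3)) (labE q fstE)) (.op .add (cntE q v) (.const 1))
      (cntE q v))
    (cntE q v)
    (cntE q v)
    (.ite (.op .eq (.op .add v (.const 3)) (labE q fstE)) (.const 0) (cntE q v))

/-- The current vertex after the move. -/
def newPosE (q : ℕ) : XExpr :=
  caseE (posE q) (posE q) (posE q) (posE q)
    (.ite (.op .lt (.op .add (posE q) (.const 1)) (.reg 0)) (.op .add (posE q) (.const 1)) (posE q))
    (posE q)

/-- The number of used vertices of the current clique after the move. -/
def newUsedE (q : ℕ) : XExpr :=
  let u := digitE q (lastE 1)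
  caseE u u (.op .add u (.const 1)) (.op .add u (.reg 1)) (.const 0) u

/-- The link after the move. -/
def newLinkE (q : ℕ) : XExpr :=
  caseE (.const 0) (digitE q (lastE 2)) (.op .add fstE (.const 1)) (.const 0) (.const 0) (.const 0)

/-- The number of finished units after the move. -/
def newUnitsE (q : ℕ) : XExpr :=
  let u := digitE q (lastE 3)
  caseE u u u (.op .add u (.const 1)) u (.op .add u (.const 1))

/-- The code of the configuration in register `9` after the move in register `8`. -/
def nextE (d : ℕ) : XExpr :=
  .ite (canE d 9)
    (.op .add
      (.sum d (.op .add (.op .mul (newLabE 9 (.reg d)) (.load 2 (.reg d)))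
        (.op .mul (newCntE (d + 1) 9 (.reg d)) (.load 2 (.op .add (.reg 0) (.reg d))))))
      (.op .add (.op .mul (newPosE 9) (.load 2 (lastE 0)))
        (.op .add (.op .mul (newUsedE 9) (.load 2 (lastE 1)))
          (.op .add (.op .mul (newLinkE 9) (.load 2 (lastE 2)))
            (.op .mul (newUnitsE 9) (.load 2 (lastE 3)))))))
    (.reg 9)

theorem den_var {d : ℕ} {σ : State} (i : Fin n) : Den (d + 1) (σ.setReg d i) (.reg d) i :=
  (Den.reg (Nat.lt_succ_self d)).congr (by simp)

theorem holds_fin_eq {d : ℕ} {σ : State} {u v : XExpr} {x y : Fin n} (hu : Den d σ u x)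
    (hv : Den d σ v y) : Holds d σ (.op .eq u v) (x = y) :=
  (Holds.eq hu hv).congr Fin.ext_iff.symm

namespace Env

variable {d : ℕ} {σ : State} {u v c : XExpr} {x y : Fin n}

theorem lift (h : Env G S d σ) (i : ℕ) : Env G S (d + 1) (σ.setReg d i) := by
  have h20 := h.free
  refine ⟨?_, h.adj, fun v => ?_, by omega⟩
  · rw [State.setReg_reg, if_neg (by omega), h.reg_zero]
  · rw [State.setReg_arr, State.setReg_reg, if_neg (by omega), h.cover]

theorem den_n (h : Env G S d σ) : Den d σ (.reg 0) n :=
  (Den.reg (by have := h.free; omega)).congr h.reg_zero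

theorem all (h : Env G S d σ) {e : XExpr} {P : Fin n → Prop}
    (he : ∀ i : Fin n, Holds (d + 1) (σ.setReg d i) e (P i)) : Holds d σ (.all d e) (∀ i, P i) :=
  Holds.all h.reg_zero (by have := h.free; omega) he

theorem count (h : Env G S d σ) {e : XExpr} {P : Fin n → Prop} [DecidablePred P]
    (he : ∀ i : Fin n, Holds (d + 1) (σ.setReg d i) e (P i)) :
    Den d σ (.count d e) (univ.filter P).card :=
  Den.count h.reg_zero (by have := h.free; omega) he

theorem adjE (h : Env G S d σ) (hu : Den d σ u x) (hv : Den d σ v y) :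
    Holds d σ (adjE u v) (G.Adj x y) := fun τ hτ => by
  rw [← h.adj x y]
  exact iff_of_eq (congrArg (· ≠ 0) (((Den.op .add (.op .mul hu h.den_n) hv).load 0) τ hτ))

theorem coverE (h : Env G S d σ) (hu : Den d σ u x) : Holds d σ (coverE u) (x ∈ S) :=
  (Holds.eq (hu.load 1) (.reg (by have := h.free; omega))).congr (h.cover x)

theorem clqE (h : Env G S d σ) (hu : Den d σ u x) (hc : Den d σ c y) :
    Holds d σ (clqE u c) (x ∈ clq G S y) :=
  ((h.coverE hu).neg.conj ((holds_fin_eq hu hc).disj (h.adjE hu hc))).congr mem_clq.symm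

theorem repE (h : Env G S d σ) (hc : Den d σ c y) :
    Holds d σ (repE d c) (IsRep G S y) :=
  ((h.coverE hc).neg.conj (h.all fun i => ((Holds.lt (den_var i) (hc.lift i)).conj
    (((h.lift i).coverE (den_var i)).neg.conj
      ((h.lift i).adjE (den_var i) (hc.lift i)))).neg)).congr (by
    simp only [IsRep, not_and, Fin.lt_def])

theorem clqCardE (h : Env G S d σ) (hc : Den d σ c y) :
    Den d σ (clqCardE d c) (clq G S y).card := by
  classical
  exact (h.count fun i => (h.lift i).clqE (den_var i) (hc.lift i)).congr
    (congrArg _ (by ext; simp))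

theorem capE (h : Env G S d σ) (hc : Den d σ c y) : Den d σ (capE d c) (cap G S y) := by
  classical
  exact (Den.ite (h.repE hc) (h.clqCardE hc) (.const 0)).congr (by rw [cap])

end Env

namespace Ctx

variable {d q : ℕ} {σ : State} {st : Config n} {u v c : XExpr} {x y : Fin n}

theorem lift (h : Ctx G S r k hn d q σ st) (i : ℕ) :
    Ctx G S r k hn (d + 1) q (σ.setReg d i) st := by
  have h20 := h.free
  have hq := h.lt_free
  refine ⟨h.toEnv.lift i, ?_, ?_, ?_, h.pow, by omega, ?_⟩
  · rw [State.setReg_reg, if_neg (by omega), h.reg_one]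
  · rw [State.setReg_reg, if_neg (by omega), h.reg_two]
  · rw [State.setReg_reg, if_neg (by omega), h.reg_four]
  · rw [State.setReg_reg, if_neg (by omega), h.code]

theorem den_r (h : Ctx G S r k hn d q σ st) : Den d σ (.reg 1) r :=
  (Den.reg (by have := h.free; omega)).congr h.reg_one

theorem den_k (h : Ctx G S r k hn d q σ st) : Den d σ (.reg 2) k :=
  (Den.reg (by have := h.free; omega)).congr h.reg_two

theorem digitE (h : Ctx G S r k hn d q σ st) {i : ℕ} (hu : Den d σ u i) (hi : i < 2 * n + 4) :
    Den d σ (digitE q u) (σ.reg q / (n + 4) ^ i % (n + 4)) :=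
  (Den.op .mod (.op .div (.reg h.lt_free) (hu.load 2))
    ((Den.reg (by have := h.free; omega)).congr h.reg_four)).congr (by rw [h.pow i hi]; rfl)

theorem labE (h : Ctx G S r k hn d q σ st) (hu : Den d σ u x) :
    Den d σ (labE q u) (st.lab x) :=
  (h.digitE hu (by omega)).congr (by rw [← h.code]; rfl)

theorem cntE (h : Ctx G S r k hn d q σ st) (hu : Den d σ u x) :
    Den d σ (cntE q u) (st.cnt x) :=
  (h.digitE (Den.op .add h.den_n hu) (show n + (x : ℕ) < _ by omega)).congr
    (by rw [← h.code]; rfl)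

theorem lastE (h : Ctx G S r k hn d q σ st) (i : ℕ) : Den d σ (lastE i) (2 * n + i) :=
  .op .add (.op .mul (.const 2) h.den_n) (.const i)

theorem posE (h : Ctx G S r k hn d q σ st) : Den d σ (posE q) st.pos :=
  (Den.op .mod (h.digitE (h.lastE 0) (by omega)) h.den_n).congr (by rw [← h.code]; rfl)

theorem usedE (h : Ctx G S r k hn d q σ st) : Den d σ (GroupedDom.digitE q (GroupedDom.lastE 1)) st.used :=
  (h.digitE (h.lastE 1) (by omega)).congr (by rw [← h.code]; rfl)

theorem linkE (h : Ctx G S r k hn d q σ st) : Den d σ (GroupedDom.digitE q (GroupedDom.lastE 2)) st.link :=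
  (h.digitE (h.lastE 2) (by omega)).congr (by rw [← h.code]; rfl)

theorem unitsE (h : Ctx G S r k hn d q σ st) : Den d σ (GroupedDom.digitE q (GroupedDom.lastE 3)) st.units :=
  (h.digitE (h.lastE 3) (by omega)).congr (by rw [← h.code]; rfl)

theorem sizeE (h : Ctx G S r k hn d q σ st) (hu : Den d σ u x) :
    Den d σ (sizeE d q u) (st.size x) :=
  Den.sum h.reg_zero (by have := h.free; omega) fun i =>
    .ite (.eq (.op .add (den_var i) (.const 3)) ((h.lift i).labE (hu.lift i)))
      ((h.lift i).cntE (den_var i)) (.const 0)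

theorem touchE (h : Ctx G S r k hn d q σ st) (hu : Den d σ u x) (hv : Den d σ v y) :
    Den d σ (touchE q u v) (st.touch G S x y) := by
  classical
  exact (Den.ite ((h.coverE hv).conj ((Holds.eq (h.labE hv) (.const 0)).conj (h.adjE hv hu)))
    (.const 1) (h.labE hv)).congr (by rw [Config.touch])

theorem looseE (h : Ctx G S r k hn d q σ st) (hv : Den d σ v y) :
    Holds d σ (looseE q v) (st.Loose r y) :=
  (Holds.lt (.const 2) (h.labE hv)).conj
    ((Holds.eq (h.labE hv) (.op .add hv (.const 3))).conj
      ((Holds.eq (h.cntE hv) (.const 2)).conj (Holds.eq h.den_r (.const 3)))).neg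

theorem tidyE (h : Ctx G S r k hn d q σ st) : Holds d σ (tidyE d q) (st.Tidy r) := by
  classical
  refine (((Holds.eq h.den_r (.const 2)).disj (Holds.eq h.den_r (.const 3))).neg.disj
    (Holds.lt (h.count fun i => (h.lift i).looseE (den_var i)) (.const 4))).congr ?_
  rw [← imp_iff_not_or, Config.Tidy]

theorem isolatedE (h : Ctx G S r k hn d q σ st) (hv : Den d σ v y) :
    Holds d σ (isolatedE d q v) (st.Isolated G S y) :=
  ((h.coverE hv).neg.conj (h.all fun i => ((Holds.eq ((h.lift i).labE (den_var i)) (.const 2)).conj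
    ((h.lift i).adjE (den_var i) (hv.lift i))).neg)).congr (by
      simp only [Config.Isolated, not_and])

theorem acceptE (h : Ctx G S r k hn d q σ st) :
    Holds d σ (acceptE d q) (st.Accept G S r k) := by
  classical
  refine ((h.all fun i => Holds.lt ((h.lift i).labE (den_var i)) (.const 3)).conj
    ((h.all fun i => ((h.lift i).isolatedE (den_var i)).neg.disj
      (Holds.lt (h.lift i).den_r (.op .add ((h.lift i).clqCardE (den_var i)) (.const 1)))).conj
    ((h.all fun i => (((h.lift i).coverE (den_var i)).conj
      (Holds.eq ((h.lift i).labE (den_var i)) (.const 0))).neg.disj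
      ((h.lift i).all fun j => ((((h.lift i).lift j).isolatedE (den_var j)).conj
        (((h.lift i).lift j).adjE ((den_var i).lift j) (den_var j))).neg).neg).conj
    (Holds.lt (.op .add h.unitsE (h.count fun i => ((h.lift i).repE (den_var i)).conj
      ((h.lift i).isolatedE (den_var i)))) (.op .add h.den_k (.const 1)))))).congr ?_
  simp only [Config.Accept, Op.eval, ← imp_iff_not_or, not_forall, not_not, and_imp]

/-- The choice `m` in register `8`. -/
theorem fstE (h : Ctx G S r k hn d q σ st) {m : ℕ} (h8 : σ.reg 8 = m) :
    Den d σ fstE (⟨m / n % n, Nat.mod_lt _ hn⟩ : Fin n) :=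
  .op .mod (.op .div ((Den.reg (by have := h.free; omega)).congr h8) h.den_n) h.den_n

theorem sndE (h : Ctx G S r k hn d q σ st) {m : ℕ} (h8 : σ.reg 8 = m) :
    Den d σ sndE (⟨m % n, Nat.mod_lt _ hn⟩ : Fin n) :=
  .op .mod ((Den.reg (by have := h.free; omega)).congr h8) h.den_n

theorem kindE (h : Ctx G S r k hn d q σ st) {m : ℕ} (h8 : σ.reg 8 = m) (i : ℕ) :
    Holds d σ (.op .eq (.op .div (.reg 8) (.op .mul (.reg 0) (.reg 0))) (.const i))
      (m / (n * n) = i) :=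
  .eq (.op .div ((Den.reg (by have := h.free; omega)).congr h8) (.op .mul h.den_n h.den_n))
    (.const i)

theorem caseE (h : Ctx G S r k hn d q σ st) {m : ℕ} (h8 : σ.reg 8 = m)
    {e₀ e₁ e₂ e₃ e₄ e₅ : XExpr} {f : Move n → ℕ} (h₀ : ∀ x, Den d σ GroupedDom.fstE (x : Fin n) →
      Den d σ e₀ (f (.new x)))
    (h₁ : ∀ x y, Den d σ GroupedDom.fstE (x : Fin n) → Den d σ GroupedDom.sndE (y : Fin n) →
      Den d σ e₁ (f (.join x y)))
    (h₂ : ∀ x, Den d σ GroupedDom.fstE (x : Fin n) → Den d σ e₂ (f (.attach x)))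
    (h₃ : Den d σ e₃ (f .inner)) (h₄ : Den d σ e₄ (f .next))
    (h₅ : ∀ x, Den d σ GroupedDom.fstE (x : Fin n) → Den d σ e₅ (f (.finish x))) :
    Den d σ (caseE e₀ e₁ e₂ e₃ e₄ e₅) (f (.ofNat hn m)) := by
  refine (Den.ite (h.kindE h8 0) (h₀ _ (h.fstE h8)) <|
    .ite (h.kindE h8 1) (h₁ _ _ (h.fstE h8) (h.sndE h8)) <| .ite (h.kindE h8 2) (h₂ _ (h.fstE h8)) <|
    .ite (h.kindE h8 3) h₃ <| .ite (h.kindE h8 4) h₄ (h₅ _ (h.fstE h8))).congr ?_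
  rw [Move.ofNat]
  split_ifs <;> rfl

theorem canE (h : Ctx G S r k hn d q σ st) {m : ℕ} (h8 : σ.reg 8 = m) :
    Holds d σ (canE d q) (st.Can G S r (.ofNat hn m)) := by
  have hx := h.fstE h8
  have hy := h.sndE h8
  have h3 : ∀ {e : XExpr} {x : Fin n}, Den d σ e x →
      Holds d σ (.op .lt (.const 2) (GroupedDom.labE q e)) (3 ≤ st.lab x) :=
    fun he => Holds.lt (.const 2) (h.labE he)
  refine (Holds.ite (h.kindE h8 0) ((h.coverE hx).conj (.lt (h.labE hx) (.const 2))) <|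
    .ite (h.kindE h8 1) ((h3 hx).conj <| (h3 hy).conj <| (Holds.eq (h.labE hx) (h.labE hy)).neg.conj <|
      (Holds.lt (.op .add (h.sizeE hx) (h.sizeE hy)) (.op .add h.den_r (.const 1))).conj <|
      (h.adjE hx hy).disj ((Holds.eq h.linkE (.op .add hx (.const 1))).conj (h.adjE hy h.posE))) <|
    .ite (h.kindE h8 2) ((h3 hx).conj <| (h.adjE hx h.posE).conj <|
      (Holds.lt h.usedE (h.capE h.posE)).conj (.lt (h.sizeE hx) h.den_r)) <|
    .ite (h.kindE h8 3) (.lt (.op .add h.usedE h.den_r) (.op .add (h.capE h.posE) (.const 1))) <|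
    .ite (h.kindE h8 4) (.lt (.op .add h.posE (.const 1)) h.den_n)
      ((h3 hx).conj (.eq (h.sizeE hx) h.den_r))).congr ?_
  rw [Move.ofNat]
  split_ifs <;> rfl

theorem newLabE (h : Ctx G S r k hn d q σ st) {m : ℕ} (h8 : σ.reg 8 = m) (hv : Den d σ v y) :
    Den d σ (newLabE q v) ((st.apply G S r (.ofNat hn m)).lab y) := by
  classical
  refine h.caseE h8 (f := fun m => (st.apply G S r m).lab y) (fun x hx => ?_) (fun x z hx hz => ?_)
    (fun x hx => h.touchE h.posE hv) (h.touchE h.posE hv) (h.labE hv) (fun x hx => ?_)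
  · exact (Den.ite (holds_fin_eq hv hx) (.op .add hx (.const 3)) (h.touchE hx hv)).congr
      (by simp only [Config.apply, Op.eval])
  · exact (Den.ite (.eq (h.labE hv) (h.labE hz)) (h.labE hx) (h.labE hv)).congr
      (by simp only [Config.apply])
  · exact (Den.ite (.eq (h.labE hv) (h.labE hx)) (.const 2) (h.labE hv)).congr
      (by simp only [Config.apply])

theorem newCntE (h : Ctx G S r k hn d q σ st) {m : ℕ} (h8 : σ.reg 8 = m) (hv : Den d σ v y) :
    Den d σ (newCntE d q v) ((st.apply G S r (.ofNat hn m)).cnt y) := by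
  classical
  have h3 : ∀ {e : XExpr} {x : Fin n}, Den d σ e x →
      Holds d σ (.op .eq (.op .add v (.const 3)) (GroupedDom.labE q e)) ((y : ℕ) + 3 = st.lab x) :=
    fun he => Holds.eq (.op .add hv (.const 3)) (h.labE he)
  refine h.caseE h8 (f := fun m => (st.apply G S r m).cnt y) (fun x hx => ?_) (fun x z hx hz => ?_)
    (fun x hx => ?_) (h.cntE hv) (h.cntE hv) (fun x hx => ?_)
  · exact (Den.ite (holds_fin_eq hv hx) (.const 1) (h.cntE hv)).congr (by simp only [Config.apply])
  · exact (Den.ite (h3 hx) (.op .add (h.cntE hv) (h.sizeE hz))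
      (.ite (h3 hz) (.const 0) (h.cntE hv))).congr (by simp only [Config.apply, Op.eval])
  · exact (Den.ite (h3 hx) (.op .add (h.cntE hv) (.const 1)) (h.cntE hv)).congr
      (by simp only [Config.apply, Op.eval])
  · exact (Den.ite (h3 hx) (.const 0) (h.cntE hv)).congr (by simp only [Config.apply])

theorem newPosE (h : Ctx G S r k hn d q σ st) {m : ℕ} (h8 : σ.reg 8 = m) :
    Den d σ (newPosE q) (st.apply G S r (.ofNat hn m)).pos := by
  refine h.caseE h8 (f := fun m => ((st.apply G S r m).pos : ℕ)) (fun _ _ => h.posE)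
    (fun _ _ _ _ => h.posE) (fun _ _ => h.posE) h.posE ?_ (fun _ _ => h.posE)
  refine (Den.ite (.lt (.op .add h.posE (.const 1)) h.den_n) (.op .add h.posE (.const 1))
    h.posE).congr ?_
  by_cases hc : (st.pos : ℕ) + 1 < n <;> simp [Config.apply, Op.eval, hc]

theorem newUsedE (h : Ctx G S r k hn d q σ st) {m : ℕ} (h8 : σ.reg 8 = m) :
    Den d σ (newUsedE q) (st.apply G S r (.ofNat hn m)).used :=
  h.caseE h8 (f := fun m => (st.apply G S r m).used) (fun _ _ => h.usedE)
    (fun _ _ _ _ => h.usedE) (fun _ _ => .op .add h.usedE (.const 1)) (.op .add h.usedE h.den_r)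
    (.const 0) (fun _ _ => h.usedE)

theorem newLinkE (h : Ctx G S r k hn d q σ st) {m : ℕ} (h8 : σ.reg 8 = m) :
    Den d σ (newLinkE q) (st.apply G S r (.ofNat hn m)).link :=
  h.caseE h8 (f := fun m => (st.apply G S r m).link) (fun _ _ => .const 0)
    (fun _ _ _ _ => h.linkE) (fun _ hx => .op .add hx (.const 1)) (.const 0)
    (.const 0) (fun _ _ => .const 0)

theorem newUnitsE (h : Ctx G S r k hn d q σ st) {m : ℕ} (h8 : σ.reg 8 = m) :
    Den d σ (newUnitsE q) (st.apply G S r (.ofNat hn m)).units :=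
  h.caseE h8 (f := fun m => (st.apply G S r m).units) (fun _ _ => h.unitsE)
    (fun _ _ _ _ => h.unitsE) (fun _ _ => h.unitsE) (.op .add h.unitsE (.const 1))
    h.unitsE (fun _ _ => .op .add h.unitsE (.const 1))

theorem load_pow (h : Ctx G S r k hn d q σ st) {i : ℕ} (hu : Den d σ u i) (hi : i < 2 * n + 4) :
    Den d σ (.load 2 u) ((n + 4) ^ i) :=
  (hu.load 2).congr (h.pow i hi)

theorem nextE (h : Ctx G S r k hn d 9 σ st) {m : ℕ} (h8 : σ.reg 8 = m) :
    Den d σ (nextE d) (nextCode G S r hn (σ.reg 9) m) := by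
  classical
  have h13 := h.free
  have h8' : ∀ i, (σ.setReg d i).reg 8 = m := fun i => by
    rw [State.setReg_reg, if_neg (by omega), h8]
  refine (Den.ite (h.canE h8) (.op .add (Den.sum h.reg_zero (by omega) fun i =>
      .op .add (.op .mul ((h.lift i).newLabE (h8' i) (den_var i))
        ((h.lift i).load_pow (den_var i) (by omega)))
      (.op .mul ((h.lift i).newCntE (h8' i) (den_var i))
        ((h.lift i).load_pow (.op .add (h.lift i).den_n (den_var i))
          (show n + (i : ℕ) < _ by omega))))
    (.op .add (.op .mul (h.newPosE h8) (h.load_pow (h.lastE 0) (by omega)))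
      (.op .add (.op .mul (h.newUsedE h8) (h.load_pow (h.lastE 1) (by omega)))
        (.op .add (.op .mul (h.newLinkE h8) (h.load_pow (h.lastE 2) (by omega)))
          (.op .mul (h.newUnitsE h8) (h.load_pow (h.lastE 3) (by omega)))))))
    (.reg h.lt_free)).congr ?_
  rw [nextCode, h.code]
  refine if_congr Iff.rfl ?_ rfl
  rw [Config.code_eq]
  rfl

end Ctx

theorem ok64_nextE : (nextE 20).ok64 := by decide
theorem ok64_tidyE : (tidyE 20 10).ok64 := by decide
theorem ok64_acceptE : (acceptE 20 9).ok64 := by decide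

end Expressions

/-! ### Guessing a twin cover -/

section Guess

variable {n : ℕ} {G : SimpleGraph (Fin n)} {S : Finset (Fin n)} {hn : 0 < n}

/-- The edge `{u, v}` shows that `A` is not a twin cover. -/
def IsBad (G : SimpleGraph (Fin n)) (A : Finset (Fin n)) (u v : Fin n) : Prop :=
  G.Adj u v ∧ ¬ AreTwins G u v ∧ u ∉ A ∧ v ∉ A

theorem isTwinCover_iff {A : Finset (Fin n)} : IsTwinCover G A ↔ ∀ u v, ¬ IsBad G A u v := by
  simp only [IsTwinCover, IsBad]
  exact forall₂_congr fun u v => by tauto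

/-- A stage of the construction of a twin cover: the vertices chosen so far, the remaining guesses,
which are the binary digits below the leading one, and a flag, which is set if there were too few
guesses. -/
structure Guess (n : ℕ) where
  chosen : Finset (Fin n)
  code : ℕ
  fail : ℕ

/-- The first vertex of a pair. -/
def pairFst (hn : 0 < n) (e : ℕ) : Fin n := ⟨e / n % n, Nat.mod_lt _ hn⟩

/-- The second vertex of a pair. -/
def pairSnd (hn : 0 < n) (e : ℕ) : Fin n := ⟨e % n, Nat.mod_lt _ hn⟩

open Classical in
/-- If the pair with number `e` is bad, then the next guess tells which of the two vertices is
chosen. -/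
noncomputable def Guess.step (G : SimpleGraph (Fin n)) (hn : 0 < n) (e : ℕ) (p : Guess n) :
    Guess n :=
  if IsBad G p.chosen (pairFst hn e) (pairSnd hn e) then
    if p.code < 2 then { p with code := p.code / 2, fail := 1 }
    else { p with
      chosen := insert (if p.code % 2 = 1 then pairFst hn e else pairSnd hn e) p.chosen
      code := p.code / 2 }
  else p

/-- The treatment of the pairs `e, e + 1, …, e + j - 1`. -/
noncomputable def Guess.run (G : SimpleGraph (Fin n)) (hn : 0 < n) : ℕ → ℕ → Guess n → Guess n
  | _, 0, p => p
  | e, j + 1, p => run G hn (e + 1) j (p.step G hn e)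

theorem IsBad.mono {A A' : Finset (Fin n)} (hA : A ⊆ A') {u v : Fin n} (h : IsBad G A' u v) :
    IsBad G A u v :=
  ⟨h.1, h.2.1, fun hu => h.2.2.1 (hA hu), fun hv => h.2.2.2 (hA hv)⟩

theorem Guess.run_fail (e j : ℕ) (p : Guess n) (hp : p.fail ≠ 0) : (p.run G hn e j).fail ≠ 0 := by
  induction j generalizing e p with
  | zero => exact hp
  | succ j ih =>
    refine ih _ _ ?_
    rw [Guess.step]
    split_ifs <;> first | exact one_ne_zero | exact hp

/-- If the guesses suffice, then no bad pair is left, and each chosen vertex has halved the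
code. -/
theorem Guess.run_sound (e j : ℕ) (p : Guess n) (hp : 1 ≤ p.code)
    (h : (p.run G hn e j).fail = 0) :
    p.chosen ⊆ (p.run G hn e j).chosen ∧
      (∀ e', e ≤ e' → e' < e + j →
        ¬ IsBad G (p.run G hn e j).chosen (pairFst hn e') (pairSnd hn e')) ∧
      2 ^ (p.run G hn e j).chosen.card * (p.run G hn e j).code ≤ 2 ^ p.chosen.card * p.code ∧
      1 ≤ (p.run G hn e j).code := by
  classical
  induction j generalizing e p with
  | zero => exact ⟨subset_rfl, fun e' h1 h2 => by omega, le_rfl, hp⟩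
  | succ j ih =>
    simp only [Guess.run] at h ⊢
    have hstep : 1 ≤ (p.step G hn e).code ∧ p.chosen ⊆ (p.step G hn e).chosen ∧
        ¬ IsBad G (p.step G hn e).chosen (pairFst hn e) (pairSnd hn e) ∧
        2 ^ (p.step G hn e).chosen.card * (p.step G hn e).code ≤ 2 ^ p.chosen.card * p.code := by
      by_cases hb : IsBad G p.chosen (pairFst hn e) (pairSnd hn e)
      · by_cases hc : p.code < 2
        · refine absurd h (Guess.run_fail _ _ _ ?_)
          rw [Guess.step, if_pos hb, if_pos hc]
          exact one_ne_zero
        · rw [Guess.step, if_pos hb, if_neg hc]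
          refine ⟨by simp only; omega, Finset.subset_insert _ _, fun hb' => ?_, ?_⟩
          · by_cases h1 : p.code % 2 = 1
            · exact hb'.2.2.1 (by simp [h1])
            · exact hb'.2.2.2 (by simp [h1])
          · have hle := Finset.card_insert_le
              (if p.code % 2 = 1 then pairFst hn e else pairSnd hn e) p.chosen
            calc _ ≤ 2 ^ (p.chosen.card + 1) * (p.code / 2) :=
                  Nat.mul_le_mul_right _ (Nat.pow_le_pow_right (by norm_num) hle)
              _ = 2 ^ p.chosen.card * (2 * (p.code / 2)) := by ring
              _ ≤ _ := Nat.mul_le_mul_left _ (Nat.mul_div_le _ _)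
      · rw [Guess.step, if_neg hb]
        exact ⟨hp, subset_rfl, hb, le_rfl⟩
    obtain ⟨s1, s2, s3, s4⟩ := hstep
    obtain ⟨i1, i2, i3, i4⟩ := ih _ _ s1 h
    refine ⟨s2.trans i1, fun e' h1 h2 => ?_, i3.trans s4, i4⟩
    rcases h1.lt_or_eq with h1 | rfl
    · exact i2 e' h1 (by omega)
    · exact fun hb => s3 (hb.mono i1)

/-- The guesses can be made such that all chosen vertices belong to the twin cover `S`. -/
theorem Guess.exists_run (hS : IsTwinCover G S) (e j : ℕ) (A : Finset (Fin n)) (hA : A ⊆ S) :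
    ∃ q, 1 ≤ q ∧ q < 2 ^ ((S \ A).card + 1) ∧ ((⟨A, q, 0⟩ : Guess n).run G hn e j).fail = 0 := by
  classical
  induction j generalizing e A with
  | zero => exact ⟨1, le_rfl, Nat.one_lt_two_pow (by omega), rfl⟩
  | succ j ih =>
    by_cases hb : IsBad G A (pairFst hn e) (pairSnd hn e)
    · have key : ∀ x ∈ S, x ∉ A → ∃ q, 1 ≤ q ∧ 2 * q + 1 < 2 ^ ((S \ A).card + 1) ∧
          ((⟨insert x A, q, 0⟩ : Guess n).run G hn (e + 1) j).fail = 0 := by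
        intro x hx hxA
        obtain ⟨q, h1, h2, h3⟩ := ih (e + 1) (insert x A) (Finset.insert_subset hx hA)
        refine ⟨q, h1, ?_, h3⟩
        have hc : (S \ insert x A).card + 1 = (S \ A).card := by
          rw [← Finset.card_insert_of_notMem (a := x) (by simp)]
          congr 1
          ext v
          by_cases hv : v = x <;> simp [hv, hx, hxA]
        rw [hc] at h2
        rw [pow_succ]
        omega
      -- a last digit `1` chooses the first vertex, a last digit `0` the second one
      by_cases hu : pairFst hn e ∈ S
      · obtain ⟨q, h1, h2, h3⟩ := key _ hu hb.2.2.1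
        refine ⟨2 * q + 1, by omega, h2, ?_⟩
        rw [Guess.run, Guess.step, if_pos hb, if_neg (by simp only; omega)]
        simpa [Nat.add_mod, show (2 * q + 1) / 2 = q by omega] using h3
      · have hv : pairSnd hn e ∈ S := by
          by_contra hv
          exact isTwinCover_iff.1 hS _ _ ⟨hb.1, hb.2.1, hu, hv⟩
        obtain ⟨q, h1, h2, h3⟩ := key _ hv hb.2.2.2
        refine ⟨2 * q, by omega, by omega, ?_⟩
        rw [Guess.run, Guess.step, if_pos hb, if_neg (by simp only; omega)]
        simpa using h3
    · obtain ⟨q, h1, h2, h3⟩ := ih (e + 1) A hA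
      refine ⟨q, h1, h2, ?_⟩
      rwa [Guess.run, Guess.step, if_neg hb]

/-- The result of all guesses that are encoded by `m`. -/
noncomputable def Guess.result (G : SimpleGraph (Fin n)) (hn : 0 < n) (m : ℕ) : Guess n :=
  (⟨∅, m, 0⟩ : Guess n).run G hn 0 (n * n)

theorem Guess.result_sound {m : ℕ} (hm : 1 ≤ m) (h : (result G hn m).fail = 0) :
    IsTwinCover G (result G hn m).chosen ∧ 2 ^ (result G hn m).chosen.card ≤ m := by
  obtain ⟨-, h2, h3, h4⟩ := Guess.run_sound 0 (n * n) ⟨∅, m, 0⟩ hm h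
  refine ⟨isTwinCover_iff.2 fun u v => ?_, ?_⟩
  · have hlt : (u : ℕ) * n + v < n * n := by
      have : ((u : ℕ) + 1) * n ≤ n * n := Nat.mul_le_mul_right _ u.2
      have := v.2
      linarith [add_mul (u : ℕ) 1 n, one_mul n]
    have := h2 (u * n + v) (Nat.zero_le _) (by omega)
    have e1 : pairFst hn (u * n + v) = u := Fin.ext (by
      simp only [pairFst]
      rw [add_comm, Nat.add_mul_div_right _ _ hn, Nat.div_eq_of_lt v.2, zero_add,
        Nat.mod_eq_of_lt u.2])
    have e2 : pairSnd hn (u * n + v) = v := Fin.ext (by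
      simp only [pairSnd]
      rw [Nat.mul_add_mod_of_lt v.2])
    rwa [e1, e2] at this
  · simp only [Finset.card_empty, pow_zero, one_mul] at h3
    exact (Nat.le_mul_of_pos_right _ h4).trans h3

theorem Guess.exists_result (G : SimpleGraph (Fin n)) (hn : 0 < n) :
    ∃ m, 1 ≤ m ∧ m < 2 ^ (twinCoverNumber G + 1) ∧ (result G hn m).fail = 0 := by
  obtain ⟨S, hS, hc⟩ := exists_twinCover_card_eq G
  obtain ⟨q, h1, h2, h3⟩ := Guess.exists_run (hn := hn) hS 0 (n * n) ∅ (Finset.empty_subset S)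
  rw [Finset.sdiff_empty, hc] at h2
  exact ⟨q, h1, h2, h3⟩

open XExpr

/-- Being true twins. -/
def twinsE (d : ℕ) (u v : XExpr) : XExpr :=
  .all d (.op .eq (.ite ((XExpr.op .eq (.reg d) u).disj (adjE (.reg d) u)) (.const 1) (.const 0))
    (.ite ((XExpr.op .eq (.reg d) v).disj (adjE (.reg d) v)) (.const 1) (.const 0)))

/-- Badness of a pair. -/
def badE (d : ℕ) (u v : XExpr) : XExpr :=
  (adjE u v).conj ((twinsE d u v).neg.conj ((coverE u).neg.conj (coverE v).neg))

theorem Env.twinsE {d : ℕ} {σ : State} {u v : XExpr} {x y : Fin n} (h : Env G S d σ)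
    (hu : Den d σ u x) (hv : Den d σ v y) : Holds d σ (twinsE d u v) (AreTwins G x y) := by
  classical
  have key : ∀ {e : XExpr} {z : Fin n}, Den d σ e z → ∀ i : Fin n, Den (d + 1) (σ.setReg d i)
      (.ite ((XExpr.op .eq (.reg d) e).disj (GroupedDom.adjE (.reg d) e)) (.const 1) (.const 0))
      (if i ∈ closedNeighborSet G z then 1 else 0) := fun {e z} he i =>
    (Den.ite ((holds_fin_eq (den_var i) (he.lift i)).disj ((h.lift i).adjE (den_var i) (he.lift i)))
      (.const 1) (.const 0)).congr
      (if_congr (by simp [closedNeighborSet, G.adj_comm]) rfl rfl)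
  refine (h.all fun i => Holds.eq (key hu i) (key hv i)).congr ?_
  rw [AreTwins, Set.ext_iff]
  refine forall_congr' fun i => ?_
  by_cases h1 : i ∈ closedNeighborSet G x <;> by_cases h2 : i ∈ closedNeighborSet G y <;>
    simp [h1, h2]

theorem Env.badE {d : ℕ} {σ : State} {u v : XExpr} {x y : Fin n} (h : Env G S d σ)
    (hu : Den d σ u x) (hv : Den d σ v y) : Holds d σ (badE d u v) (IsBad G S x y) :=
  (h.adjE hu hv).conj ((h.twinsE hu hv).neg.conj ((h.coverE hu).neg.conj (h.coverE hv).neg))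

/-- The vertex to be chosen from the pair in register `17` if the next guess is in register
`15`. -/
def guessedE : XExpr :=
  .ite (.op .mod (.reg 15) (.const 2)) (.op .mod (.op .div (.reg 17) (.reg 0)) (.reg 0))
    (.op .mod (.reg 17) (.reg 0))

/-- The badness of the pair in register `17`. -/
def currentBadE : XExpr :=
  .ite (badE 20 (.op .mod (.op .div (.reg 17) (.reg 0)) (.reg 0)) (.op .mod (.reg 17) (.reg 0)))
    (.const 1) (.const 0)

/-- The new mark of the guessed vertex. -/
def newMarkE : XExpr :=
  .ite ((XExpr.reg 19).conj (.op .lt (.const 1) (.reg 15))) (.reg 3) (.load 1 guessedE)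

/-- The new flag for a lack of guesses. -/
def newFailE : XExpr :=
  .ite ((XExpr.reg 19).conj (.op .lt (.reg 15) (.const 2))) (.const 1) (.reg 14)

/-- The remaining guesses. -/
def newGuessE : XExpr := .ite (.reg 19) (.op .div (.reg 15) (.const 2)) (.reg 15)

/-- The treatment of one pair. -/
def guessBody : Prog :=
  .seq (.set 19 currentBadE) <|
  .seq (.put 1 guessedE newMarkE) <|
  .seq (.set 14 newFailE) <|
  .seq (.set 15 newGuessE) <|
  .set 17 (.op .add (.reg 17) (.const 1))

/-- The time for one pair. -/
def guessBodyCost (w : ℕ) : ℕ :=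
  setCost currentBadE w + (putCost guessedE newMarkE w + (setCost newFailE w +
    (setCost newGuessE w + setCost (.op .add (.reg 17) (.const 1)) w)))

theorem polyBdd_guessBodyCost : PolyBdd guessBodyCost :=
  (polyBdd_setCost _).add ((polyBdd_putCost _ _).add ((polyBdd_setCost _).add
    ((polyBdd_setCost _).add (polyBdd_setCost _))))

/-- The memory represents the stage `p`, where `m` encodes the guesses and `e` is the number of the
next pair. The entry of a chosen vertex in array `1` is `m`; smaller entries stem from smaller
values of `m`. -/
structure GuessInv (σ₀ : State) (w m : ℕ) (p : Guess n) (e : ℕ) (σ : State) : Prop where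
  reg : ∀ x < 3, σ.reg x = σ₀.reg x
  arr : ∀ a ≠ 1, σ.arr a = σ₀.arr a
  bdd : σ.Bdd w
  reg_three : σ.reg 3 = m
  reg_zero : σ.reg 13 = 0
  fail : σ.reg 14 = p.fail
  code : σ.reg 15 = p.code
  pair : σ.reg 17 = e
  num : σ.reg 18 = n * n
  le : ∀ i, σ.arr 1 i ≤ m
  chosen : ∀ v : Fin n, σ.arr 1 v = m ↔ v ∈ p.chosen

theorem exec_guessBody {σ₀ σ : State} {w m e : ℕ} {p : Guess n} (h0 : σ₀.reg 0 = n)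
    (hadj : ∀ u v : Fin n, σ₀.arr 0 (u * n + v) ≠ 0 ↔ G.Adj u v) (hw : 1 ≤ w)
    (hnw : (n * n).size ≤ w) (h : GuessInv σ₀ w m p e σ) (he : e < n * n) :
    ∃ σ', Exec guessBody (guessBodyCost w) σ σ' ∧
      GuessInv σ₀ w m (p.step G hn e) (e + 1) σ' := by
  classical
  have hone : Nat.size 1 ≤ w := by simpa using hw
  have r0 : σ.reg 0 = n := (h.reg 0 (by norm_num)).trans h0
  set bad : Prop := IsBad G p.chosen (pairFst hn e) (pairSnd hn e) with hbad
  set b : ℕ := if bad then 1 else 0 with hb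
  set x : Fin n := if p.code % 2 = 1 then pairFst hn e else pairSnd hn e with hx
  have henv : Env G p.chosen 20 σ :=
    ⟨r0, fun u v => by rw [h.arr 0 (by norm_num)]; exact hadj u v,
      fun v => by rw [h.reg_three]; exact h.chosen v, le_rfl⟩
  have e17 : Den 20 σ (.reg 17) e := (Den.reg (by norm_num)).congr h.pair
  have e1 : currentBadE.eval σ = b := (Den.ite (henv.badE (x := pairFst hn e) (y := pairSnd hn e)
    (.op .mod (.op .div e17 henv.den_n) henv.den_n) (.op .mod e17 henv.den_n))
    (.const 1) (.const 0)).eval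
  set σ₁ := σ.setReg 19 b with hσ₁
  have x1 : Exec (.set 19 currentBadE) (setCost currentBadE w) σ σ₁ :=
    Exec.set (by decide) h.bdd e1
  have b1 : σ₁.Bdd w := h.bdd.setReg (by norm_num) (by
    rw [hb]; split_ifs; exacts [hone, by simp])
  have hguess : guessedE.eval σ₁ = (x : ℕ) := by
    simp only [guessedE, XExpr.eval, Op.eval, hσ₁, State.setReg_reg, h.code, h.pair, r0, hx]
    by_cases h1 : p.code % 2 = 1 <;> simp [h1, pairFst, pairSnd]
  have e2 : newMarkE.eval σ₁ = if bad ∧ ¬ p.code < 2 then m else σ.arr 1 x := by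
    simp only [newMarkE, XExpr.conj, XExpr.eval, Op.eval, hguess]
    by_cases h1 : bad <;> by_cases h2 : p.code < 2 <;>
      simp [hσ₁, hb, h1, h2, h.code, h.reg_three, show (1 < p.code) = ¬ p.code < 2 by
        simp [Nat.lt_iff_add_one_le]]
  set mk := if bad ∧ ¬ p.code < 2 then m else σ.arr 1 x with hmk
  set σ₂ := σ₁.setArr 1 x mk with hσ₂
  have x2 : Exec (.put 1 guessedE newMarkE) (putCost guessedE newMarkE w) σ₁ σ₂ :=
    Exec.put (by decide) (by decide) b1 hguess e2
  have hmw : m.size ≤ w := h.reg_three ▸ h.bdd.reg 3 (by norm_num)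
  have b2 : σ₂.Bdd w := b1.setArr (by rw [hmk]; split_ifs; exacts [hmw, h.bdd.arr _ _])
  have e3 : newFailE.eval σ₂ = if bad ∧ p.code < 2 then 1 else p.fail := by
    simp only [newFailE, XExpr.conj, XExpr.eval, Op.eval]
    by_cases h1 : bad <;> by_cases h2 : p.code < 2 <;>
      simp [hσ₂, hσ₁, hb, h1, h2, h.code, h.fail]
  set f := if bad ∧ p.code < 2 then 1 else p.fail with hf
  set σ₃ := σ₂.setReg 14 f with hσ₃
  have x3 : Exec (.set 14 newFailE) (setCost newFailE w) σ₂ σ₃ := Exec.set (by decide) b2 e3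
  have b3 : σ₃.Bdd w := b2.setReg (by norm_num) (by
    rw [hf]; split_ifs; exacts [hone, h.fail ▸ h.bdd.reg 14 (by norm_num)])
  have e4 : newGuessE.eval σ₃ = if bad then p.code / 2 else p.code := by
    simp only [newGuessE, XExpr.eval, Op.eval]
    by_cases h1 : bad <;> simp [hσ₃, hσ₂, hσ₁, hb, h1, h.code]
  set q := if bad then p.code / 2 else p.code with hq
  set σ₄ := σ₃.setReg 15 q with hσ₄
  have x4 : Exec (.set 15 newGuessE) (setCost newGuessE w) σ₃ σ₄ := Exec.set (by decide) b3 e4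
  have hcw : p.code.size ≤ w := h.code ▸ h.bdd.reg 15 (by norm_num)
  have b4 : σ₄.Bdd w := b3.setReg (by norm_num) (by
    rw [hq]; split_ifs; exacts [(Nat.size_le_size (Nat.div_le_self _ _)).trans hcw, hcw])
  set σ₅ := σ₄.setReg 17 (e + 1) with hσ₅
  have x5 : Exec (.set 17 (.op .add (.reg 17) (.const 1)))
      (setCost (.op .add (.reg 17) (.const 1)) w) σ₄ σ₅ :=
    Exec.set (by decide) b4 (by
      simp [XExpr.eval, Op.eval, hσ₄, hσ₃, hσ₂, hσ₁, h.pair])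
  have b5 : σ₅.Bdd w := b4.setReg (by norm_num) ((Nat.size_le_size (by omega)).trans hnw)
  have hstep : p.step G hn e = ⟨if bad ∧ ¬ p.code < 2 then insert x p.chosen else p.chosen, q, f⟩ := by
    rw [Guess.step]
    by_cases h1 : bad <;> by_cases h2 : p.code < 2 <;> simp [← hbad, h1, h2, hq, hf, hx]
  have harr1 : ∀ i, σ₅.arr 1 i = if i = x then mk else σ.arr 1 i := fun i => by
    simp [hσ₅, hσ₄, hσ₃, hσ₂, hσ₁]
  refine ⟨σ₅, x1.seq (x2.seq (x3.seq (x4.seq x5))), ⟨fun y hy => ?_, fun a ha => ?_, b5,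
    ?_, ?_, ?_, ?_, ?_, ?_, fun i => ?_, fun v => ?_⟩⟩
  · rw [← h.reg y hy]
    simp [hσ₅, hσ₄, hσ₃, hσ₂, hσ₁, show y ≠ 17 by omega, show y ≠ 15 by omega,
      show y ≠ 14 by omega, show y ≠ 19 by omega]
  · rw [← h.arr a ha]
    ext i
    simp [hσ₅, hσ₄, hσ₃, hσ₂, hσ₁, ha]
  · simp [hσ₅, hσ₄, hσ₃, hσ₂, hσ₁, h.reg_three]
  · simp [hσ₅, hσ₄, hσ₃, hσ₂, hσ₁, h.reg_zero]
  · simp [hσ₅, hσ₄, hσ₃, hstep]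
  · simp [hσ₅, hσ₄, hstep]
  · simp [hσ₅]
  · simp [hσ₅, hσ₄, hσ₃, hσ₂, hσ₁, h.num]
  · rw [harr1, hmk]
    split_ifs
    exacts [le_rfl, h.le _, h.le _]
  · rw [harr1, hstep, hmk]
    by_cases h1 : bad ∧ ¬ p.code < 2
    · by_cases h2 : v = x
      · simp [h1, h2]
      · simp [h1, h2, Fin.ext_iff.not.1 h2, h.chosen]
    · rw [if_neg h1, if_neg h1]
      by_cases h2 : v = x
      · simp [h2, h.chosen]
      · simp [Fin.ext_iff.not.1 h2, h.chosen]

/-- The construction for the next value `m` in register `3`. -/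
def guessLoop : Prog :=
  .seq (.set 3 (.op .add (.reg 3) (.const 1))) <|
  .seq (.set 15 (.reg 3)) <|
  .seq (.set 14 (.const 0)) <|
  .seq (.set 17 (.const 0)) <|
  .whileLt 17 18 guessBody

/-- The construction of a twin cover, with `m = 1, 2, 3, …` until the guesses are right. -/
def coverProg : Prog :=
  .seq (.set 18 (.op .mul (.reg 0) (.reg 0))) <|
  .seq (.set 14 (.const 1)) <|
  .whileLt 13 14 guessLoop

/-- The time for one value of `m`, where `w` bounds the number of pairs. -/
def guessLoopCost (w : ℕ) : ℕ :=
  setCost (.op .add (.reg 3) (.const 1)) w + (setCost (.reg 3) w + (setCost (.const 0) w +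
    (setCost (.const 0) w + (w + 1) * (testCost w + guessBodyCost w))))

theorem polyBdd_guessLoopCost : PolyBdd guessLoopCost :=
  (polyBdd_setCost _).add ((polyBdd_setCost _).add ((polyBdd_setCost _).add
    ((polyBdd_setCost _).add ((PolyBdd.id.add (.const 1)).mul
      (polyBdd_testCost.add polyBdd_guessBodyCost)))))

theorem exec_guessLoop {σ₀ σ : State} {w m e : ℕ} {p : Guess n} (h0 : σ₀.reg 0 = n)
    (hadj : ∀ u v : Fin n, σ₀.arr 0 (u * n + v) ≠ 0 ↔ G.Adj u v) (hw : 1 ≤ w)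
    (hnw : n * n ≤ w) (hmw : (m + 1).size ≤ w) (h : GuessInv σ₀ w m p e σ) :
    ∃ σ', Exec guessLoop (guessLoopCost w) σ σ' ∧
      GuessInv σ₀ w (m + 1) (Guess.result G hn (m + 1)) (n * n) σ' := by
  set σ₁ := σ.setReg 3 (m + 1) with hσ₁
  have x1 : Exec (.set 3 (.op .add (.reg 3) (.const 1)))
      (setCost (.op .add (.reg 3) (.const 1)) w) σ σ₁ :=
    Exec.set (by decide) h.bdd (by simp [XExpr.eval, Op.eval, h.reg_three])
  have b1 : σ₁.Bdd w := h.bdd.setReg (by norm_num) hmw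
  set σ₂ := σ₁.setReg 15 (m + 1) with hσ₂
  have x2 : Exec (.set 15 (.reg 3)) (setCost (.reg 3) w) σ₁ σ₂ :=
    Exec.set (by decide) b1 (by simp [XExpr.eval, hσ₁])
  have b2 : σ₂.Bdd w := b1.setReg (by norm_num) hmw
  set σ₃ := σ₂.setReg 14 0 with hσ₃
  have x3 : Exec (.set 14 (.const 0)) (setCost (.const 0) w) σ₂ σ₃ :=
    Exec.set (by decide) b2 rfl
  have b3 : σ₃.Bdd w := b2.setReg (by norm_num) (by simp)
  set σ₄ := σ₃.setReg 17 0 with hσ₄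
  have x4 : Exec (.set 17 (.const 0)) (setCost (.const 0) w) σ₃ σ₄ :=
    Exec.set (by decide) b3 rfl
  have b4 : σ₄.Bdd w := b3.setReg (by norm_num) (by simp)
  -- the remaining run from the current stage gives the result of the full run
  let I : State → Prop := fun τ => ∃ (p : Guess n) (e : ℕ), e ≤ n * n ∧
    GuessInv σ₀ w (m + 1) p e τ ∧ p.run G hn e (n * n - e) = Guess.result G hn (m + 1)
  have hI : I σ₄ := by
    refine ⟨⟨∅, m + 1, 0⟩, 0, Nat.zero_le _, ⟨fun y hy => ?_, fun a ha => ?_, b4, ?_, ?_, ?_, ?_,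
      ?_, ?_, fun i => (h.le i).trans (Nat.le_succ m), fun v => ?_⟩, rfl⟩
    · rw [← h.reg y hy]
      simp [hσ₄, hσ₃, hσ₂, hσ₁, show y ≠ 17 by omega, show y ≠ 15 by omega,
        show y ≠ 14 by omega, show y ≠ 3 by omega]
    · exact h.arr a ha
    · simp [hσ₄, hσ₃, hσ₂, hσ₁]
    · simp [hσ₄, hσ₃, hσ₂, hσ₁, h.reg_zero]
    · simp [hσ₄, hσ₃]
    · simp [hσ₄, hσ₃, hσ₂]
    · simp [hσ₄]
    · simp [hσ₄, hσ₃, hσ₂, hσ₁, h.num]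
    · have := h.le v
      simp only [hσ₄, hσ₃, hσ₂, hσ₁, State.setReg_arr, Finset.notMem_empty, iff_false]
      omega
  obtain ⟨σ', x5, ⟨p', e', he', hinv, hrun⟩, hend⟩ := Exec.whileLt (x := 17) (y := 18)
    (P := guessBody) (w := w) (T := guessBodyCost w) (by norm_num) (by norm_num) I
    (fun τ => n * n - τ.reg 17) (fun τ ⟨_, _, _, hτ, _⟩ => hτ.bdd)
    (fun τ ⟨p, e, he, hτ, hrun⟩ hlt => by
      rw [hτ.pair, hτ.num] at hlt
      obtain ⟨τ', hx, hτ'⟩ := exec_guessBody (hn := hn) h0 hadj hw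
        ((Nat.size_le_size hnw).trans (size_le_self w)) hτ hlt
      refine ⟨τ', hx, ⟨_, e + 1, hlt, hτ', ?_⟩, by rw [hτ'.pair, hτ.pair]; omega⟩
      rw [← hrun, show n * n - e = n * n - (e + 1) + 1 by omega]
      rfl) hI
  rw [hinv.num, hinv.pair] at hend
  obtain rfl : e' = n * n := le_antisymm he' hend
  rw [Nat.sub_self] at hrun
  rw [← hrun]
  refine ⟨σ', (x1.seq (x2.seq (x3.seq (x4.seq (x5.mono ?_))))), hinv⟩
  exact Nat.mul_le_mul_right _ (by omega)

/-- The time for the construction of a twin cover, per value of `m`. -/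
def coverCost (w : ℕ) : ℕ :=
  setCost (.op .mul (.reg 0) (.reg 0)) w + (setCost (.const 1) w + (testCost w + guessLoopCost w))

theorem polyBdd_coverCost : PolyBdd coverCost :=
  (polyBdd_setCost _).add ((polyBdd_setCost _).add (polyBdd_testCost.add polyBdd_guessLoopCost))

/-- A minimum twin cover is found for some `m < 2 ^ (τ + 1)`: right guesses follow a minimum twin
cover, so that there are at most `τ` of them. -/
theorem exec_coverProg {σ₀ : State} {w : ℕ} (hn : 0 < n) (h0 : σ₀.reg 0 = n)
    (hadj : ∀ u v : Fin n, σ₀.arr 0 (u * n + v) ≠ 0 ↔ G.Adj u v)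
    (hw : 1 ≤ w) (hnw : n * n ≤ w) (hτw : twinCoverNumber G + 1 ≤ w) (hb : σ₀.Bdd w)
    (h3 : σ₀.reg 3 = 0) (h13 : σ₀.reg 13 = 0) (h15 : σ₀.reg 15 = 0) (h17 : σ₀.reg 17 = 0)
    (h1 : ∀ i, σ₀.arr 1 i = 0) :
    ∃ (σ : State) (S : Finset (Fin n)),
      Exec coverProg (2 ^ (twinCoverNumber G + 1) * coverCost w) σ₀ σ ∧
      IsTwinCover G S ∧ S.card ≤ twinCoverNumber G ∧ (∀ x < 3, σ.reg x = σ₀.reg x) ∧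
      (∀ a ≠ 1, σ.arr a = σ₀.arr a) ∧ σ.Bdd w ∧
      ∀ v : Fin n, σ.arr 1 v = σ.reg 3 ↔ v ∈ S := by
  obtain ⟨M, hM1, hM2, hM⟩ := Guess.exists_result G hn
  set σ₁ := σ₀.setReg 18 (n * n) with hσ₁
  have x1 : Exec (.set 18 (.op .mul (.reg 0) (.reg 0))) (setCost (.op .mul (.reg 0) (.reg 0)) w)
      σ₀ σ₁ := Exec.set (by decide) hb (by simp [XExpr.eval, Op.eval, h0])
  have b1 : σ₁.Bdd w := hb.setReg (by norm_num) ((Nat.size_le_size hnw).trans (size_le_self w))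
  set σ₂ := σ₁.setReg 14 1 with hσ₂
  have x2 : Exec (.set 14 (.const 1)) (setCost (.const 1) w) σ₁ σ₂ :=
    Exec.set (by decide) b1 rfl
  have b2 : σ₂.Bdd w := b1.setReg (by norm_num) (by simpa using hw)
  let I : State → Prop := fun τ => ∃ (m : ℕ) (p : Guess n) (e : ℕ), m ≤ M ∧
    GuessInv σ₀ w m p e τ ∧ (m = 0 ∧ p.fail = 1 ∨ 1 ≤ m ∧ p = Guess.result G hn m)
  have hI : I σ₂ := by
    refine ⟨0, ⟨univ, 0, 1⟩, 0, Nat.zero_le _, ⟨fun y hy => ?_, fun a ha => rfl, b2, ?_, ?_, ?_, ?_,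
      ?_, ?_, fun i => (h1 i).le, fun v => ?_⟩, Or.inl ⟨rfl, rfl⟩⟩
    · simp [hσ₂, hσ₁, show y ≠ 18 by omega, show y ≠ 14 by omega]
    all_goals simp [hσ₂, hσ₁, h3, h13, h15, h17, h1]
  obtain ⟨σ, x3, ⟨m, p, e, hm, hinv, hp⟩, hend⟩ := Exec.whileLt (x := 13) (y := 14)
    (P := guessLoop) (w := w) (T := guessLoopCost w) (by norm_num) (by norm_num) I
    (fun τ => M - τ.reg 3) (fun τ ⟨_, _, _, _, hτ, _⟩ => hτ.bdd)
    (fun τ ⟨m, p, e, hm, hτ, hp⟩ hlt => by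
      have hlt' : m < M := by
        refine lt_of_le_of_ne hm ?_
        rintro rfl
        rcases hp with ⟨h0, -⟩ | ⟨-, rfl⟩
        · omega
        · rw [hτ.reg_zero, hτ.fail, hM] at hlt
          omega
      obtain ⟨τ', hx, hτ'⟩ := exec_guessLoop (hn := hn) h0 hadj hw hnw
        ((Nat.size_le.2 (show m + 1 < 2 ^ (twinCoverNumber G + 1) by omega)).trans hτw) hτ
      exact ⟨τ', hx, ⟨m + 1, _, _, hlt', hτ', Or.inr ⟨by omega, rfl⟩⟩, by
        rw [hτ'.reg_three, hτ.reg_three]; omega⟩) hI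
  rw [hinv.fail, hinv.reg_zero] at hend
  rcases hp with ⟨-, hp⟩ | ⟨hm1, rfl⟩
  · omega
  obtain ⟨hS, hcard⟩ := Guess.result_sound hm1 (Nat.le_zero.1 hend)
  refine ⟨σ, _, (x1.seq (x2.seq x3)).mono ?_, hS, ?_, hinv.reg, hinv.arr, hinv.bdd,
    fun v => by rw [hinv.reg_three]; exact hinv.chosen v⟩
  · have hμ : M - σ₂.reg 3 + 1 ≤ 2 ^ (twinCoverNumber G + 1) := by omega
    have hpos : 1 ≤ 2 ^ (twinCoverNumber G + 1) := Nat.one_le_two_pow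
    simp only [coverCost, mul_add]
    have h4 := Nat.mul_le_mul_right (testCost w + guessLoopCost w) hμ
    have h5 : ∀ c, c ≤ 2 ^ (twinCoverNumber G + 1) * c := fun c => Nat.le_mul_of_pos_left c hpos
    have h6 := h5 (setCost (.op .mul (.reg 0) (.reg 0)) w)
    have h7 := h5 (setCost (.const 1) w)
    rw [mul_add (2 ^ (twinCoverNumber G + 1))] at h4
    linarith
  · have : 2 ^ (Guess.result G hn m).chosen.card < 2 ^ (twinCoverNumber G + 1) := by omega
    exact Nat.lt_succ_iff.1 ((Nat.pow_lt_pow_iff_right (by norm_num)).1 this)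

end Guess

/-! ### The algorithm -/

/-- The computation of the powers of `n + 4`. -/
def tableBody : Prog :=
  .seq (.put 2 (.reg 17) (.reg 16)) <|
  .seq (.set 16 (.op .mul (.reg 16) (.reg 4))) <|
  .set 17 (.op .add (.reg 17) (.const 1))

/-- The table of the powers of `n + 4`, up to the exponent `2 n + 3`. -/
def tableProg : Prog :=
  .seq (.set 4 (.op .add (.reg 0) (.const 4))) <|
  .seq (.set 16 (.const 1)) <|
  .seq (.set 17 (.const 0)) <|
  .seq (.set 18 (.op .add (.op .mul (.const 2) (.reg 0)) (.const 4))) <|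
  .whileLt 17 18 tableBody

/-- The time for one power. -/
def tableBodyCost (w : ℕ) : ℕ :=
  putCost (.reg 17) (.reg 16) w + (setCost (.op .mul (.reg 16) (.reg 4)) w +
    setCost (.op .add (.reg 17) (.const 1)) w)

/-- The time for the table. -/
def tableCost (w : ℕ) : ℕ :=
  setCost (.op .add (.reg 0) (.const 4)) w + (setCost (.const 1) w + (setCost (.const 0) w +
    (setCost (.op .add (.op .mul (.const 2) (.reg 0)) (.const 4)) w +
      (w + 1) * (testCost w + tableBodyCost w))))

theorem polyBdd_tableCost : PolyBdd tableCost :=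
  (polyBdd_setCost _).add ((polyBdd_setCost _).add ((polyBdd_setCost _).add
    ((polyBdd_setCost _).add ((PolyBdd.id.add (.const 1)).mul (polyBdd_testCost.add
      ((polyBdd_putCost _ _).add ((polyBdd_setCost _).add (polyBdd_setCost _))))))))

theorem exec_tableProg {σ₀ : State} {n w : ℕ} (h0 : σ₀.reg 0 = n) (hb : σ₀.Bdd w)
    (hnw : 2 * n + 4 ≤ w) (hpw : ((n + 4) ^ (2 * n + 4)).size ≤ w) :
    ∃ σ, Exec tableProg (tableCost w) σ₀ σ ∧ (∀ x < 4, σ.reg x = σ₀.reg x) ∧ σ.reg 4 = n + 4 ∧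
      (∀ a ≠ 2, σ.arr a = σ₀.arr a) ∧ σ.Bdd w ∧ ∀ i < 2 * n + 4, σ.arr 2 i = (n + 4) ^ i := by
  have hsz : ∀ m ≤ w, m.size ≤ w := fun m hm => (size_le_self m).trans hm
  set σ₁ := σ₀.setReg 4 (n + 4) with hσ₁
  have x1 : Exec (.set 4 (.op .add (.reg 0) (.const 4)))
      (setCost (.op .add (.reg 0) (.const 4)) w) σ₀ σ₁ :=
    Exec.set (by decide) hb (by simp [XExpr.eval, Op.eval, h0])
  have b1 : σ₁.Bdd w := hb.setReg (by norm_num) (hsz _ (by omega))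
  set σ₂ := σ₁.setReg 16 1 with hσ₂
  have x2 : Exec (.set 16 (.const 1)) (setCost (.const 1) w) σ₁ σ₂ :=
    Exec.set (by decide) b1 rfl
  have b2 : σ₂.Bdd w := b1.setReg (by norm_num) (hsz _ (by omega))
  set σ₃ := σ₂.setReg 17 0 with hσ₃
  have x3 : Exec (.set 17 (.const 0)) (setCost (.const 0) w) σ₂ σ₃ :=
    Exec.set (by decide) b2 rfl
  have b3 : σ₃.Bdd w := b2.setReg (by norm_num) (by simp)
  set σ₄ := σ₃.setReg 18 (2 * n + 4) with hσ₄
  have x4 : Exec (.set 18 (.op .add (.op .mul (.const 2) (.reg 0)) (.const 4)))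
      (setCost (.op .add (.op .mul (.const 2) (.reg 0)) (.const 4)) w) σ₃ σ₄ :=
    Exec.set (by decide) b3 (by simp [XExpr.eval, Op.eval, hσ₃, hσ₂, hσ₁, h0])
  have b4 : σ₄.Bdd w := b3.setReg (by norm_num) (hsz _ hnw)
  let I : State → Prop := fun τ => τ.reg 17 ≤ 2 * n + 4 ∧ τ.reg 18 = 2 * n + 4 ∧
    τ.reg 4 = n + 4 ∧ τ.reg 16 = (n + 4) ^ τ.reg 17 ∧ (∀ x < 4, τ.reg x = σ₀.reg x) ∧
    (∀ a ≠ 2, τ.arr a = σ₀.arr a) ∧ τ.Bdd w ∧ ∀ i < τ.reg 17, τ.arr 2 i = (n + 4) ^ i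
  have hI : I σ₄ := by
    refine ⟨?_, ?_, ?_, ?_, fun x hx => ?_, fun a ha => rfl, b4, fun i hi => ?_⟩
    · simp [hσ₄, hσ₃]
    · simp [hσ₄]
    · simp [hσ₄, hσ₃, hσ₂, hσ₁]
    · simp [hσ₄, hσ₃, hσ₂]
    · simp [hσ₄, hσ₃, hσ₂, hσ₁, show x ≠ 18 by omega, show x ≠ 17 by omega, show x ≠ 16 by omega,
        show x ≠ 4 by omega]
    · simp [hσ₄, hσ₃] at hi
  obtain ⟨σ, x5, ⟨h17, h18, h4, -, hreg, harr, hbd, hpow⟩, hend⟩ := Exec.whileLt (x := 17) (y := 18)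
    (P := tableBody) (w := w) (T := tableBodyCost w) (by norm_num) (by norm_num) I
    (fun τ => 2 * n + 4 - τ.reg 17) (fun τ hτ => hτ.2.2.2.2.2.2.1)
    (fun τ ⟨h17, h18, h4, h16, hreg, harr, hbd, hpow⟩ hlt => by
      rw [h18] at hlt
      set τ₁ := τ.setArr 2 (τ.reg 17) (τ.reg 16) with hτ₁
      have y1 : Exec (.put 2 (.reg 17) (.reg 16)) (putCost (.reg 17) (.reg 16) w) τ τ₁ :=
        Exec.put (by decide) (by decide) hbd rfl rfl
      have c1 : τ₁.Bdd w := hbd.setArr (hbd.reg 16 (by norm_num))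
      set τ₂ := τ₁.setReg 16 ((n + 4) ^ (τ.reg 17 + 1)) with hτ₂
      have y2 : Exec (.set 16 (.op .mul (.reg 16) (.reg 4)))
          (setCost (.op .mul (.reg 16) (.reg 4)) w) τ₁ τ₂ :=
        Exec.set (by decide) c1 (by simp [XExpr.eval, Op.eval, hτ₁, h16, h4, pow_succ])
      have c2 : τ₂.Bdd w := c1.setReg (by norm_num)
        ((Nat.size_le_size (Nat.pow_le_pow_right (by omega) hlt)).trans hpw)
      set τ₃ := τ₂.setReg 17 (τ.reg 17 + 1) with hτ₃
      have y3 : Exec (.set 17 (.op .add (.reg 17) (.const 1)))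
          (setCost (.op .add (.reg 17) (.const 1)) w) τ₂ τ₃ :=
        Exec.set (by decide) c2 (by simp [XExpr.eval, Op.eval, hτ₂, hτ₁])
      have c3 : τ₃.Bdd w := c2.setReg (by norm_num) (hsz _ (by omega))
      refine ⟨τ₃, y1.seq (y2.seq y3), ⟨?_, ?_, ?_, ?_, fun x hx => ?_, fun a ha => ?_, c3,
        fun i hi => ?_⟩, ?_⟩
      · simpa [hτ₃] using Nat.succ_le_of_lt hlt
      · simp [hτ₃, hτ₂, hτ₁, h18]
      · simp [hτ₃, hτ₂, hτ₁, h4]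
      · simp [hτ₃, hτ₂]
      · rw [← hreg x hx]
        simp [hτ₃, hτ₂, hτ₁, show x ≠ 17 by omega, show x ≠ 16 by omega]
      · rw [← harr a ha]
        ext i
        simp [hτ₃, hτ₂, hτ₁, ha]
      · simp only [hτ₃, State.setReg_reg, if_true] at hi
        simp only [hτ₃, hτ₂, hτ₁, State.setReg_arr, State.setArr_arr, true_and]
        split_ifs with h
        · rw [h16, h]
        · exact hpow i (by omega)
      · simp only [hτ₃, State.setReg_reg, if_true]
        omega) hI
  rw [h18] at hend
  refine ⟨σ, x1.seq (x2.seq (x3.seq (x4.seq (x5.mono ?_)))), hreg, h4, harr, hbd,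
    fun i hi => hpow i (by omega)⟩
  exact Nat.mul_le_mul_right _ (by omega)

open XExpr in
/-- The algorithm: a search through the configurations of the dynamic program for a minimum twin
cover. If `n < r`, then there are no units, and the answer is known. -/
def mainProg : Prog :=
  .cond (.op .lt (.reg 0) (.reg 1)) (.set 0 (.op .eq (.reg 0) (.const 0))) <|
  .seq coverProg <|
  .seq tableProg <|
  .seq (.set 9 (.const 0)) <|
  .seq (.set 5 (.op .mul (.const 6) (.op .mul (.reg 0) (.reg 0)))) <|
  .seq (searchProg (nextE 20) (tidyE 20 10) (acceptE 20 9)) <|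
  .set 0 (.reg 12)

section Correctness

variable {n : ℕ} {G : SimpleGraph (Fin n)} {r k : ℕ}

theorem hasGroupedDominatingSet_of_lt (h : n < r) : HasGroupedDominatingSet G r k ↔ n = 0 := by
  constructor
  · rintro ⟨𝒟, -, hu, -, hd⟩
    by_contra hn
    have hno : ∀ D, D ∉ 𝒟 := fun D hD => by
      have := Finset.card_le_univ D
      rw [(hu D hD).1, Fintype.card_fin] at this
      omega
    rcases hd ⟨0, by omega⟩ with ⟨D, hD, -⟩ | ⟨u, ⟨D, hD, -⟩, -⟩ <;> exact hno D hD
  · rintro rfl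
    exact ⟨∅, by simp, by simp, by simp, fun v => v.elim0⟩

theorem twinCoverNumber_le (G : SimpleGraph (Fin n)) : twinCoverNumber G ≤ n := by
  obtain ⟨S, -, hc⟩ := exists_twinCover_card_eq G
  rw [← hc]
  exact (Finset.card_le_univ S).trans_eq (Fintype.card_fin n)

theorem IsTwinCover.twinCoverNumber_le {S : Finset (Fin n)} (hS : IsTwinCover G S) :
    twinCoverNumber G ≤ S.card :=
  Nat.sInf_le ⟨S, hS, rfl⟩

theorem initState_adj (u v : Fin n) : (initState G r k).arr 0 (u * n + v) ≠ 0 ↔ G.Adj u v := by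
  classical
  have hn : 0 < n := u.pos
  simp only [initState, true_and, ne_eq, ite_eq_right_iff, one_ne_zero, imp_false, not_not]
  constructor
  · rintro ⟨u', v', h, he⟩
    have h1 := congrArg (· / n) he
    have h2 := congrArg (· % n) he
    simp only [add_comm _ (v : ℕ), add_comm _ (v' : ℕ), Nat.add_mul_div_right _ _ hn, Nat.div_eq_of_lt v.2,
      Nat.div_eq_of_lt v'.2, Nat.add_mul_mod_self_right, Nat.mod_eq_of_lt v.2,
      Nat.mod_eq_of_lt v'.2, zero_add] at h1 h2
    rwa [Fin.ext h1, Fin.ext h2]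
  · exact fun h => ⟨u, v, h, rfl⟩

theorem size_pow_le (a b : ℕ) : (a ^ b).size ≤ b * a.size + 1 := by
  rw [Nat.size_le, pow_succ, mul_comm b, pow_mul]
  have h : a ^ b ≤ (2 ^ a.size) ^ b := Nat.pow_le_pow_left (Nat.size_le.1 le_rfl).le b
  have : 0 < (2 ^ a.size) ^ b := by positivity
  omega

/-- A bound for the length of all numbers that the algorithm handles, for input size `N`; the
product bounds the length of the codes, which are below `(n + 4) ^ (2 n + 4)`. -/
def wordSize (N : ℕ) : ℕ := 6 * N + ((2 * N + 4) * (N + 4) + 1)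

theorem polyBdd_wordSize : PolyBdd wordSize :=
  ((PolyBdd.const 6).mul .id).add (((((PolyBdd.const 2).mul .id).add (.const 4)).mul
    (PolyBdd.id.add (.const 4))).add (.const 1))

open Classical in
/-- Correctness and running time of the search, once the twin cover `S` is known. -/
theorem exec_search {S : Finset (Fin n)} (hS : IsTwinCover G S) (hn : 0 < n) (hr : 1 ≤ r)
    {T : Finset (Config n)} (hT : ∀ st, Reach G S r hn st → st ∈ T) {w : ℕ} (hw : 1 ≤ w)
    (hnw : 6 * (n * n) ≤ w) (hpw : ((n + 4) ^ (2 * n + 4)).size ≤ w) {σ₀ : State} (hb : σ₀.Bdd w)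
    (h0 : σ₀.reg 0 = n) (h1 : σ₀.reg 1 = r) (h2 : σ₀.reg 2 = k) (h4 : σ₀.reg 4 = n + 4)
    (h5 : σ₀.reg 5 = 6 * (n * n)) (h9 : σ₀.reg 9 = 0)
    (hadj : ∀ u v : Fin n, σ₀.arr 0 (u * n + v) ≠ 0 ↔ G.Adj u v)
    (hcov : ∀ v : Fin n, σ₀.arr 1 v = σ₀.reg 3 ↔ v ∈ S)
    (hpow : ∀ i < 2 * n + 4, σ₀.arr 2 i = (n + 4) ^ i) (h3 : ∀ i, σ₀.arr 3 i = 0) :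
    ∃ σ, Exec (searchProg (nextE 20) (tidyE 20 10) (acceptE 20 9))
      ((T.card + 1) * searchCost (nextE 20) (tidyE 20 10) (acceptE 20 9) w) σ₀ σ ∧
      σ.Bdd w ∧ σ.reg 12 = if HasGroupedDominatingSet G r k then 1 else 0 := by
  have hctx : ∀ q < 20, ∀ σ, σ₀.SameInput σ →
      Ctx G S r k hn 20 q σ (Config.decode hn (σ.reg q)) := fun q hq σ h =>
    { reg_zero := (h.1 0 (by norm_num)).trans h0
      adj := fun u v => by rw [h.2 0 (by norm_num) (by norm_num)]; exact hadj u v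
      cover := fun v => by
        rw [h.2 1 (by norm_num) (by norm_num), h.1 3 (by norm_num)]; exact hcov v
      free := le_rfl
      reg_one := (h.1 1 (by norm_num)).trans h1
      reg_two := (h.1 2 (by norm_num)).trans h2
      reg_four := (h.1 4 (by norm_num)).trans h4
      pow := fun i hi => by rw [h.2 2 (by norm_num) (by norm_num)]; exact hpow i hi
      lt_free := hq
      code := rfl }
  set R : Finset ℕ := (T.filter (Reach G S r hn)).image Config.code with hR
  have hlt : ∀ {s}, Visited (nextCode G S r hn) (fun t => (Config.decode hn t).Tidy r)
      (6 * (n * n)) 0 s → s < (n + 4) ^ (2 * n + 4) := by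
    intro s hs
    obtain ⟨st, hst, rfl⟩ := (visited_iff hS hr).1 hs
    exact (hst.valid hS hr).code_lt
  have hRlt : R ⊆ range ((n + 4) ^ (2 * n + 4)) := by
    intro s hs
    obtain ⟨st, hst, rfl⟩ := Finset.mem_image.1 hs
    exact Finset.mem_range.2 ((Finset.mem_filter.1 hst).2.valid hS hr).code_lt
  have hRcard : R.card ≤ (n + 4) ^ (2 * n + 4) := by
    simpa using Finset.card_le_card hRlt
  obtain ⟨σ, hx, hbd, h12⟩ := exec_searchProg (N := nextCode G S r hn)
    (ok := fun t => (Config.decode hn t).Tidy r)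
    (acc := fun t => (Config.decode hn t).Accept G S r k) (L := 6 * (n * n)) (s₀ := 0) (R := R)
    ok64_nextE ok64_tidyE ok64_acceptE hw
    (fun s hs => by
      obtain ⟨st, hst, rfl⟩ := (visited_iff hS hr).1 hs
      exact Finset.mem_image_of_mem _ (Finset.mem_filter.2 ⟨hT st hst, hst⟩))
    ((Nat.size_le_size hRcard).trans hpw) hnw
    (fun s c hs hc => by
      rw [nextCode]
      obtain ⟨st, hst, rfl⟩ := (visited_iff hS hr).1 hs
      rw [(hst.valid hS hr).decode_code hn]
      split_ifs with hcan
      · obtain ⟨g, hg⟩ := hst.exists_matches hS hr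
        obtain ⟨g', hg'⟩ := hg.exists_apply hS hr hcan
        exact (Nat.size_le_size (hg'.valid hr).code_lt.le).trans hpw
      · exact (Nat.size_le_size (hlt hs).le).trans hpw)
    (fun σ h _ _ => ((hctx 9 (by norm_num) σ h).nextE rfl).eval)
    (fun σ s c h _ _ _ => (hctx 10 (by norm_num) σ h).tidyE.eval)
    (fun σ h _ => (hctx 9 (by norm_num) σ h).acceptE.eval) hb h9 h5 h3
  refine ⟨σ, hx.mono (Nat.mul_le_mul_right _ (Nat.succ_le_succ
    (Finset.card_image_le.trans (Finset.card_filter_le _ _)))), hbd, h12.trans ?_⟩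
  refine if_congr ?_ rfl rfl
  rw [hasGroupedDominatingSet_iff hS hr hn]
  constructor
  · rintro ⟨s, hs, hacc⟩
    obtain ⟨st, hst, rfl⟩ := (visited_iff hS hr).1 hs
    rw [(hst.valid hS hr).decode_code hn] at hacc
    exact ⟨st, hst, hacc⟩
  · rintro ⟨st, hst, hacc⟩
    exact ⟨_, (visited_iff hS hr).2 ⟨st, hst, rfl⟩, by rwa [(hst.valid hS hr).decode_code hn]⟩

/-- The time of the algorithm apart from the search for a twin cover and the search through the
configurations. -/
def overheadCost (w : ℕ) : ℕ :=
  (XExpr.op .lt (.reg 0) (.reg 1)).costBound w +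
    (2 + (XExpr.op .lt (.reg 0) (.reg 1)).sizeBound w) +
  (setCost (.op .eq (.reg 0) (.const 0)) w + (tableCost w + (setCost (.const 0) w +
    (setCost (.op .mul (.const 6) (.op .mul (.reg 0) (.reg 0))) w + setCost (.reg 12) w))))

theorem polyBdd_overheadCost : PolyBdd overheadCost :=
  ((XExpr.polyBdd_costBound _).add ((PolyBdd.const 2).add (XExpr.polyBdd_sizeBound _))).add
    ((polyBdd_setCost _).add (polyBdd_tableCost.add ((polyBdd_setCost _).add
      ((polyBdd_setCost _).add (polyBdd_setCost _)))))

open Classical in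
/-- Correctness and running time of the algorithm, in terms of the number of configurations. -/
theorem exec_mainProg (hr : 1 ≤ r) {w C : ℕ} (hw : w = wordSize (inputSize n r k))
    (hC : ∀ (hn : 0 < n) (S : Finset (Fin n)), IsTwinCover G S → S.card = twinCoverNumber G →
      ∃ T : Finset (Config n), (∀ st, Reach G S r hn st → st ∈ T) ∧ T.card ≤ C) :
    ∃ σ, Exec mainProg (overheadCost w + 2 ^ (twinCoverNumber G + 1) * coverCost w +
        (C + 1) * searchCost (nextE 20) (tidyE 20 10) (acceptE 20 9) w) (initState G r k) σ ∧
      σ.reg 0 = if HasGroupedDominatingSet G r k then 1 else 0 := by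
  set σ₀ := initState G r k with hσ₀
  set N := inputSize n r k with hN
  have hnN : n * n ≤ N := by rw [hN, inputSize]; omega
  have hn1 : n ≤ N := (Nat.le_mul_self n).trans hnN
  have hrN : r.size ≤ N := by rw [hN, inputSize]; omega
  have hkN : k.size ≤ N := by rw [hN, inputSize]; omega
  have hw' : w = 6 * N + ((2 * N + 4) * (N + 4) + 1) := hw
  have hNN : 2 * N + 4 ≤ (2 * N + 4) * (N + 4) := Nat.le_mul_of_pos_right _ (by omega)
  have r0 : σ₀.reg 0 = n := by simp [hσ₀, initState]
  have r1 : σ₀.reg 1 = r := by simp [hσ₀, initState]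
  have r2 : σ₀.reg 2 = k := by simp [hσ₀, initState]
  have r3 : ∀ x, 3 ≤ x → σ₀.reg x = 0 := fun x hx => by
    simp [hσ₀, initState, show x ≠ 0 by omega, show x ≠ 1 by omega, show x ≠ 2 by omega]
  have a1 : ∀ a ≠ 0, ∀ i, σ₀.arr a i = 0 := fun a ha i => by simp [hσ₀, initState, ha]
  have b0 : σ₀.Bdd w := by
    refine ⟨by omega, fun x _ => ?_, fun a i => ?_⟩
    · rcases Nat.lt_or_ge x 3 with hx | hx
      · interval_cases x
        · rw [r0]; have := size_le_self n; omega
        · rw [r1]; omega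
        · rw [r2]; omega
      · rw [r3 x hx]; simp
    · simp only [hσ₀, initState]
      split_ifs <;> simp
      omega
  by_cases hlt : n < r
  · have x1 : Exec (.set 0 (.op .eq (.reg 0) (.const 0)))
        (setCost (.op .eq (.reg 0) (.const 0)) w) σ₀ (σ₀.setReg 0 (if n = 0 then 1 else 0)) :=
      Exec.set (by decide) b0 (by simp [XExpr.eval, Op.eval, r0])
    refine ⟨_, (Exec.cond_true (by decide) b0 (by simp [XExpr.eval, Op.eval, r0, r1, hlt]) x1).mono
      ?_, ?_⟩
    · simp only [overheadCost]
      omega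
    · simp [hasGroupedDominatingSet_of_lt hlt]
  · have hn : 0 < n := by omega
    have hpw : ((n + 4) ^ (2 * n + 4)).size ≤ w := by
      refine (size_pow_le _ _).trans ?_
      have : (2 * n + 4) * (n + 4).size ≤ (2 * N + 4) * (N + 4) :=
        Nat.mul_le_mul (by omega) ((size_le_self _).trans (by omega))
      omega
    have hτ := twinCoverNumber_le G
    obtain ⟨σ₁, S, x1, hS, hcard, reg1, arr1, b1, cov1⟩ := exec_coverProg hn r0
      (fun u v => initState_adj u v) (show 1 ≤ w by omega) (by omega) (by omega) b0
      (r3 3 (by norm_num)) (r3 13 (by norm_num)) (r3 15 (by norm_num)) (r3 17 (by norm_num))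
      (a1 1 (by norm_num))
    have r0' : σ₁.reg 0 = n := (reg1 0 (by norm_num)).trans r0
    obtain ⟨σ₂, x2, reg2, r4, arr2, b2, pow2⟩ := exec_tableProg r0' b1 (by omega) hpw
    have r0'' : σ₂.reg 0 = n := (reg2 0 (by norm_num)).trans r0'
    set σ₃ := σ₂.setReg 9 0 with hσ₃
    have x3 : Exec (.set 9 (.const 0)) (setCost (.const 0) w) σ₂ σ₃ :=
      Exec.set (by decide) b2 rfl
    have b3 : σ₃.Bdd w := b2.setReg (by norm_num) (by simp)
    set σ₄ := σ₃.setReg 5 (6 * (n * n)) with hσ₄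
    have x4 : Exec (.set 5 (.op .mul (.const 6) (.op .mul (.reg 0) (.reg 0))))
        (setCost (.op .mul (.const 6) (.op .mul (.reg 0) (.reg 0))) w) σ₃ σ₄ :=
      Exec.set (by decide) b3 (by simp [XExpr.eval, Op.eval, hσ₃, r0''])
    have b4 : σ₄.Bdd w := b3.setReg (by norm_num)
      ((size_le_self _).trans (by omega))
    obtain ⟨T, hT, hTC⟩ := hC hn S hS (le_antisymm hcard hS.twinCoverNumber_le)
    have reg4 : ∀ x < 4, σ₄.reg x = σ₂.reg x := fun x hx => by
      simp [hσ₄, hσ₃, show x ≠ 5 by omega, show x ≠ 9 by omega]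
    obtain ⟨σ₅, x5, b5, h12⟩ := exec_search (σ₀ := σ₄) (k := k) (w := w) hS hn hr hT
      (by omega) (by omega) hpw b4 ((reg4 0 (by norm_num)).trans r0'')
      (by rw [reg4 1 (by norm_num), reg2 1 (by norm_num), reg1 1 (by norm_num), r1])
      (by rw [reg4 2 (by norm_num), reg2 2 (by norm_num), reg1 2 (by norm_num), r2])
      (by simpa [hσ₄, hσ₃] using r4) (by simp [hσ₄]) (by simp [hσ₄, hσ₃])
      (fun u v => by
        show σ₂.arr 0 _ ≠ 0 ↔ _
        rw [arr2 0 (by norm_num), arr1 0 (by norm_num)]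
        exact initState_adj u v)
      (fun v => by
        show σ₂.arr 1 _ = _ ↔ _
        rw [arr2 1 (by norm_num), reg4 3 (by norm_num), reg2 3 (by norm_num)]
        exact cov1 v)
      pow2
      (fun i => by
        show σ₂.arr 3 i = 0
        rw [arr2 3 (by norm_num), arr1 3 (by norm_num), a1 3 (by norm_num)])
    have x6 : Exec (.set 0 (.reg 12)) (setCost (.reg 12) w) σ₅ (σ₅.setReg 0 (σ₅.reg 12)) :=
      Exec.set (by decide) b5 rfl
    refine ⟨_, (Exec.cond_false (by decide) b0 (by simp [XExpr.eval, Op.eval, r0, r1, hlt])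
      (x1.seq (x2.seq (x3.seq (x4.seq (x5.seq x6)))))).mono ?_, by simpa using h12⟩
    have := Nat.mul_le_mul_right (searchCost (nextE 20) (tidyE 20 10) (acceptE 20 9) w)
      (Nat.succ_le_succ hTC)
    simp only [overheadCost, Nat.succ_eq_add_one] at *
    omega

end Correctness

/-- The problem is solvable in time `O*(f τ r)` if there are at most `f τ r` configurations, up to
a factor that is polynomial in `n`. -/
theorem solvableInOStar_of_configs {R : Set ℕ} {f : ℕ → ℕ → ℕ} (q : Polynomial ℕ)
    (hf : ∀ τ r, r ∈ R → 1 ≤ r → 2 ^ τ ≤ f τ r)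
    (hC : ∀ (n : ℕ) (G : SimpleGraph (Fin n)) (S : Finset (Fin n)) (r : ℕ) (hn : 0 < n), r ∈ R →
      1 ≤ r → IsTwinCover G S → ∃ T : Finset (Config n), (∀ st, Reach G S r hn st → st ∈ T) ∧
        T.card ≤ f S.card r * q.eval n) :
    SolvableInOStar R f := by
  obtain ⟨p₁, h₁⟩ := polyBdd_overheadCost.comp polyBdd_wordSize
  obtain ⟨p₂, h₂⟩ := polyBdd_coverCost.comp polyBdd_wordSize
  obtain ⟨p₃, h₃⟩ :=
    (polyBdd_searchCost (nextE 20) (tidyE 20 10) (acceptE 20 9)).comp polyBdd_wordSize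
  refine ⟨mainProg, p₁ + 2 * p₂ + (q + 1) * p₃, fun n G r k hrR hr _ => ?_⟩
  set N := inputSize n r k with hN
  set F := f (twinCoverNumber G) r with hF
  have hnN : n ≤ N := (Nat.le_mul_self n).trans (by rw [hN, inputSize]; omega)
  obtain ⟨σ, hx, h0⟩ := exec_mainProg (G := G) (k := k) hr (w := wordSize N)
    (C := F * q.eval N) rfl (fun hn S hS hc => by
      obtain ⟨T, hT, hcard⟩ := hC n G S r hn hrR hr hS
      exact ⟨T, hT, hcard.trans (by
        rw [hc]; exact Nat.mul_le_mul_left _ (PolyBdd.monotone_eval q hnN))⟩)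
  obtain ⟨t, τ, hrun, ht, hτ⟩ := hx _ (State.Eqv.refl _)
  refine ⟨t, τ, hrun, ht.trans ?_, by rw [hτ.1 0 (by norm_num), h0]⟩
  have hF2 : 2 ^ twinCoverNumber G ≤ F := hf _ r hrR hr
  have hF1 : 1 ≤ F := Nat.one_le_two_pow.trans hF2
  simp only [Polynomial.eval_add, Polynomial.eval_mul, Polynomial.eval_one, Polynomial.eval_ofNat]
  rw [pow_succ]
  calc _ ≤ F * p₁.eval N + F * 2 * p₂.eval N + (F * q.eval N + F) * p₃.eval N := by
        gcongr
        · exact (h₁ N).trans (Nat.le_mul_of_pos_left _ hF1)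
        · exact h₂ N
        · exact h₃ N
    _ = _ := by ring

theorem add_three_pow_le (τ : ℕ) : (τ + 3) ^ τ ≤ 2 * (2 * τ) ^ τ := by
  rcases Nat.lt_or_ge τ 3 with h | h
  · interval_cases τ <;> norm_num
  · have := Nat.pow_le_pow_left (show τ + 3 ≤ 2 * τ by omega) τ
    omega

theorem solvableInOStar_of_one_le :
    SolvableInOStar {r : ℕ | 1 ≤ r} (fun τ r => (2 * τ * (r + 1)) ^ τ) := by
  refine solvableInOStar_of_configs
    (2 * (Polynomial.X * ((Polynomial.X + 1) * ((Polynomial.X + 1) * (Polynomial.X + 1)))))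
    (fun τ r _ hr => ?_) (fun n G S r hn _ hr hS => ?_)
  · rcases Nat.eq_zero_or_pos τ with rfl | hτ
    · simp
    · refine Nat.pow_le_pow_left ?_ τ
      calc 2 = 2 * 1 * 1 := rfl
        _ ≤ 2 * τ * (r + 1) := by gcongr <;> omega
  · obtain ⟨T, hT, hcard⟩ := exists_configs (hn := hn) hS hr
    refine ⟨T, hT, hcard.trans ?_⟩
    simp only [Polynomial.eval_add, Polynomial.eval_mul, Polynomial.eval_one,
      Polynomial.eval_ofNat, Polynomial.eval_X]
    rw [mul_pow, mul_pow (2 * S.card)]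
    calc _ ≤ (2 * (2 * S.card) ^ S.card) * (r + 1) ^ S.card *
          (n * ((n + 1) * ((n + 1) * (n + 1)))) := by
          gcongr
          exact add_three_pow_le _
      _ = _ := by ring

theorem solvableInOStar_two_three : SolvableInOStar {2, 3} (fun τ r => (r + 1) ^ τ) := by
  refine solvableInOStar_of_configs
    ((Polynomial.X * ((Polynomial.X + 3) * 4)) ^ 3 *
      (Polynomial.X * ((Polynomial.X + 1) * ((Polynomial.X + 1) * (Polynomial.X + 1)))))
    (fun τ r _ hr => Nat.pow_le_pow_left (by omega) τ) (fun n G S r hn hrR hr hS => ?_)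
  have hr' : r = 2 ∨ r = 3 := hrR
  obtain ⟨T, hT, hcard⟩ := exists_configs_tidy (hn := hn) hS hr'
  refine ⟨T, hT, hcard.trans ?_⟩
  simp only [Polynomial.eval_add, Polynomial.eval_mul, Polynomial.eval_one, Polynomial.eval_pow,
    Polynomial.eval_ofNat, Polynomial.eval_X]
  gcongr
  omega

end GroupedDom

theorem mainTheorem1 :
    GroupedDom.SolvableInOStar {r : ℕ | 1 ≤ r} (fun τ r => (2 * τ * (r + 1)) ^ τ) ∧
    GroupedDom.SolvableInOStar {2, 3} (fun τ r => (r + 1) ^ τ) :=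
  ⟨GroupedDom.solvableInOStar_of_one_le, GroupedDom.solvableInOStar_two_three⟩
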